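/- **Setting.** Let $d\ge 1$, $s\in(0,1]$, $r=|x|$, $\omega=x/r$, $\langle x\rangle=(1+|x|^2)^{1/2}$, and let $q\in C^\infty(\mathbb R^d;\mathbb R)$ be such that for some $\rho\in(0,1)$ and constants $C_k>0$, for all $k\ge 0$, $$|\nabla^k q|\le C_k\langle x\rangle^{2s-k-\rho}\ \ (s<1),\qquad |\nabla^k q|\le C_k(\log\langle x\rangle)^{-1-\rho}\langle x\rangle^{2-k}\ \ (s=1,\ x\ne 0).$$ For $\hbar>0$ consider $H=-\tfrac{\hbar^2}{2}\Delta-\tfrac12|x|^{2s}+q(x)$ on $L^2(\mathbb R^d)$. **Distortion.** Fix $\chi_1\in C^\infty(\mathbb R;[0,1])$ with $\chi_1(t)=0$ for $t\le 1$ and $\chi_1(t)=1$ for $t\ge 2$, and for $R>0$ put $\chi_R(t)=\chi_1(t/R^{2s})$, $$r_\theta=\begin{cases}(r^{2s}+2s\theta\chi_R(r^{2s}))^{1/(2s)}&s<1,\\(r^2+2\theta\chi_R(r^2)\log r)^{1/2}&s=1,\end{cases}\qquad J=\begin{cases}(r_\theta/r)^{d-2s}(1+2s\theta\chi_R'(r^{2s}))&s<1,\\(r_\theta/r)^{d-2}(1+\theta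 r^{-2}\chi_R(r^2)+2\theta\log r\,\chi_R'(r^2))&s=1.\end{cases}$$ For small real $\theta$, $(U_\theta u)(r\omega)=J^{1/2}u(r_\theta\omega)$ is unitary. Put $q_\theta(r\omega)=q(r_\theta\omega)$. Assume that, for some $\ell,\beta_0>0$, $\theta\mapsto q_\theta(x)$, $|\theta|<\ell$ real, extends for each $x\in\mathbb R^d$ analytically to $\{\theta\in\mathbb C:|\theta|<\ell,\ |\operatorname{Im}\theta|<\beta_0\}$, uniformly in $x$ (that is, $q_\theta-q$ is bounded uniformly in $x$ and in $\theta$ on compact subsets of this region). For complex $\theta$ let $H_\theta$ be the closure, from $C_c^\infty(\mathbb R^d)$, of $U_\theta HU_\theta^{-1}$ continued to complex $\theta$ (principal branches), that is, of $\tfrac{\hbar^2}{2}U_\theta(-\Delta)U_\theta^{-1}-\tfrac12 r_\theta^{2s}+q_\theta$ with $$U_\theta(-\Delta)U_\theta^{-1}=-J^{1/2}(\tfrac{\partial r_\theta}{\partial r})^{-1}\partial_r(\tfrac{\partial r_\theta}{\partial r})^{-1}\partial_rJ^{-1/2}-(d-1)J^{1/2}r_\theta^{-1}(\tfrac{\partial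 r_\theta}{\partial r})^{-1}\partial_rJ^{-1/2}-r_\theta^{-2}\Delta_{\mathbb S^{d-1}}.$$ **Hypotheses on the energy.** Let $E\in\mathbb R$, $\mu,\alpha,\gamma>0$ and let $\chi,\tilde\chi\in C^1([0,\infty);[0,1])$ (read as functions of $r=|x|$) satisfy (i) $\chi^2+\tilde\chi^2=1$, $\chi=1$ near $0$ and, if $s=1$, $\operatorname{supp}\tilde\chi\subset\{r\ge\sqrt{\mathrm e}\}$; (ii) $-\tfrac12r^{2s}+q-E\ge\alpha$ on $\operatorname{supp}\chi$; (iii) on $\operatorname{supp}\tilde\chi$: $\;1-s-2(1-2s)r^{-2s}(q-E)-r^{1-2s}\partial_rq-\mu\ge\gamma$ if $s<1$, and $1+2r^{-2}(\log r-1)(q-E)-r^{-1}(\log r)\,\partial_rq-\mu\ge\gamma$ if $s=1$. Let $R>0$ (used in the distortion) be such that $\chi_R(r^{2s})=1$ on $\operatorname{supp}\tilde\chi$. **Conclusion.** There are $c,K>0$, $\beta_c\in(0,\min\{\ell,\beta_0\}]$ and numbers $C_{\beta,\hbar}$ such that, for all $\beta\in(0,\beta_c)$ and $\hbar>0$, $$\bigl|C_{\beta,\hbar}-(1-c\beta)\min\{\alpha,\beta\gamma\}\bigr|\le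 K(\beta^2+\hbar^2),\qquad \|(H_{i\beta}-(E-i\beta\mu))u\|\ge C_{\beta,\hbar}\|u\|\quad(u\in D(H_{i\beta})),$$ and for each $\beta\in(0,\beta_c)$ there is $\hbar_0>0$ such that for all $\hbar\in(0,\hbar_0)$ the constant $C_{\beta,\hbar}$ is strictly positive and $z=E-i\mu\beta$ is not an eigenvalue of $H_{i\beta}$, nor of $H_{i\beta'}$ for any $\beta'\in[\beta,\beta_c)$; i.e. $z$ is not a resonance of $H$. -/

import Mathlib

open Set Filter Topology MeasureTheory
open scoped ContDiff

noncomputable section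

namespace Repulsive

/-- The configuration space `ℝ^d` with its Euclidean norm. -/
abbrev Space (d : ℕ) : Type := EuclideanSpace ℝ (Fin d)

/-- The Hilbert space `L²(ℝ^d)` of complex-valued functions. -/
abbrev L2 (d : ℕ) : Type := Lp ℂ 2 (volume : Measure (Space d))

/-- Radial derivative `∂_r g (x) = ∇g(x) · x/|x|` (relevant for `x ≠ 0`). -/
def radialDeriv {d : ℕ} {F : Type*} [NormedAddCommGroup F] [NormedSpace ℝ F]
    (g : Space d → F) (x : Space d) : F :=
  fderiv ℝ g x (‖x‖⁻¹ • x)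

/-- The long-range condition on the potential. For `s = 1` the right-hand side is `+∞` at `x = 0`,
hence nothing is asked there. -/
def LongRange {d : ℕ} (s : ℝ) (q : Space d → ℝ) : Prop :=
  ContDiff ℝ ∞ q ∧
    ∃ ρ ∈ Ioo (0 : ℝ) 1, ∃ C : ℕ → ℝ, (∀ k, 0 < C k) ∧
      (s < 1 → ∀ (k : ℕ) (x : Space d),
        ‖iteratedFDeriv ℝ k q x‖ ≤ C k * √(1 + ‖x‖ ^ 2) ^ (2 * s - k - ρ)) ∧
      (s = 1 → ∀ (k : ℕ) (x : Space d), x ≠ 0 →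
        ‖iteratedFDeriv ℝ k q x‖ ≤
          C k * Real.log √(1 + ‖x‖ ^ 2) ^ (-1 - ρ) * √(1 + ‖x‖ ^ 2) ^ (2 - (k : ℝ)))

/-- A smooth step function `ℝ → [0,1]`, equal to `0` on `t ≤ 1` and to `1` on `t ≥ 2`. -/
structure IsStep (χ₁ : ℝ → ℝ) : Prop where
  smooth : ContDiff ℝ ∞ χ₁
  mem_Icc : ∀ t, χ₁ t ∈ Icc (0 : ℝ) 1
  eq_zero : ∀ t ≤ 1, χ₁ t = 0
  eq_one : ∀ t, 2 ≤ t → χ₁ t = 1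

/-- `χ_R(t) = χ₁(t / R^{2s})`. -/
def stepAt (χ₁ : ℝ → ℝ) (s R t : ℝ) : ℝ := χ₁ (t / R ^ (2 * s))

/-- The distorted radius `r_θ` for real `θ`. -/
def realRadius (χ₁ : ℝ → ℝ) (s R θ r : ℝ) : ℝ :=
  if s < 1 then (r ^ (2 * s) + 2 * s * θ * stepAt χ₁ s R (r ^ (2 * s))) ^ (1 / (2 * s))
  else √(r ^ 2 + 2 * θ * stepAt χ₁ s R (r ^ 2) * Real.log r)

/-- `r_θ^{2s}` for complex `θ`. -/
def radiusPow (χ₁ : ℝ → ℝ) (s R : ℝ) (θ : ℂ) (r : ℝ) : ℂ :=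
  if s < 1 then ((r ^ (2 * s) : ℝ) : ℂ) + 2 * s * θ * stepAt χ₁ s R (r ^ (2 * s))
  else (r : ℂ) ^ 2 + 2 * θ * stepAt χ₁ s R (r ^ 2) * Real.log r

/-- The distorted radius `r_θ` for complex `θ` (principal branch). -/
def radius (χ₁ : ℝ → ℝ) (s R : ℝ) (θ : ℂ) (r : ℝ) : ℂ :=
  radiusPow χ₁ s R θ r ^ (1 / (2 * (s : ℂ)))

/-- The derivative `∂r_θ/∂r`. -/
def radius' (χ₁ : ℝ → ℝ) (s R : ℝ) (θ : ℂ) (r : ℝ) : ℂ :=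
  deriv (fun t : ℝ => radius χ₁ s R θ t) r

/-- The Jacobian `J(θ, r)` of `rω ↦ r_θ ω`, continued to complex `θ` (principal branches). -/
def jacobian (d : ℕ) (χ₁ : ℝ → ℝ) (s R : ℝ) (θ : ℂ) (r : ℝ) : ℂ :=
  if s < 1 then
    (radius χ₁ s R θ r / r) ^ ((d : ℂ) - 2 * s) *
      (1 + 2 * s * θ * (deriv (stepAt χ₁ s R) (r ^ (2 * s)) : ℝ))
  else
    (radius χ₁ s R θ r / r) ^ ((d : ℂ) - 2) *
      (1 + θ * (r : ℂ)⁻¹ ^ 2 * stepAt χ₁ s R (r ^ 2) +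
        2 * θ * Real.log r * (deriv (stepAt χ₁ s R) (r ^ 2) : ℝ))

/-- The Laplace–Beltrami operator on the unit sphere, acting on the angular variables:
`Δ = ∂_r² + (d-1) r⁻¹ ∂_r + r⁻² Δ_S` is solved for `Δ_S`. -/
def sphereLaplacian {d : ℕ} (g : Space d → ℂ) (x : Space d) : ℂ :=
  (‖x‖ : ℂ) ^ 2 * (Laplacian.laplacian g x - radialDeriv (radialDeriv g) x
    - ((d : ℂ) - 1) / ‖x‖ * radialDeriv g x)

/-- `r_θ'⁻¹ ∂_r (J^{-1/2} g)`. -/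
def innerDeriv {d : ℕ} (χ₁ : ℝ → ℝ) (s R : ℝ) (θ : ℂ) (g : Space d → ℂ) (x : Space d) : ℂ :=
  (radius' χ₁ s R θ ‖x‖)⁻¹ *
    radialDeriv (fun y => jacobian d χ₁ s R θ ‖y‖ ^ (-(1 / 2) : ℂ) * g y) x

/-- The distorted Laplacian `U_θ (-Δ) U_θ⁻¹`, continued to complex `θ`, in polar coordinates:
`-J^{1/2} r_θ'⁻¹ ∂_r r_θ'⁻¹ ∂_r J^{-1/2} - (d-1) J^{1/2} r_θ⁻¹ r_θ'⁻¹ ∂_r J^{-1/2} - r_θ⁻² Δ_S`. -/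
def distortedNegLaplacian {d : ℕ} (χ₁ : ℝ → ℝ) (s R : ℝ) (θ : ℂ) (g : Space d → ℂ)
    (x : Space d) : ℂ :=
  -(jacobian d χ₁ s R θ ‖x‖ ^ (1 / 2 : ℂ) * (radius' χ₁ s R θ ‖x‖)⁻¹ *
      radialDeriv (innerDeriv χ₁ s R θ g) x)
    - ((d : ℂ) - 1) * jacobian d χ₁ s R θ ‖x‖ ^ (1 / 2 : ℂ) * (radius χ₁ s R θ ‖x‖)⁻¹ *
      innerDeriv χ₁ s R θ g x
    - (radius χ₁ s R θ ‖x‖)⁻¹ ^ 2 * sphereLaplacian g x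

/-- The differential expression
`H_θ = (ħ²/2) U_θ (-Δ) U_θ⁻¹ - (1/2) r_θ^{2s} + q_θ`; here `qθ : Space d → ℂ` is `q_θ`. -/
def distortedExpr {d : ℕ} (χ₁ : ℝ → ℝ) (s R : ℝ) (qθ : Space d → ℂ) (ħ : ℝ) (θ : ℂ)
    (g : Space d → ℂ) (x : Space d) : ℂ :=
  (ħ : ℂ) ^ 2 / 2 * distortedNegLaplacian χ₁ s R θ g x
    - 1 / 2 * radiusPow χ₁ s R θ ‖x‖ * g x + qθ x * g x

/-- The graph of the closed operator `H_θ` in `L²(ℝ^d)`: the closure of the graph of the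
differential expression on `C_c^∞(ℝ^d)`. So `(u, f)` belongs to it iff `u ∈ D(H_θ)`, `H_θ u = f`. -/
def distortedGraph {d : ℕ} (χ₁ : ℝ → ℝ) (s R : ℝ) (qθ : Space d → ℂ) (ħ : ℝ) (θ : ℂ) :
    Set (L2 d × L2 d) :=
  closure {p | ∃ φ : Space d → ℂ, ContDiff ℝ ∞ φ ∧ HasCompactSupport φ ∧
    (p.1 : Space d → ℂ) =ᵐ[volume] φ ∧
    (p.2 : Space d → ℂ) =ᵐ[volume] distortedExpr χ₁ s R qθ ħ θ φ}

/-- `z` is an eigenvalue of the operator with graph `G`. -/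
def IsEigenvalue {d : ℕ} (G : Set (L2 d × L2 d)) (z : ℂ) : Prop :=
  ∃ u : L2 d, u ≠ 0 ∧ (u, z • u) ∈ G

/-- The region `{|θ| < ℓ} ∩ {|Im θ| < β₀}`. -/
def region (β₀ ℓ : ℝ) : Set ℂ := {θ | ‖θ‖ < ℓ ∧ |θ.im| < β₀}

/-- `Q θ x` is the analytic extension of `θ ↦ q_θ(x) = q(r_θ ω)`, `x = rω`, from real `θ` to the
region `{|θ| < ℓ} ∩ {|Im θ| < β₀}`, uniformly in `x ∈ ℝ^d` (that is, `θ ↦ q_θ - q` is analytic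
with values in the bounded functions: pointwise analytic and locally uniformly bounded). -/
structure IsAnalyticExtension {d : ℕ} (χ₁ : ℝ → ℝ) (s R : ℝ) (q : Space d → ℝ) (β₀ ℓ : ℝ)
    (Q : ℂ → Space d → ℂ) : Prop where
  eq_real : ∀ t : ℝ, |t| < ℓ → ∀ x : Space d,
    Q t x = q ((realRadius χ₁ s R t ‖x‖ / ‖x‖) • x)
  analytic : ∀ x : Space d, DifferentiableOn ℂ (fun θ => Q θ x) (region β₀ ℓ)
  uniform : ∀ K ⊆ region β₀ ℓ, IsCompact K →
    ∃ M : ℝ, ∀ θ ∈ K, ∀ x : Space d, ‖Q θ x - q x‖ ≤ M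

/-- Support in `ℝ^d` of a radial function given by its profile on `[0, ∞)`. -/
def radialSupport (d : ℕ) (χ : ℝ → ℝ) : Set (Space d) := tsupport fun x : Space d => χ ‖x‖

/-- The geometric assumptions (i), (ii), (iii) on the energy `E`, on `μ, α, γ > 0` and on the
cut-off functions `χ`, `χt` (for `χ̃`): partition, classically forbidden region, virial bound. -/
structure VirialData {d : ℕ} (s : ℝ) (q : Space d → ℝ) (E μ α γ : ℝ) (χ χt : ℝ → ℝ) : Prop where
  contDiff : ContDiffOn ℝ 1 χ (Ici 0)
  contDiff_t : ContDiffOn ℝ 1 χt (Ici 0)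
  mem_Icc : ∀ r, 0 ≤ r → χ r ∈ Icc (0 : ℝ) 1
  mem_Icc_t : ∀ r, 0 ≤ r → χt r ∈ Icc (0 : ℝ) 1
  sq_add_sq : ∀ r, 0 ≤ r → χ r ^ 2 + χt r ^ 2 = 1
  near_zero : ∀ᶠ r in 𝓝[≥] (0 : ℝ), χ r = 1
  support_t : s = 1 → ∀ x ∈ radialSupport d χt, √(Real.exp 1) ≤ ‖x‖
  forbidden : ∀ x ∈ radialSupport d χ, α ≤ -(1 / 2) * ‖x‖ ^ (2 * s) + q x - E
  virial_lt : s < 1 → ∀ x ∈ radialSupport d χt,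
    γ ≤ 1 - s - 2 * (1 - 2 * s) * ‖x‖ ^ (-(2 * s)) * (q x - E)
      - ‖x‖ ^ (1 - 2 * s) * radialDeriv q x - μ
  virial_one : s = 1 → ∀ x ∈ radialSupport d χt,
    γ ≤ 1 + 2 * ‖x‖⁻¹ ^ 2 * (Real.log ‖x‖ - 1) * (q x - E)
      - ‖x‖⁻¹ * Real.log ‖x‖ * radialDeriv q x - μ

end Repulsive

end

section

open scoped ComplexConjugate

noncomputable section

/-! Put θ = iβ and consider the real part of ∫ a ū (H_θ − z)u for a bounded radial multiplier a
(`weight`). Since |a| ≤ 1 + O(β), a lower bound (βγ − O(β² + ħ²))‖u‖² for this form gives the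
estimate.

In the forbidden region a = 1, and the real part of the potential minus E is at least α − O(β²).
Elsewhere a = i + ν with ν real and small, which selects minus the imaginary part. Let ω be `amp`,
so that r_θ^{2s} = r^{2s}(1 + 2sθω). To first order the radial and angular kinetic coefficients are
1 − 2iβ(ω + rω') and 1 − 2iβω, and the potential has imaginary part −β(s r^{2s}ω − rω ∂_r q). The
sign of ω + rω' is not controlled, so ν contains −2β(ω + rω'), which cancels the radial first-order
term; the angular one stays nonnegative because rω' ≤ 0 where a is not 1. The price is −2β(ω +
rω')(−r^{2s}/2 + q − E), and this, together with minus the imaginary part of the potential and the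
shift βμ from z, is β times the virial expression, hence at least βγ. The second-order kinetic
errors are O(β² r^{-2s}); a further term Mβ² r^{-2s} in ν dominates them and costs only O(β²)
against a potential of size r^{2s}.

Derivatives of a and of the Jacobian leave terms ħ²·O(χ + (1 − χ²)βr^{-s})|u||∂_r u|, besides
O(ħ²)|u|². The remaining kinetic form, at least (ħ²/2)(χ²/2 + (1 − χ²)β²r^{-2s})|∂_r u|², absorbs
them at a cost O(ħ²)|u|² uniform in β. The cut-off enters squared so that its derivative is O(χ).

The main ingredients are `coefficient_bounds` and `IsAnalyticExtension.expansion` (first-order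
expansions), `Regular.integral_form` (integration by parts), `VirialData.weight_bounds`,
`formDensity_lower` and `weighted_potential_lower` (pointwise positivity), all assembled in
`VirialData.lower_bound`. The bound only needs Im z ≥ −βμ, so the point E − iμβ is excluded for
every larger distortion β' as well. -/

namespace Repulsive

/-! ### Second-order remainders of holomorphic functions. -/

section

/-- Second-order remainder of an analytic function. -/
theorem analyticAt_remainder {f : ℂ → ℂ} {f' : ℂ} (hf : AnalyticAt ℂ f 0)
    (hd : HasDerivAt f f' 0) :
    ∃ C > 0, ∃ ε > 0, ∀ z : ℂ, ‖z‖ ≤ ε → ‖f z - f 0 - f' * z‖ ≤ C * ‖z‖ ^ 2 := by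
  obtain ⟨p, hp⟩ := hf
  have h := hp.isBigO_sub_partialSum_pow 2
  obtain ⟨C, hC, h⟩ := h.exists_pos
  rw [Asymptotics.IsBigOWith] at h
  obtain ⟨ε, hε, h⟩ := Metric.eventually_nhds_iff_ball.1 h
  refine ⟨C, hC, ε / 2, by positivity, fun z hz => ?_⟩
  have h1 := h z (by simp; linarith)
  have h0 : p 0 (fun _ => z) = f 0 := hp.coeff_zero _
  have h2 : p 1 (fun _ => z) = f' * z := by
    have := hp.hasDerivAt.unique hd
    rw [← this]
    have e : (fun _ : Fin 1 => z) = fun i => z • (fun _ : Fin 1 => (1 : ℂ)) i := by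
      ext; simp
    rw [e, (p 1).map_smul_univ]; simp [mul_comm]
  rw [FormalMultilinearSeries.partialSum, Finset.sum_range_succ, Finset.sum_range_one, h0, h2] at h1
  simpa [sub_sub] using h1

/-- Second-order Taylor bound for a bounded holomorphic function on a disc. -/
theorem taylor_bound {f : ℂ → ℂ} {ρ M : ℝ} (hρ : 0 < ρ)
    (hf : DifferentiableOn ℂ f (Metric.ball 0 ρ)) (hM : ∀ z ∈ Metric.ball (0 : ℂ) ρ, ‖f z‖ ≤ M)
    {z : ℂ} (hz : z ∈ Metric.ball (0 : ℂ) ρ) :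
    ‖f z - f 0 - z * deriv f 0‖ ≤ 4 * M / ρ ^ 2 * ‖z‖ ^ 2 := by
  have h0 : (0 : ℂ) ∈ Metric.ball (0 : ℂ) ρ := Metric.mem_ball_self hρ
  have hnhds : Metric.ball (0 : ℂ) ρ ∈ 𝓝 (0 : ℂ) := Metric.ball_mem_nhds _ hρ
  -- Schwarz's lemma is applied to `f` and then to its slope at `0`; each application costs a factor
  -- 2 for the oscillation about the centre, whence the 4.
  have m1 : MapsTo f (Metric.ball 0 ρ) (Metric.closedBall (f 0) (2 * M)) := fun w hw => by
    rw [mem_closedBall_iff_norm]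
    linarith [norm_sub_le (f w) (f 0), hM w hw, hM 0 h0]
  have b1 : ∀ w ∈ Metric.ball (0 : ℂ) ρ, ‖dslope f 0 w‖ ≤ 2 * M / ρ := fun w hw =>
    Complex.norm_dslope_le_div_of_mapsTo_ball hf m1 hw
  have hg : DifferentiableOn ℂ (dslope f 0) (Metric.ball 0 ρ) :=
    (Complex.differentiableOn_dslope hnhds).2 hf
  have m2 : MapsTo (dslope f 0) (Metric.ball 0 ρ)
      (Metric.closedBall (dslope f 0 0) (2 * (2 * M / ρ))) := fun w hw => by
    rw [mem_closedBall_iff_norm]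
    linarith [norm_sub_le (dslope f 0 w) (dslope f 0 0), b1 w hw, b1 0 h0]
  have b2 := Complex.norm_dslope_le_div_of_mapsTo_ball hg m2 hz
  have e1 := sub_smul_dslope f 0 z
  have e2 := sub_smul_dslope (dslope f 0) 0 z
  rw [dslope_same] at e2
  simp only [sub_zero, smul_eq_mul] at e1 e2
  have : f z - f 0 - z * deriv f 0 = z ^ 2 * dslope (dslope f 0) 0 z := by
    rw [← e1, pow_two, mul_assoc, e2]; ring
  rw [this, norm_mul, norm_pow]
  calc ‖z‖ ^ 2 * _ ≤ ‖z‖ ^ 2 * (2 * (2 * M / ρ) / ρ) := by gcongr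
    _ = _ := by field_simp; ring

end

/-! ### Expansion of the kinetic coefficients, and growth of the potential. -/

section

theorem eventually_of_continuousAt_pair {F : ℂ × ℂ → ℂ} (hF : ContinuousAt F 0) {S : Set ℂ}
    (hS : S ∈ 𝓝 (F 0)) : ∃ ε > 0, ∀ z w : ℂ, ‖z‖ ≤ ε → ‖w‖ ≤ ε → F (z, w) ∈ S := by
  obtain ⟨ε, hε, h⟩ := Metric.eventually_nhds_iff_ball.1 (hF.eventually hS)
  refine ⟨ε / 2, by positivity, fun z w hz hw => h (z, w) ?_⟩
  rw [mem_ball_zero_iff, Prod.norm_def]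
  exact max_lt (by simpa using by linarith) (by simpa using by linarith)

/-- Expansion of the coefficients of the distorted Laplacian in the distortion parameter;
`X` stands for `β ω` and `Y` for `β r ω'`. -/
theorem coefficient_expansion (d : ℕ) {s : ℝ} (hs : 0 < s) :
    ∃ ε₀ > 0, ∃ C > 0, ∀ X Y ε : ℝ, |X| ≤ ε → |Y| ≤ ε → ε ≤ ε₀ → ∀ n l P : ℂ,
      n = 1 + 2 * s * (Complex.I * X) → l = Complex.log n / (2 * s) → P = 1 + Complex.I * Y / n →
      n ∈ Complex.slitPlane ∧ 1 / 2 ≤ ‖n‖ ∧ |l.im| < Real.pi ∧ 1 / 2 ≤ ‖P‖ ∧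
      Complex.exp (d * l) * P ∈ Complex.slitPlane ∧
      ‖Complex.exp (-2 * l) - 1 + 2 * Complex.I * X‖ ≤ C * ε ^ 2 ∧
      ‖((Complex.exp l * P) ^ 2)⁻¹ - 1 + 2 * Complex.I * (X + Y)‖ ≤ C * ε ^ 2 := by
  have hsC : (s : ℂ) ≠ 0 := by exact_mod_cast hs.ne'
  have hn0 : ContinuousAt (fun p : ℂ × ℂ => 1 + 2 * (s : ℂ) * p.1) 0 := by fun_prop
  have hl0 : ContinuousAt
      (fun p : ℂ × ℂ => Complex.log (1 + 2 * (s : ℂ) * p.1) / (2 * s)) 0 := by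
    refine ContinuousAt.div_const (ContinuousAt.clog hn0 (by simp)) _
  have hP0 : ContinuousAt (fun p : ℂ × ℂ => 1 + p.2 / (1 + 2 * (s : ℂ) * p.1)) 0 :=
    continuousAt_const.add (continuousAt_snd.div hn0 (by simp))
  have hJ0 : ContinuousAt (fun p : ℂ × ℂ =>
      Complex.exp (d * (Complex.log (1 + 2 * (s : ℂ) * p.1) / (2 * s))) *
        (1 + p.2 / (1 + 2 * (s : ℂ) * p.1))) 0 :=
    ((continuousAt_const.mul hl0).cexp).mul hP0
  obtain ⟨ε₁, hε₁, h1⟩ := eventually_of_continuousAt_pair hn0 (S := Complex.slitPlane)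
    (Complex.isOpen_slitPlane.mem_nhds (by simp))
  obtain ⟨ε₂, hε₂, h2⟩ := eventually_of_continuousAt_pair hn0 (S := {z | 1 / 2 < ‖z‖})
    ((isOpen_lt continuous_const continuous_norm).mem_nhds (by norm_num))
  obtain ⟨ε₃, hε₃, h3⟩ := eventually_of_continuousAt_pair hl0 (S := {z | |z.im| < Real.pi})
    ((isOpen_lt Complex.continuous_im.abs continuous_const).mem_nhds (by simp [Real.pi_pos]))
  obtain ⟨ε₄, hε₄, h4⟩ := eventually_of_continuousAt_pair hP0 (S := {z | 1 / 2 < ‖z‖})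
    ((isOpen_lt continuous_const continuous_norm).mem_nhds (by norm_num))
  obtain ⟨ε₅, hε₅, h5⟩ := eventually_of_continuousAt_pair hJ0 (S := Complex.slitPlane)
    (Complex.isOpen_slitPlane.mem_nhds (by simp))
  have aB : AnalyticAt ℂ
      (fun z : ℂ => Complex.exp (-2 * (Complex.log (1 + 2 * (s : ℂ) * z) / (2 * s)))) 0 := by
    refine AnalyticAt.cexp (analyticAt_const.mul (AnalyticAt.div ?_ analyticAt_const (by simp [hsC])))
    refine AnalyticAt.clog (by fun_prop) (by simp)
  have dB : HasDerivAt
      (fun z : ℂ => Complex.exp (-2 * (Complex.log (1 + 2 * (s : ℂ) * z) / (2 * s)))) (-2) 0 := by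
    have h0 : HasDerivAt (fun z : ℂ => 1 + 2 * (s : ℂ) * z) (2 * s) 0 := by
      simpa using ((hasDerivAt_id (0 : ℂ)).const_mul (2 * (s : ℂ))).const_add 1
    have := (((h0.clog (by simp)).div_const (2 * (s : ℂ))).const_mul (-2)).cexp
    refine this.congr_deriv ?_
    simp [hsC]
  obtain ⟨C₁, hC₁, ε₆, hε₆, h6⟩ := analyticAt_remainder aB dB
  have aP : AnalyticAt ℂ (fun z : ℂ => ((1 + z) ^ 2)⁻¹) 0 :=
    AnalyticAt.inv (by fun_prop) (by simp)
  have dP : HasDerivAt (fun z : ℂ => ((1 + z) ^ 2)⁻¹) (-2) 0 := by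
    have := (((hasDerivAt_id (0 : ℂ)).const_add 1).pow 2).inv (by simp)
    refine this.congr_deriv ?_
    simp
  obtain ⟨C₂, hC₂, ε₇, hε₇, h7⟩ := analyticAt_remainder aP dP
  -- `K₁` and `K₂` are Lipschitz constants for the two factors of the radial coefficient; their
  -- product bounds the cross term.
  let K₁ := 2 + C₁
  let K₂ := 2 + 4 * C₂ + 8 * s
  refine ⟨min 1 (min ε₁ (min ε₂ (min ε₃ (min ε₄ (min ε₅ (min ε₆ (ε₇ / 2))))))), by positivity,
    K₁ * K₂ + C₁ + (4 * C₂ + 8 * s), by positivity, ?_⟩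
  rintro X Y ε hX hY hε n l P rfl rfl rfl
  simp only [le_min_iff] at hε
  obtain ⟨e0, e1, e2, e3, e4, e5, e6, e7⟩ := hε
  have hε0 : 0 ≤ ε := (abs_nonneg X).trans hX
  have nX : ‖Complex.I * (X : ℂ)‖ ≤ ε := by simpa using hX
  have nY : ‖Complex.I * (Y : ℂ)‖ ≤ ε := by simpa using hY
  have g2 := le_of_lt (show 1 / 2 < ‖_‖ from h2 _ 0 (nX.trans e2) (by simpa using hε₂.le))
  have gB := h6 (Complex.I * X) (nX.trans e6)
  have hη : ‖Complex.I * Y / (1 + 2 * s * (Complex.I * X))‖ ≤ 2 * ε := by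
    rw [norm_div, div_le_iff₀ (by simp only at g2; linarith)]
    simp only at g2
    nlinarith
  have gP := h7 (Complex.I * Y / (1 + 2 * s * (Complex.I * X))) (hη.trans (by linarith))
  simp only [mul_zero, add_zero, Complex.log_one, zero_div, Complex.exp_zero, one_pow, inv_one]
    at gB gP
  set n : ℂ := 1 + 2 * s * (Complex.I * X) with hn
  have hn_ne : n ≠ 0 := by
    intro h
    simp only [h, norm_zero] at g2
    linarith
  set η : ℂ := Complex.I * Y / n with hηdef
  set B : ℂ := Complex.exp (-2 * (Complex.log n / (2 * s))) with hB
  have hBX : ‖B - 1 + 2 * Complex.I * X‖ ≤ C₁ * ε ^ 2 := by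
    have : B - 1 + 2 * Complex.I * X = B - 1 - -2 * (Complex.I * X) := by ring
    rw [this]
    exact gB.trans (by gcongr)
  have hPY : ‖((1 + η) ^ 2)⁻¹ - 1 + 2 * Complex.I * Y‖ ≤ (4 * C₂ + 8 * s) * ε ^ 2 := by
    -- The linear term in `η` is replaced by the one in iY; as ηn = iY, the difference is η(n − 1)
    -- up to sign, again of second order.
    have : ((1 + η) ^ 2)⁻¹ - 1 + 2 * Complex.I * Y
        = (((1 + η) ^ 2)⁻¹ - 1 - -2 * η) + 2 * η * (2 * s * (Complex.I * X)) := by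
      have : η * n = Complex.I * Y := by rw [hηdef]; field_simp
      linear_combination (-2) * this + 2 * η * hn
    rw [this]
    have q1 : ‖2 * η * (2 * s * (Complex.I * X))‖ ≤ (2 * (2 * ε)) * (2 * s * ε) := by
      rw [norm_mul, norm_mul, norm_mul (2 * (s : ℂ)), norm_mul 2 (s : ℂ)]
      simp only [Complex.norm_ofNat, Complex.norm_real, Real.norm_eq_abs, abs_of_pos hs]
      gcongr
    have q2 : C₂ * ‖η‖ ^ 2 ≤ C₂ * (2 * ε) ^ 2 := by gcongr
    calc _ ≤ _ := norm_add_le _ _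
      _ ≤ C₂ * (2 * ε) ^ 2 + (2 * (2 * ε)) * (2 * s * ε) := add_le_add (gP.trans q2) q1
      _ = _ := by ring
  have hsq : ε ^ 2 ≤ ε := by nlinarith
  have hB1 : ‖B - 1‖ ≤ K₁ * ε := by
    have : B - 1 = (B - 1 + 2 * Complex.I * X) - 2 * (Complex.I * X) := by ring
    rw [this]
    refine (norm_sub_le _ _).trans ?_
    have : ‖2 * (Complex.I * (X : ℂ))‖ ≤ 2 * ε := by rw [norm_mul]; simpa using hX
    simp only [K₁]
    nlinarith
  have hP1 : ‖((1 + η) ^ 2)⁻¹ - 1‖ ≤ K₂ * ε := by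
    have : ((1 + η) ^ 2)⁻¹ - 1 = (((1 + η) ^ 2)⁻¹ - 1 + 2 * Complex.I * Y)
      - 2 * (Complex.I * Y) := by ring
    rw [this]
    refine (norm_sub_le _ _).trans ?_
    have : ‖2 * (Complex.I * (Y : ℂ))‖ ≤ 2 * ε := by rw [norm_mul]; simpa using hY
    simp only [K₂]
    have : (4 * C₂ + 8 * s) * ε ^ 2 ≤ (4 * C₂ + 8 * s) * ε := by gcongr
    nlinarith
  refine ⟨h1 _ 0 (nX.trans e1) (by simpa using hε₁.le), g2,
    h3 _ 0 (nX.trans e3) (by simpa using hε₃.le), (h4 _ _ (nX.trans e4) (nY.trans e4)).le,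
    h5 _ _ (nX.trans e5) (nY.trans e5), hBX.trans ?_, ?_⟩
  · gcongr
    nlinarith [show 0 ≤ K₁ * K₂ by positivity, show 0 ≤ 4 * C₂ + 8 * s by positivity]
  · have hA : ((Complex.exp (Complex.log n / (2 * s)) * (1 + η)) ^ 2)⁻¹
        = B * ((1 + η) ^ 2)⁻¹ := by
      rw [mul_pow, mul_inv, hB, ← Complex.exp_nat_mul, ← Complex.exp_neg]
      congr 2
      push_cast; ring
    have : ((Complex.exp (Complex.log n / (2 * s)) * (1 + η)) ^ 2)⁻¹ - 1 + 2 * Complex.I * (X + Y)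
        = (B - 1) * (((1 + η) ^ 2)⁻¹ - 1) + (B - 1 + 2 * Complex.I * X)
          + (((1 + η) ^ 2)⁻¹ - 1 + 2 * Complex.I * Y) := by rw [hA]; ring
    rw [this]
    calc _ ≤ _ := norm_add₃_le
      _ ≤ (K₁ * ε) * (K₂ * ε) + C₁ * ε ^ 2 + (4 * C₂ + 8 * s) * ε ^ 2 := by
        rw [norm_mul]; gcongr
      _ = _ := by ring

/-- A long-range potential is negligible with respect to `|x|^{2s}`. -/
theorem LongRange.growth {d : ℕ} {s : ℝ} {q : Space d → ℝ} (hs0 : 0 < s) (hs1 : s ≤ 1)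
    (hq : LongRange s q) : ∃ Cq > 0, ∀ x, |q x| ≤ 1 / 4 * ‖x‖ ^ (2 * s) + Cq := by
  obtain ⟨hsm, ρ, ⟨hρ0, hρ1⟩, C, hC, hlt, hone⟩ := hq
  obtain ⟨T, hT1, hT⟩ : ∃ T ≥ 1, ∀ x : Space d, T ≤ ‖x‖ → |q x| ≤ 1 / 4 * ‖x‖ ^ (2 * s) := by
    -- The constant 1/8 leaves room for the factor 2 lost in passing from ⟨x⟩^{2s} to |x|^{2s}.
    have main : ∃ T ≥ 1, ∀ x : Space d, T ≤ ‖x‖ →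
        |q x| ≤ 1 / 8 * √(1 + ‖x‖ ^ 2) ^ (2 * s) := by
      rcases hs1.lt_or_eq with h | rfl
      · have : Tendsto (fun t : ℝ => C 0 * t ^ (-ρ)) atTop (𝓝 (C 0 * 0)) :=
          (tendsto_rpow_neg_atTop hρ0).const_mul _
        obtain ⟨T, hT⟩ := eventually_atTop.1 (this.eventually (ge_mem_nhds (show C 0 * 0 < 1 / 8 by simp)))
        refine ⟨max T 1, le_max_right _ _, fun x hx => ?_⟩
        have hle : ‖x‖ ≤ √(1 + ‖x‖ ^ 2) := Real.le_sqrt_of_sq_le (by linarith)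
        have h1 := hT (√(1 + ‖x‖ ^ 2)) ((le_max_left _ _).trans (hx.trans hle))
        have h2 := hlt h 0 x
        have hpos : 0 < √(1 + ‖x‖ ^ 2) := by positivity
        rw [norm_iteratedFDeriv_zero, Real.norm_eq_abs] at h2
        refine h2.trans ?_
        have e : 2 * s - ((0 : ℕ) : ℝ) - ρ = -ρ + 2 * s := by push_cast; ring
        rw [e, Real.rpow_add hpos, ← mul_assoc]
        gcongr
      · have : Tendsto (fun t : ℝ => C 0 * Real.log t ^ (-(1 + ρ))) atTop (𝓝 (C 0 * 0)) :=
          ((tendsto_rpow_neg_atTop (by linarith)).comp Real.tendsto_log_atTop).const_mul _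
        obtain ⟨T, hT⟩ := eventually_atTop.1 (this.eventually (ge_mem_nhds (show C 0 * 0 < 1 / 8 by simp)))
        refine ⟨max T 1, le_max_right _ _, fun x hx => ?_⟩
        have hle : ‖x‖ ≤ √(1 + ‖x‖ ^ 2) := Real.le_sqrt_of_sq_le (by linarith)
        have h1 := hT (√(1 + ‖x‖ ^ 2)) ((le_max_left _ _).trans (hx.trans hle))
        have hx0 : x ≠ 0 := by
          rintro rfl
          simp at hx
          linarith [le_max_right T 1]
        have h2 := hone rfl 0 x hx0
        rw [norm_iteratedFDeriv_zero, Real.norm_eq_abs] at h2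
        refine h2.trans ?_
        have e : (2 : ℝ) - ((0 : ℕ) : ℝ) = 2 * 1 := by push_cast; ring
        rw [e, show -1 - ρ = -(1 + ρ) by ring]
        gcongr
    obtain ⟨T, hT1, hT⟩ := main
    refine ⟨T, hT1, fun x hx => (hT x hx).trans ?_⟩
    have hx1 : 1 ≤ ‖x‖ := hT1.trans hx
    have : √(1 + ‖x‖ ^ 2) ^ (2 * s) ≤ 2 * ‖x‖ ^ (2 * s) := by
      calc √(1 + ‖x‖ ^ 2) ^ (2 * s) ≤ (√2 * ‖x‖) ^ (2 * s) := by
            refine Real.rpow_le_rpow (by positivity) ?_ (by positivity)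
            refine Real.sqrt_le_iff.2 ⟨by positivity, ?_⟩
            rw [mul_pow, Real.sq_sqrt (by norm_num)]
            nlinarith
        _ = 2 ^ s * ‖x‖ ^ (2 * s) := by
            rw [Real.mul_rpow (by positivity) (by positivity), Real.sqrt_eq_rpow,
              ← Real.rpow_mul (by norm_num)]
            congr 2; ring
        _ ≤ 2 ^ (1 : ℝ) * ‖x‖ ^ (2 * s) := by
            gcongr
            norm_num
        _ = _ := by norm_num
    linarith
  obtain ⟨M, hM⟩ := (isCompact_closedBall (0 : Space d) T).exists_bound_of_continuousOn
    hsm.continuous.continuousOn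
  refine ⟨max M 1, by positivity, fun x => ?_⟩
  rcases le_total ‖x‖ T with h | h
  · have := hM x (by simpa using h)
    have h2 : (0 : ℝ) ≤ 1 / 4 * ‖x‖ ^ (2 * s) := by positivity
    rw [Real.norm_eq_abs] at this
    linarith [le_max_left M 1]
  · linarith [hT x h, le_max_right M 1]

end

/-! ### Amplitude of the distortion and its decay. -/

section

/-- The relative amplitude of the distortion: `r_θ^{2s} = r^{2s} (1 + 2sθ · amp)`. -/
def amp (χ₁ : ℝ → ℝ) (s R r : ℝ) : ℝ :=
  stepAt χ₁ s R (r ^ (2 * s)) * ((if s < 1 then 1 else Real.log r) * r ^ (-(2 * s)))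

/-- `amp` where the cut-off equals `1`. -/
def ampTail (s r : ℝ) : ℝ := (if s < 1 then 1 else Real.log r) * r ^ (-(2 * s))

variable {χ₁ : ℝ → ℝ} {s R : ℝ}

theorem contDiff_stepAt (hχ₁ : IsStep χ₁) : ContDiff ℝ ∞ (stepAt χ₁ s R) :=
  hχ₁.smooth.comp (contDiff_id.div_const _)

theorem contDiffAt_ampTail {r : ℝ} (hr : 0 < r) : ContDiffAt ℝ ∞ (ampTail s) r := by
  unfold ampTail
  refine ContDiffAt.mul ?_ (Real.contDiffAt_rpow_const_of_ne hr.ne')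
  split_ifs
  · exact contDiffAt_const
  · exact Real.contDiffAt_log.2 hr.ne'

theorem contDiffAt_amp (hχ₁ : IsStep χ₁) {r : ℝ} (hr : 0 < r) :
    ContDiffAt ℝ ∞ (amp χ₁ s R) r :=
  ((contDiff_stepAt hχ₁).contDiffAt.comp r (Real.contDiffAt_rpow_const_of_ne hr.ne')).mul
    (contDiffAt_ampTail hr)

theorem stepAt_eq_zero (hχ₁ : IsStep χ₁) (hs0 : 0 < s) (hR : 0 < R) {r : ℝ}
    (hr : |r| ≤ R) : stepAt χ₁ s R (r ^ (2 * s)) = 0 := by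
  refine hχ₁.eq_zero _ ((div_le_one (by positivity)).2 ?_)
  exact (le_abs_self _).trans ((Real.abs_rpow_le_abs_rpow _ _).trans
    (Real.rpow_le_rpow (abs_nonneg _) hr (by positivity)))

theorem amp_eq_zero (hχ₁ : IsStep χ₁) (hs0 : 0 < s) (hR : 0 < R) {r : ℝ}
    (hr : |r| ≤ R) : amp χ₁ s R r = 0 := by
  rw [amp, stepAt_eq_zero hχ₁ hs0 hR hr, zero_mul]

theorem amp_eventually_zero (hχ₁ : IsStep χ₁) (hs0 : 0 < s) (hR : 0 < R) {r : ℝ}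
    (hr : |r| < R) : amp χ₁ s R =ᶠ[𝓝 r] fun _ => 0 := by
  filter_upwards [(isOpen_lt continuous_abs continuous_const).mem_nhds hr] with t ht
  exact amp_eq_zero hχ₁ hs0 hR (le_of_lt ht)

theorem amp_eventually_tail (hχ₁ : IsStep χ₁) (hs0 : 0 < s) (hR : 0 < R) :
    ∃ T > R, ∀ r, T < r → amp χ₁ s R =ᶠ[𝓝 r] ampTail s := by
  -- At this radius r^{2s}/R^{2s} = 2, where the step function has reached 1.
  refine ⟨2 ^ (1 / (2 * s)) * R, ?_, fun r hr => ?_⟩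
  · have : (1 : ℝ) < 2 ^ (1 / (2 * s)) := Real.one_lt_rpow (by norm_num) (by positivity)
    exact lt_mul_of_one_lt_left hR this
  · filter_upwards [Ioi_mem_nhds hr] with t ht
    have : stepAt χ₁ s R (t ^ (2 * s)) = 1 := by
      refine hχ₁.eq_one _ ((le_div_iff₀ (by positivity)).2 ?_)
      have := Real.rpow_le_rpow (by positivity) (le_of_lt ht) (show 0 ≤ 2 * s by positivity)
      rwa [Real.mul_rpow (by positivity) hR.le, ← Real.rpow_mul (by norm_num),
        one_div_mul_cancel (by positivity), Real.rpow_one] at this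
    rw [amp, this, one_mul, ampTail]

/-- A function vanishing near `0`, locally bounded and decaying like `r^{-s}` is uniformly
`O(min(1, r^{-s}))`. -/
theorem uniform_decay {f g : ℝ → ℝ} {T C : ℝ} (hs0 : 0 < s) (hR : 0 < R)
    (hf : ContinuousOn f (Ioi 0)) (h0 : ∀ r, 0 < r → r < R → f r = 0)
    (hg : ∀ r > T, f r = g r) (hC : ∀ r ≥ 1, |g r| ≤ C * r ^ (-s)) :
    ∃ D > 0, ∀ r > 0, |f r| ≤ D ∧ |f r| ≤ D * r ^ (-s) := by
  set T' := max (max T R) 1 with hT'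
  have hT'1 : 1 ≤ T' := le_max_right _ _
  have hTT' : T ≤ T' := (le_max_left _ _).trans (le_max_left _ _)
  obtain ⟨M, hM⟩ := (isCompact_Icc (a := R) (b := T')).exists_bound_of_continuousOn
    (hf.mono fun x hx => hR.trans_le hx.1)
  have hC0 : 0 ≤ C := by
    have := hC 1 le_rfl
    rw [Real.one_rpow, mul_one] at this
    exact (abs_nonneg _).trans this
  have hM0 : 0 ≤ max M 0 := le_max_right _ _
  have hTs : 1 ≤ T' ^ s := Real.one_le_rpow hT'1 hs0.le
  -- On the compact range [R, T'] one has 1 ≤ T'^s r^{-s}, so a plain bound becomes a decaying one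
  -- after multiplication by T'^s.
  refine ⟨max M 0 * T' ^ s + C + 1, by positivity, fun r hr => ?_⟩
  have hrs : 0 < r ^ (-s) := Real.rpow_pos_of_pos hr _
  rcases lt_or_ge r R with h | h
  · rw [h0 r hr h, abs_zero]
    constructor <;> positivity
  rcases le_or_gt r T' with h' | h'
  · have h1 := hM r ⟨h, h'⟩
    rw [Real.norm_eq_abs] at h1
    have h2 : |f r| ≤ max M 0 := h1.trans (le_max_left _ _)
    have h3 : 1 ≤ T' ^ s * r ^ (-s) := by
      rw [Real.rpow_neg hr.le, ← div_eq_mul_inv, one_le_div (by positivity)]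
      exact Real.rpow_le_rpow hr.le h' hs0.le
    constructor
    · nlinarith
    · calc |f r| ≤ max M 0 * 1 := by linarith
        _ ≤ max M 0 * (T' ^ s * r ^ (-s)) := by gcongr
        _ ≤ _ := by nlinarith
  · have h1 := hC r (hT'1.trans h'.le)
    rw [← hg r (hTT'.trans_lt h')] at h1
    have h2 : r ^ (-s) ≤ 1 := Real.rpow_le_one_of_one_le_of_nonpos (hT'1.trans h'.le) (by linarith)
    have h4 : 0 ≤ max M 0 * T' ^ s := by positivity
    constructor
    · nlinarith
    · nlinarith

theorem hasDerivAt_ampTail (hs1 : s ≤ 1) {r : ℝ} (hr : 0 < r) :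
    HasDerivAt (ampTail s) ((if s < 1 then -(2 * s) else 1 - 2 * Real.log r)
      * r ^ (-(2 * s) - 1)) r := by
  unfold ampTail
  have h1 := Real.hasDerivAt_rpow_const (p := -(2 * s)) (Or.inl hr.ne')
  split_ifs with h
  · simpa using h1
  · obtain rfl : s = 1 := le_antisymm hs1 (not_lt.1 h)
    refine ((Real.hasDerivAt_log hr.ne').mul h1).congr_deriv ?_
    have : r ^ (-(2 * 1) : ℝ) = r ^ (-(2 * 1) - 1 : ℝ) * r := by
      rw [← Real.rpow_add_one hr.ne']; norm_num
    rw [this]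
    field_simp
    ring

theorem hasDerivAt_ampTail' (hs1 : s ≤ 1) {r : ℝ} (hr : 0 < r) :
    HasDerivAt (deriv (ampTail s)) ((if s < 1 then 2 * s * (2 * s + 1) else 6 * Real.log r - 5)
      * r ^ (-(2 * s) - 2)) r := by
  have h0 : deriv (ampTail s) =ᶠ[𝓝 r] fun t => (if s < 1 then -(2 * s) else 1 - 2 * Real.log t)
      * t ^ (-(2 * s) - 1) := by
    filter_upwards [Ioi_mem_nhds hr] with t ht
    exact (hasDerivAt_ampTail hs1 ht).deriv
  refine HasDerivAt.congr_of_eventuallyEq ?_ h0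
  have h1 := Real.hasDerivAt_rpow_const (p := -(2 * s) - 1) (Or.inl hr.ne')
  split_ifs with h
  · refine (h1.const_mul (-(2 * s))).congr_deriv ?_
    rw [show -(2 * s) - 1 - 1 = -(2 * s) - 2 by ring]
    ring
  · obtain rfl : s = 1 := le_antisymm hs1 (not_lt.1 h)
    refine ((((Real.hasDerivAt_log hr.ne').const_mul 2).const_sub 1).mul h1).congr_deriv ?_
    have : r ^ (-(2 * 1) - 1 : ℝ) = r ^ (-(2 * 1) - 2 : ℝ) * r := by
      rw [← Real.rpow_add_one hr.ne']; norm_num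
    rw [show (-(2 * 1) - 1 - 1 : ℝ) = -(2 * 1) - 2 by ring, this]
    field_simp
    ring

/-- For s = 1 the logarithm is absorbed by log r ≤ r, which turns r^{-2} into r^{-1}. The rate
r^{-s} is what is needed later: its square is r^{-2s}, the inverse of the growth of the potential.
-/
theorem log_factor_bound (hs0 : 0 < s) (hs1 : s ≤ 1) {a b c e r : ℝ} (hr : 1 ≤ r)
    (he : e ≤ -(2 * s)) :
    |(if s < 1 then a else b + c * Real.log r) * r ^ e| ≤ (|a| + |b| + |c|) * r ^ (-s) := by
  have hr0 : 0 < r := by linarith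
  have hre : 0 < r ^ e := Real.rpow_pos_of_pos hr0 _
  rw [abs_mul, abs_of_pos hre]
  have ha := abs_nonneg a
  have hb := abs_nonneg b
  have hc := abs_nonneg c
  split_ifs with h
  · have h1 : r ^ e ≤ r ^ (-s) := Real.rpow_le_rpow_of_exponent_le hr (by linarith)
    calc |a| * r ^ e ≤ |a| * r ^ (-s) := by gcongr
      _ ≤ _ := by
        gcongr
        linarith
  · obtain rfl : s = 1 := le_antisymm hs1 (not_lt.1 h)
    have h1 : |b + c * Real.log r| ≤ (|a| + |b| + |c|) * r := by
      have hl : 0 ≤ Real.log r := Real.log_nonneg hr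
      have hl' : Real.log r ≤ r := (Real.log_le_sub_one_of_pos hr0).trans (by linarith)
      calc |b + c * Real.log r| ≤ |b| + |c| * Real.log r := by
            refine (abs_add_le _ _).trans ?_
            rw [abs_mul, abs_of_nonneg hl]
        _ ≤ _ := by nlinarith
    calc |b + c * Real.log r| * r ^ e ≤ (|a| + |b| + |c|) * r * r ^ (-2 : ℝ) := by
          gcongr
          linarith
      _ = _ := by
        rw [mul_assoc, ← Real.rpow_one_add' hr0.le (by norm_num)]
        norm_num

/-- Uniform bounds on the amplitude and its derivatives. -/
theorem amp_bounds (hχ₁ : IsStep χ₁) (hs0 : 0 < s) (hs1 : s ≤ 1) (hR : 0 < R) :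
    ∃ D > 0, ∀ r > 0, ∀ y ∈ ({amp χ₁ s R r, deriv (amp χ₁ s R) r, r * deriv (amp χ₁ s R) r,
      r * deriv (deriv (amp χ₁ s R)) r} : Set ℝ), |y| ≤ D ∧ |y| ≤ D * r ^ (-s) := by
  obtain ⟨T, hTR, hT⟩ := amp_eventually_tail hχ₁ hs0 hR (χ₁ := χ₁) (s := s) (R := R)
  have hω : ContDiffOn ℝ ∞ (amp χ₁ s R) (Ioi 0) := fun r hr =>
    (contDiffAt_amp hχ₁ hr).contDiffWithinAt
  have hω1 : ContDiffOn ℝ ∞ (deriv (amp χ₁ s R)) (Ioi 0) := by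
    exact ((contDiffOn_infty_iff_deriv_of_isOpen isOpen_Ioi).1 hω).2
  have hω2 : ContDiffOn ℝ ∞ (deriv (deriv (amp χ₁ s R))) (Ioi 0) := by
    exact ((contDiffOn_infty_iff_deriv_of_isOpen isOpen_Ioi).1 hω1).2
  have z0 : ∀ r, 0 < r → r < R → amp χ₁ s R r = 0 := fun r hr hr' =>
    amp_eq_zero hχ₁ hs0 hR (by rw [abs_of_pos hr]; exact hr'.le)
  have z1 : ∀ r, 0 < r → r < R → deriv (amp χ₁ s R) r = 0 := fun r hr hr' => by
    rw [(amp_eventually_zero hχ₁ hs0 hR (by rwa [abs_of_pos hr])).deriv_eq]; simp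
  have z2 : ∀ r, 0 < r → r < R → deriv (deriv (amp χ₁ s R)) r = 0 := fun r hr hr' => by
    rw [(amp_eventually_zero hχ₁ hs0 hR (by rwa [abs_of_pos hr])).deriv.deriv_eq]; simp
  have t1 : ∀ r > T, deriv (amp χ₁ s R) r = (if s < 1 then -(2 * s) else 1 - 2 * Real.log r)
      * r ^ (-(2 * s) - 1) := fun r hr => by
    rw [(hT r hr).deriv_eq]
    exact (hasDerivAt_ampTail hs1 (hR.trans (hTR.trans hr))).deriv
  have t2 : ∀ r > T, deriv (deriv (amp χ₁ s R)) r =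
      (if s < 1 then 2 * s * (2 * s + 1) else 6 * Real.log r - 5) * r ^ (-(2 * s) - 2) :=
    fun r hr => by
    rw [(hT r hr).deriv.deriv_eq]
    exact (hasDerivAt_ampTail' hs1 (hR.trans (hTR.trans hr))).deriv
  have cid : ContinuousOn (fun r : ℝ => r) (Ioi 0) := continuousOn_id
  obtain ⟨D₁, hD₁, h1⟩ := uniform_decay (g := ampTail s) (C := |1| + |0| + |1|) hs0 hR
    hω.continuousOn z0 (fun r hr => (hT r hr).eq_of_nhds) fun r hr => by
      have := log_factor_bound hs0 hs1 (a := 1) (b := 0) (c := 1) hr (le_refl (-(2 * s)))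
      simpa only [ampTail, zero_add, one_mul] using this
  obtain ⟨D₂, hD₂, h2⟩ := uniform_decay (C := |-(2 * s)| + |1| + |-2|) hs0 hR
    hω1.continuousOn z1 t1 fun r hr => by
      have := log_factor_bound hs0 hs1 (a := -(2 * s)) (b := 1) (c := -2) hr
        (show -(2 * s) - 1 ≤ -(2 * s) by linarith)
      rwa [neg_mul, ← sub_eq_add_neg] at this
  obtain ⟨D₃, hD₃, h3⟩ := uniform_decay (C := |-(2 * s)| + |1| + |-2|) hs0 hR
    (g := fun r => (if s < 1 then -(2 * s) else 1 - 2 * Real.log r) * r ^ (-(2 * s)))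
    (T := T) (cid.mul hω1.continuousOn) (fun r hr hr' => by simp [z1 r hr hr'])
    (fun r hr => by
      have hr0 : 0 < r := hR.trans (hTR.trans hr)
      simp only [Pi.mul_apply]
      rw [t1 r hr, show -(2 * s) = -(2 * s) - 1 + 1 by ring, Real.rpow_add_one hr0.ne']
      ring_nf) fun r hr => by
      have := log_factor_bound hs0 hs1 (a := -(2 * s)) (b := 1) (c := -2) hr
        (le_refl (-(2 * s)))
      rwa [neg_mul, ← sub_eq_add_neg] at this
  obtain ⟨D₄, hD₄, h4⟩ := uniform_decay (C := |2 * s * (2 * s + 1)| + |-5| + |6|) hs0 hR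
    (g := fun r => (if s < 1 then 2 * s * (2 * s + 1) else 6 * Real.log r - 5)
      * r ^ (-(2 * s) - 1))
    (T := T) (cid.mul hω2.continuousOn) (fun r hr hr' => by simp [z2 r hr hr'])
    (fun r hr => by
      have hr0 : 0 < r := hR.trans (hTR.trans hr)
      simp only [Pi.mul_apply]
      rw [t2 r hr, show -(2 * s) - 1 = -(2 * s) - 2 + 1 by ring, Real.rpow_add_one hr0.ne']
      ring_nf) fun r hr => by
      have := log_factor_bound hs0 hs1 (a := 2 * s * (2 * s + 1)) (b := -5) (c := 6) hr
        (show -(2 * s) - 1 ≤ -(2 * s) by linarith)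
      rwa [neg_add_eq_sub] at this
  have key : ∀ {r y D : ℝ}, 0 < r → D ≤ D₁ + D₂ + D₃ + D₄ → |y| ≤ D ∧ |y| ≤ D * r ^ (-s) →
      |y| ≤ D₁ + D₂ + D₃ + D₄ ∧ |y| ≤ (D₁ + D₂ + D₃ + D₄) * r ^ (-s) := by
    rintro r y D hr hD ⟨ha, hb⟩
    have : 0 < r ^ (-s) := Real.rpow_pos_of_pos hr _
    exact ⟨ha.trans hD, hb.trans (by gcongr)⟩
  refine ⟨D₁ + D₂ + D₃ + D₄, by positivity, ?_⟩
  rintro r hr y (rfl | rfl | rfl | rfl)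
  · exact key hr (by linarith) (h1 r hr)
  · exact key hr (by linarith) (h2 r hr)
  · exact key hr (by linarith) (h3 r hr)
  · exact key hr (by linarith) (h4 r hr)

end

/-! ### Distorted radius and Jacobian expressed through the amplitude. -/

section

variable {χ₁ : ℝ → ℝ} {s R : ℝ}

/-- `n = r_θ^{2s} / r^{2s}`. -/
def powRatio (χ₁ : ℝ → ℝ) (s R : ℝ) (θ : ℂ) (r : ℝ) : ℂ := 1 + 2 * s * (θ * amp χ₁ s R r)

/-- `log (r_θ / r)`. -/
def logRatio (χ₁ : ℝ → ℝ) (s R : ℝ) (θ : ℂ) (r : ℝ) : ℂ :=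
  Complex.log (powRatio χ₁ s R θ r) / (2 * s)

/-- `r` times the derivative of `logRatio`. -/
def stretch (χ₁ : ℝ → ℝ) (s R : ℝ) (θ : ℂ) (r : ℝ) : ℂ :=
  θ * (r * deriv (amp χ₁ s R) r : ℝ) / powRatio χ₁ s R θ r

theorem radiusPow_eq (hs1 : s ≤ 1) (θ : ℂ) {r : ℝ} (hr : 0 < r) :
    radiusPow χ₁ s R θ r = ((r ^ (2 * s) : ℝ) : ℂ) * powRatio χ₁ s R θ r := by
  have h1 : r ^ (2 * s) * r ^ (-(2 * s)) = 1 := by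
    rw [← Real.rpow_add hr]; simp
  have h1' : ((r ^ (2 * s) : ℝ) : ℂ) * ((r ^ (-(2 * s)) : ℝ) : ℂ) = 1 := by exact_mod_cast h1
  unfold radiusPow powRatio amp
  split_ifs with h
  · push_cast [one_mul] at h1' ⊢
    linear_combination (-2 * s * θ * stepAt χ₁ s R (r ^ (2 * s))) * h1'
  · obtain rfl : s = 1 := le_antisymm hs1 (not_lt.1 h)
    have e : r ^ (2 * 1 : ℝ) = r ^ 2 := by rw [← Real.rpow_natCast]; norm_num
    rw [e] at h1' ⊢
    push_cast at h1' ⊢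
    linear_combination (-2 * θ * stepAt χ₁ 1 R (r ^ 2) * Real.log r) * h1'

theorem radius_eq (hs0 : 0 < s) (hs1 : s ≤ 1) {θ : ℂ} {r : ℝ} (hr : 0 < r)
    (hn : powRatio χ₁ s R θ r ≠ 0) :
    radius χ₁ s R θ r = r * Complex.exp (logRatio χ₁ s R θ r) := by
  have hsC : (s : ℂ) ≠ 0 := by exact_mod_cast hs0.ne'
  have hrs : 0 < r ^ (2 * s) := Real.rpow_pos_of_pos hr _
  have hrsC : ((r ^ (2 * s) : ℝ) : ℂ) ≠ 0 := by exact_mod_cast hrs.ne'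
  rw [radius, radiusPow_eq hs1 θ hr, Complex.cpow_def_of_ne_zero (mul_ne_zero hrsC hn),
    Complex.log_ofReal_mul hrs hn, add_mul, Complex.exp_add, Real.log_rpow hr, logRatio]
  congr 1
  · have : ((2 * s * Real.log r : ℝ) : ℂ) * (1 / (2 * (s : ℂ))) = ((Real.log r : ℝ) : ℂ) := by
      push_cast; field_simp
    rw [this, ← Complex.ofReal_exp, Real.exp_log hr]
  · congr 1; field_simp

theorem hasDerivAt_powRatio (hχ₁ : IsStep χ₁) {θ : ℂ} {r : ℝ} (hr : 0 < r) :
    HasDerivAt (powRatio χ₁ s R θ) (2 * s * (θ * deriv (amp χ₁ s R) r)) r := by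
  have h := ((contDiffAt_amp hχ₁ hr (s := s) (R := R)).differentiableAt (by simp)).hasDerivAt
  exact ((h.ofReal_comp.const_mul θ).const_mul (2 * (s : ℂ))).const_add 1

theorem hasDerivAt_logRatio (hχ₁ : IsStep χ₁) (hs0 : 0 < s) {θ : ℂ} {r : ℝ} (hr : 0 < r)
    (hn : powRatio χ₁ s R θ r ∈ Complex.slitPlane) :
    HasDerivAt (logRatio χ₁ s R θ) (stretch χ₁ s R θ r / r) r := by
  have hsC : (s : ℂ) ≠ 0 := by exact_mod_cast hs0.ne'
  have hrC : (r : ℂ) ≠ 0 := by exact_mod_cast hr.ne'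
  have := ((hasDerivAt_powRatio hχ₁ hr (s := s) (R := R) (θ := θ)).clog_real hn).div_const
    (2 * (s : ℂ))
  refine this.congr_deriv ?_
  have hn0 := Complex.slitPlane_ne_zero hn
  rw [stretch]
  push_cast
  field_simp

theorem contDiffAt_deriv_amp (hχ₁ : IsStep χ₁) {r : ℝ} (hr : 0 < r) :
    ContDiffAt ℝ ∞ (deriv (amp χ₁ s R)) r :=
  ((contDiffOn_infty_iff_deriv_of_isOpen isOpen_Ioi).1 (fun _ ht =>
    (contDiffAt_amp hχ₁ ht).contDiffWithinAt)).2.contDiffAt (Ioi_mem_nhds hr)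

/-- The derivative of `stretch`. -/
def stretchDeriv (χ₁ : ℝ → ℝ) (s R : ℝ) (θ : ℂ) (r : ℝ) : ℂ :=
  θ * (deriv (amp χ₁ s R) r + r * deriv (deriv (amp χ₁ s R)) r : ℝ) / powRatio χ₁ s R θ r
    - 2 * s * θ ^ 2 * (r * deriv (amp χ₁ s R) r : ℝ) * deriv (amp χ₁ s R) r
      / powRatio χ₁ s R θ r ^ 2

theorem hasDerivAt_stretch (hχ₁ : IsStep χ₁) {θ : ℂ} {r : ℝ} (hr : 0 < r)
    (hn : powRatio χ₁ s R θ r ≠ 0) :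
    HasDerivAt (stretch χ₁ s R θ) (stretchDeriv χ₁ s R θ r) r := by
  have hω : ContDiffAt ℝ ∞ (deriv (amp χ₁ s R)) r :=
    contDiffAt_deriv_amp hχ₁ hr
  have h := (hω.differentiableAt (by simp)).hasDerivAt
  have h2 := (((hasDerivAt_id r).mul h).ofReal_comp.const_mul θ).div
    (hasDerivAt_powRatio hχ₁ hr (s := s) (R := R) (θ := θ)) hn
  refine h2.congr_deriv ?_
  rw [stretchDeriv]
  simp only [id, Pi.mul_apply, one_mul]
  push_cast
  field_simp

/-- The second factor of the Jacobian is n(1 + S), with n = `powRatio` and S = `stretch`, and n =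
(r_θ/r)^{2s}, which restores the full power d. Both cases s < 1 and s = 1 thereby get a single
formula. -/
theorem jacobian_eq (d : ℕ) (hχ₁ : IsStep χ₁) (hs0 : 0 < s) (hs1 : s ≤ 1) {θ : ℂ} {r : ℝ}
    (hr : 0 < r) (hn : powRatio χ₁ s R θ r ≠ 0) (hl : |(logRatio χ₁ s R θ r).im| < Real.pi) :
    jacobian d χ₁ s R θ r =
      Complex.exp (d * logRatio χ₁ s R θ r) * (1 + stretch χ₁ s R θ r) := by
  have hsC : (s : ℂ) ≠ 0 := by exact_mod_cast hs0.ne'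
  have hrC : (r : ℂ) ≠ 0 := by exact_mod_cast hr.ne'
  have hrs : 0 < r ^ (2 * s) := Real.rpow_pos_of_pos hr _
  have e2 : Complex.exp (2 * s * logRatio χ₁ s R θ r) = powRatio χ₁ s R θ r := by
    rw [logRatio, mul_div_cancel₀ _ (by simpa using hsC), Complex.exp_log hn]
  have e1 : radius χ₁ s R θ r / r = Complex.exp (logRatio χ₁ s R θ r) := by
    rw [radius_eq hs0 hs1 hr hn]; field_simp
  -- The bound on the imaginary part ensures that the principal logarithm of exp(`logRatio`) is
  -- `logRatio` itself.
  have e3 : ∀ z : ℂ, (radius χ₁ s R θ r / r) ^ z = Complex.exp (z * logRatio χ₁ s R θ r) := by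
    intro z
    rw [abs_lt] at hl
    rw [e1, Complex.cpow_def_of_ne_zero (Complex.exp_ne_zero _),
      Complex.log_exp hl.1 hl.2.le, mul_comm]
  have hS := ((contDiff_stepAt hχ₁ (s := s) (R := R)).differentiable (by simp)
    (r ^ (2 * s))).hasDerivAt
  have hp := Real.hasDerivAt_rpow_const (p := 2 * s) (Or.inl hr.ne')
  have hc := hS.comp r hp
  have hω := ((contDiffAt_amp hχ₁ hr (s := s) (R := R)).differentiableAt (by simp)).hasDerivAt
  have hpω := hp.mul hω
  have hpm : r ^ (2 * s - 1) * r = r ^ (2 * s) := by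
    rw [← Real.rpow_add_one hr.ne']; ring_nf
  have hinv : ∀ t : ℝ, 0 < t → t ^ (2 * s) * t ^ (-(2 * s)) = 1 := fun t ht => by
    rw [← Real.rpow_add ht]; simp
  have key : (1 : ℂ) + θ * ((2 * s * amp χ₁ s R r + r * deriv (amp χ₁ s R) r : ℝ) : ℂ) =
      powRatio χ₁ s R θ r * (1 + stretch χ₁ s R θ r) := by
    have : powRatio χ₁ s R θ r * stretch χ₁ s R θ r = θ * (r * deriv (amp χ₁ s R) r : ℝ) := by
      rw [stretch]; field_simp
    rw [mul_add, this, powRatio]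
    push_cast; ring
  have main : jacobian d χ₁ s R θ r = (radius χ₁ s R θ r / r) ^ ((d : ℂ) - 2 * s) *
      (1 + θ * ((2 * s * amp χ₁ s R r + r * deriv (amp χ₁ s R) r : ℝ) : ℂ)) := by
    unfold jacobian
    split_ifs with h
    -- The derivative of the cut-off is obtained by differentiating the product r^{2s}·`amp` in two
    -- ways.
    · have hev : (fun t : ℝ => stepAt χ₁ s R (t ^ (2 * s))) =ᶠ[𝓝 r]
          fun t => t ^ (2 * s) * amp χ₁ s R t := by
        filter_upwards [Ioi_mem_nhds hr] with t ht
        rw [amp, if_pos h]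
        linear_combination (-stepAt χ₁ s R (t ^ (2 * s))) * hinv t ht
      have hu := (hc.congr_of_eventuallyEq hev.symm).unique hpω
      have hu' : 2 * s * deriv (stepAt χ₁ s R) (r ^ (2 * s)) =
          2 * s * amp χ₁ s R r + r * deriv (amp χ₁ s R) r := by
        refine mul_left_cancel₀ hrs.ne' ?_
        linear_combination r * hu + (2 * s * amp χ₁ s R r
          - 2 * s * deriv (stepAt χ₁ s R) (r ^ (2 * s))) * hpm
      rw [← hu']
      push_cast; ring
    · obtain rfl : s = 1 := le_antisymm hs1 (not_lt.1 h)
      have e : ∀ t : ℝ, t ^ (2 * 1 : ℝ) = t ^ 2 := fun t => by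
        rw [← Real.rpow_natCast]; norm_num
      have hev : (fun t : ℝ => stepAt χ₁ 1 R (t ^ (2 * 1 : ℝ)) * Real.log t) =ᶠ[𝓝 r]
          fun t => t ^ (2 * 1 : ℝ) * amp χ₁ 1 R t := by
        filter_upwards [Ioi_mem_nhds hr] with t ht
        rw [amp, if_neg h]
        linear_combination (-stepAt χ₁ 1 R (t ^ (2 * 1 : ℝ)) * Real.log t) * hinv t ht
      have hu := ((hc.mul (Real.hasDerivAt_log hr.ne')).congr_of_eventuallyEq hev.symm).unique hpω
      simp only [Function.comp, e] at hu hrs hpm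
      have hu' : r⁻¹ ^ 2 * stepAt χ₁ 1 R (r ^ 2) + 2 * Real.log r * deriv (stepAt χ₁ 1 R) (r ^ 2) =
          2 * 1 * amp χ₁ 1 R r + r * deriv (amp χ₁ 1 R) r := by
        refine mul_left_cancel₀ hrs.ne' ?_
        have hri : r * r⁻¹ = 1 := mul_inv_cancel₀ hr.ne'
        have e1 : r ^ (2 * 1 - 1 : ℝ) = r := by norm_num
        rw [e1] at hu
        linear_combination r * hu + (stepAt χ₁ 1 R (r ^ 2) * r * r⁻¹) * hri
      rw [← hu']
      push_cast; ring_nf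
  rw [main, key, e3, ← e2, ← mul_assoc, ← Complex.exp_add]
  congr 2
  ring

end

/-! ### Radial calculus and derivatives of the coefficients. -/

section

section RadialCalculus
variable {d : ℕ}

theorem hasFDerivAt_norm_of_ne {x : Space d} (hx : x ≠ 0) :
    HasFDerivAt (fun y : Space d => ‖y‖) (‖x‖⁻¹ • innerSL ℝ x) x := by
  have hx' : ‖x‖ ≠ 0 := norm_ne_zero_iff.2 hx
  have h := (hasStrictFDerivAt_norm_sq x).hasFDerivAt.sqrt (pow_ne_zero 2 hx')
  simp only [Real.sqrt_sq (norm_nonneg _)] at h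
  refine h.congr_fderiv ?_
  ext e
  simp
  field_simp

theorem hasFDerivAt_radial {f : ℝ → ℂ} {f' : ℂ} {x : Space d} (hx : x ≠ 0)
    (hf : HasDerivAt f f' ‖x‖) :
    HasFDerivAt (fun y : Space d => f ‖y‖)
      ((‖x‖⁻¹ • innerSL ℝ x).smulRight f') x := by
  refine (hf.hasFDerivAt.comp x (hasFDerivAt_norm_of_ne hx)).congr_fderiv ?_
  ext e
  simp [mul_assoc]

/-- `u` is differentiable at `x` with radial derivative `u'`. -/
def HasRadialDerivAt (u : Space d → ℂ) (u' : ℂ) (x : Space d) : Prop :=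
  DifferentiableAt ℝ u x ∧ radialDeriv u x = u'

theorem hasRadialDerivAt_radial {f : ℝ → ℂ} {f' : ℂ} {x : Space d} (hx : x ≠ 0)
    (hf : HasDerivAt f f' ‖x‖) : HasRadialDerivAt (fun y => f ‖y‖) f' x := by
  have h := hasFDerivAt_radial hx hf
  refine ⟨h.differentiableAt, ?_⟩
  have hx' : ‖x‖ ≠ 0 := norm_ne_zero_iff.2 hx
  rw [radialDeriv, h.fderiv]
  simp only [ContinuousLinearMap.smulRight_apply, smul_apply,
    innerSL_apply_apply, inner_smul_right, real_inner_self_eq_norm_sq, smul_eq_mul]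
  rw [show ‖x‖⁻¹ * (‖x‖⁻¹ * ‖x‖ ^ 2) = 1 by field_simp, one_smul]

theorem HasRadialDerivAt.mul {u v : Space d → ℂ} {u' v' : ℂ} {x : Space d}
    (hu : HasRadialDerivAt u u' x) (hv : HasRadialDerivAt v v' x) :
    HasRadialDerivAt (fun y => u y * v y) (u' * v x + u x * v') x := by
  refine ⟨hu.1.mul hv.1, ?_⟩
  rw [radialDeriv, fderiv_fun_mul hu.1 hv.1, ← hu.2, ← hv.2]
  simp [radialDeriv]
  ring

theorem HasRadialDerivAt.sub {u v : Space d → ℂ} {u' v' : ℂ} {x : Space d}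
    (hu : HasRadialDerivAt u u' x) (hv : HasRadialDerivAt v v' x) :
    HasRadialDerivAt (fun y => u y - v y) (u' - v') x := by
  refine ⟨hu.1.sub hv.1, ?_⟩
  rw [radialDeriv, fderiv_fun_sub hu.1 hv.1, ← hu.2, ← hv.2]
  simp [radialDeriv, mul_sub]

theorem HasRadialDerivAt.congr {u v : Space d → ℂ} {u' : ℂ} {x : Space d}
    (hu : HasRadialDerivAt u u' x) (h : v =ᶠ[𝓝 x] u) : HasRadialDerivAt v u' x := by
  refine ⟨hu.1.congr_of_eventuallyEq h, ?_⟩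
  rw [radialDeriv, h.fderiv_eq]
  exact hu.2

theorem contDiffAt_radialDeriv {g : Space d → ℂ} (hg : ContDiff ℝ ∞ g) {x : Space d}
    (hx : x ≠ 0) : ContDiffAt ℝ ∞ (radialDeriv g) x := by
  have h1 : ContDiffAt ℝ ∞ (fderiv ℝ g) x := hg.contDiffAt.fderiv_right (by simp)
  have h2 : ContDiffAt ℝ ∞ (fun y : Space d => ‖y‖⁻¹ • y) x :=
    ((contDiffAt_norm ℝ hx).inv (norm_ne_zero_iff.2 hx)).smul contDiffAt_id
  exact h1.clm_apply h2

theorem eventually_ne_zero {x : Space d} (hx : x ≠ 0) : ∀ᶠ y in 𝓝 x, y ≠ 0 :=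
  isOpen_ne.mem_nhds hx

end RadialCalculus

/-- The parameters `θ` for which all principal branches in the distortion are harmless. -/
structure Regular (d : ℕ) (χ₁ : ℝ → ℝ) (s R : ℝ) (θ : ℂ) : Prop where
  powRatio_mem : ∀ r > 0, powRatio χ₁ s R θ r ∈ Complex.slitPlane
  abs_im_lt : ∀ r > 0, |(logRatio χ₁ s R θ r).im| < Real.pi
  stretch_ne : ∀ r > 0, 1 + stretch χ₁ s R θ r ≠ 0
  jac_mem : ∀ r > 0, Complex.exp (d * logRatio χ₁ s R θ r) * (1 + stretch χ₁ s R θ r) ∈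
    Complex.slitPlane

/-- Coefficient of the radial part of the distorted Laplacian. -/
def radCoeff (χ₁ : ℝ → ℝ) (s R : ℝ) (θ : ℂ) (r : ℝ) : ℂ :=
  ((Complex.exp (logRatio χ₁ s R θ r) * (1 + stretch χ₁ s R θ r)) ^ 2)⁻¹

/-- Coefficient of the angular part of the distorted Laplacian. -/
def angCoeff (χ₁ : ℝ → ℝ) (s R : ℝ) (θ : ℂ) (r : ℝ) : ℂ :=
  Complex.exp (-2 * logRatio χ₁ s R θ r)

/-- Half the logarithmic derivative of the Jacobian. -/
def drift (d : ℕ) (χ₁ : ℝ → ℝ) (s R : ℝ) (θ : ℂ) (r : ℝ) : ℂ :=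
  1 / 2 * (d * (stretch χ₁ s R θ r / r) + stretchDeriv χ₁ s R θ r / (1 + stretch χ₁ s R θ r))

/-- Logarithmic derivative of `∂ r_θ / ∂ r`. -/
def radLogDeriv (χ₁ : ℝ → ℝ) (s R : ℝ) (θ : ℂ) (r : ℝ) : ℂ :=
  stretch χ₁ s R θ r / r + stretchDeriv χ₁ s R θ r / (1 + stretch χ₁ s R θ r)

section Coefficients
variable {d : ℕ} {χ₁ : ℝ → ℝ} {s R : ℝ} {θ : ℂ}

theorem contDiffAt_div_complex {f g : ℝ → ℂ} {r : ℝ} (hf : ContDiffAt ℝ ∞ f r)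
    (hg : ContDiffAt ℝ ∞ g r) (h0 : g r ≠ 0) : ContDiffAt ℝ ∞ (fun t => f t / g t) r := by
  simp only [div_eq_mul_inv]
  exact hf.mul (hg.inv h0)

theorem contDiffAt_powRatio (hχ₁ : IsStep χ₁) {r : ℝ} (hr : 0 < r) :
    ContDiffAt ℝ ∞ (powRatio χ₁ s R θ) r :=
  contDiffAt_const.add (contDiffAt_const.mul (contDiffAt_const.mul
    (Complex.ofRealCLM.contDiff.contDiffAt.comp r (contDiffAt_amp hχ₁ hr))))

theorem contDiffAt_stretch (hχ₁ : IsStep χ₁) {r : ℝ} (hr : 0 < r)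
    (hn : powRatio χ₁ s R θ r ≠ 0) : ContDiffAt ℝ ∞ (stretch χ₁ s R θ) r :=
  contDiffAt_div_complex (contDiffAt_const.mul (Complex.ofRealCLM.contDiff.contDiffAt.comp r
    (contDiffAt_id.mul (contDiffAt_deriv_amp hχ₁ hr)))) (contDiffAt_powRatio hχ₁ hr) hn

theorem contDiffAt_deriv_of {f : ℝ → ℂ} (hf : ∀ r > 0, ContDiffAt ℝ ∞ f r) {r : ℝ}
    (hr : 0 < r) : ContDiffAt ℝ ∞ (deriv f) r :=
  ((contDiffOn_infty_iff_deriv_of_isOpen isOpen_Ioi).1 (fun t ht =>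
    (hf t ht).contDiffWithinAt)).2.contDiffAt (Ioi_mem_nhds hr)

theorem Regular.contDiffAt_stretchDeriv (h : Regular d χ₁ s R θ) (hχ₁ : IsStep χ₁) {r : ℝ}
    (hr : 0 < r) : ContDiffAt ℝ ∞ (stretchDeriv χ₁ s R θ) r := by
  have hn := fun t ht => Complex.slitPlane_ne_zero (h.powRatio_mem t ht)
  refine (contDiffAt_deriv_of (fun t ht => contDiffAt_stretch hχ₁ ht (hn t ht)) hr
    ).congr_of_eventuallyEq ?_
  filter_upwards [Ioi_mem_nhds hr] with t ht
  exact (hasDerivAt_stretch hχ₁ ht (hn t ht)).deriv.symm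

theorem Regular.contDiffAt_logRatio (h : Regular d χ₁ s R θ) (hχ₁ : IsStep χ₁) {r : ℝ}
    (hr : 0 < r) : ContDiffAt ℝ ∞ (logRatio χ₁ s R θ) r := by
  have : ContDiffAt ℝ ∞ Complex.log (powRatio χ₁ s R θ r) :=
    (Complex.contDiffAt_log (h.powRatio_mem r hr)).restrict_scalars ℝ
  exact (this.comp r (contDiffAt_powRatio hχ₁ hr)).div_const _

theorem Regular.contDiffAt_radCoeff (h : Regular d χ₁ s R θ) (hχ₁ : IsStep χ₁) {r : ℝ}
    (hr : 0 < r) : ContDiffAt ℝ ∞ (radCoeff χ₁ s R θ) r := by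
  have hn := Complex.slitPlane_ne_zero (h.powRatio_mem r hr)
  refine ContDiffAt.inv (((h.contDiffAt_logRatio hχ₁ hr).cexp.mul
    (contDiffAt_const.add (contDiffAt_stretch hχ₁ hr hn))).pow 2) ?_
  exact pow_ne_zero 2 (mul_ne_zero (Complex.exp_ne_zero _) (h.stretch_ne r hr))

theorem Regular.contDiffAt_angCoeff (h : Regular d χ₁ s R θ) (hχ₁ : IsStep χ₁) {r : ℝ}
    (hr : 0 < r) : ContDiffAt ℝ ∞ (angCoeff χ₁ s R θ) r :=
  (contDiffAt_const.mul (h.contDiffAt_logRatio hχ₁ hr)).cexp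

theorem Regular.contDiffAt_drift (h : Regular d χ₁ s R θ) (hχ₁ : IsStep χ₁) {r : ℝ}
    (hr : 0 < r) : ContDiffAt ℝ ∞ (drift d χ₁ s R θ) r := by
  have hn := Complex.slitPlane_ne_zero (h.powRatio_mem r hr)
  have hS := contDiffAt_stretch (θ := θ) hχ₁ hr hn
  refine contDiffAt_const.mul ((contDiffAt_const.mul (contDiffAt_div_complex hS
    Complex.ofRealCLM.contDiff.contDiffAt ?_)).add
    (contDiffAt_div_complex (h.contDiffAt_stretchDeriv hχ₁ hr) (contDiffAt_const.add hS)
      (h.stretch_ne r hr)))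
  simpa using hr.ne'

theorem Regular.hasDerivAt_angCoeff (h : Regular d χ₁ s R θ) (hχ₁ : IsStep χ₁) (hs0 : 0 < s)
    {r : ℝ} (hr : 0 < r) : HasDerivAt (angCoeff χ₁ s R θ)
      (-2 * (stretch χ₁ s R θ r / r) * angCoeff χ₁ s R θ r) r := by
  refine (((hasDerivAt_logRatio hχ₁ hs0 hr (h.powRatio_mem r hr)).const_mul (-2)).cexp
    ).congr_deriv ?_
  rw [angCoeff]; ring

theorem Regular.hasDerivAt_radFactor (h : Regular d χ₁ s R θ) (hχ₁ : IsStep χ₁) (hs0 : 0 < s)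
    {r : ℝ} (hr : 0 < r) :
    HasDerivAt (fun t => Complex.exp (logRatio χ₁ s R θ t) * (1 + stretch χ₁ s R θ t))
      (radLogDeriv χ₁ s R θ r *
        (Complex.exp (logRatio χ₁ s R θ r) * (1 + stretch χ₁ s R θ r))) r := by
  have hn := Complex.slitPlane_ne_zero (h.powRatio_mem r hr)
  have hS := h.stretch_ne r hr
  refine (((hasDerivAt_logRatio hχ₁ hs0 hr (h.powRatio_mem r hr)).cexp).mul
    ((hasDerivAt_stretch hχ₁ hr hn).const_add 1)).congr_deriv ?_
  rw [radLogDeriv]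
  field_simp

theorem Regular.hasDerivAt_radCoeff (h : Regular d χ₁ s R θ) (hχ₁ : IsStep χ₁) (hs0 : 0 < s)
    {r : ℝ} (hr : 0 < r) : HasDerivAt (radCoeff χ₁ s R θ)
      (-2 * radLogDeriv χ₁ s R θ r * radCoeff χ₁ s R θ r) r := by
  have hp := mul_ne_zero (Complex.exp_ne_zero (logRatio χ₁ s R θ r)) (h.stretch_ne r hr)
  refine (((h.hasDerivAt_radFactor hχ₁ hs0 hr).pow 2).inv (pow_ne_zero 2 hp)).congr_deriv ?_
  rw [radCoeff]
  have h1 := Complex.exp_ne_zero (logRatio χ₁ s R θ r)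
  have h2 := h.stretch_ne r hr
  simp only [Pi.pow_apply]
  push_cast
  field_simp

theorem Regular.radius'_eq (h : Regular d χ₁ s R θ) (hχ₁ : IsStep χ₁) (hs0 : 0 < s)
    (hs1 : s ≤ 1) {r : ℝ} (hr : 0 < r) :
    radius' χ₁ s R θ r = Complex.exp (logRatio χ₁ s R θ r) * (1 + stretch χ₁ s R θ r) := by
  have hev : (fun t => radius χ₁ s R θ t) =ᶠ[𝓝 r]
      fun t => (t : ℂ) * Complex.exp (logRatio χ₁ s R θ t) := by
    filter_upwards [Ioi_mem_nhds hr] with t ht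
    exact radius_eq hs0 hs1 ht (Complex.slitPlane_ne_zero (h.powRatio_mem t ht))
  have hd := (hasDerivAt_id r).ofReal_comp.mul
    (hasDerivAt_logRatio hχ₁ hs0 hr (h.powRatio_mem r hr)).cexp
  rw [radius', hev.deriv_eq]
  refine hd.deriv.trans ?_
  have hrC : (r : ℂ) ≠ 0 := by exact_mod_cast hr.ne'
  simp only [id, Complex.ofReal_one]
  field_simp

theorem Regular.jacobian_eq (h : Regular d χ₁ s R θ) (hχ₁ : IsStep χ₁) (hs0 : 0 < s)
    (hs1 : s ≤ 1) {r : ℝ} (hr : 0 < r) : jacobian d χ₁ s R θ r =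
      Complex.exp (d * logRatio χ₁ s R θ r) * (1 + stretch χ₁ s R θ r) :=
  Repulsive.jacobian_eq d hχ₁ hs0 hs1 hr (Complex.slitPlane_ne_zero (h.powRatio_mem r hr))
    (h.abs_im_lt r hr)

theorem Regular.hasDerivAt_jacobian (h : Regular d χ₁ s R θ) (hχ₁ : IsStep χ₁) (hs0 : 0 < s)
    (hs1 : s ≤ 1) {r : ℝ} (hr : 0 < r) : HasDerivAt (jacobian d χ₁ s R θ)
      (2 * drift d χ₁ s R θ r * jacobian d χ₁ s R θ r) r := by
  have hev : jacobian d χ₁ s R θ =ᶠ[𝓝 r]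
      fun t => Complex.exp (d * logRatio χ₁ s R θ t) * (1 + stretch χ₁ s R θ t) := by
    filter_upwards [Ioi_mem_nhds hr] with t ht
    exact h.jacobian_eq hχ₁ hs0 hs1 ht
  have hn := Complex.slitPlane_ne_zero (h.powRatio_mem r hr)
  have hS := h.stretch_ne r hr
  refine HasDerivAt.congr_of_eventuallyEq ?_ hev
  refine ((((hasDerivAt_logRatio hχ₁ hs0 hr (h.powRatio_mem r hr)).const_mul (d : ℂ)).cexp).mul
    ((hasDerivAt_stretch hχ₁ hr hn).const_add 1)).congr_deriv ?_
  rw [drift, h.jacobian_eq hχ₁ hs0 hs1 hr]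
  field_simp

/-- Logarithmic differentiation, legitimate because the Jacobian avoids the cut of the principal
branch. Conjugating ∂_r by the square root of the Jacobian therefore subtracts `drift`. -/
theorem Regular.hasDerivAt_jacobian_rpow (h : Regular d χ₁ s R θ) (hχ₁ : IsStep χ₁)
    (hs0 : 0 < s) (hs1 : s ≤ 1) {r : ℝ} (hr : 0 < r) :
    HasDerivAt (fun t => jacobian d χ₁ s R θ t ^ (-(1 / 2) : ℂ))
      (-drift d χ₁ s R θ r * jacobian d χ₁ s R θ r ^ (-(1 / 2) : ℂ)) r := by
  have hJ : jacobian d χ₁ s R θ r ∈ Complex.slitPlane := by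
    rw [h.jacobian_eq hχ₁ hs0 hs1 hr]; exact h.jac_mem r hr
  have hJ0 := Complex.slitPlane_ne_zero hJ
  have h1 := (hasDerivAt_id (jacobian d χ₁ s R θ r)).cpow_const (c := (-(1 / 2) : ℂ)) hJ
  refine (h1.comp r (h.hasDerivAt_jacobian hχ₁ hs0 hs1 hr)).congr_deriv ?_
  simp only [id]
  rw [Complex.cpow_sub _ _ hJ0, Complex.cpow_one]
  field_simp

end Coefficients

end

/-! ### The distorted Laplacian with explicit coefficients and in divergence form. -/

section

variable {d : ℕ} {χ₁ : ℝ → ℝ} {s R : ℝ} {θ : ℂ}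

theorem hasRadialDerivAt_of_contDiffAt {u : Space d → ℂ} {x : Space d} (hu : ContDiffAt ℝ ∞ u x) :
    HasRadialDerivAt u (radialDeriv u x) x :=
  ⟨hu.differentiableAt (by simp), rfl⟩

/-- `∂_r g - b g`, the radial derivative conjugated by `J^{1/2}`. -/
def driftDeriv (d : ℕ) (χ₁ : ℝ → ℝ) (s R : ℝ) (θ : ℂ) (g : Space d → ℂ) (x : Space d) : ℂ :=
  radialDeriv g x - drift d χ₁ s R θ ‖x‖ * g x

theorem Regular.innerDeriv_eq (h : Regular d χ₁ s R θ) (hχ₁ : IsStep χ₁) (hs0 : 0 < s)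
    (hs1 : s ≤ 1) {g : Space d → ℂ} (hg : ContDiff ℝ ∞ g) {x : Space d} (hx : x ≠ 0) :
    innerDeriv χ₁ s R θ g x = (radius' χ₁ s R θ ‖x‖)⁻¹ *
      (jacobian d χ₁ s R θ ‖x‖ ^ (-(1 / 2) : ℂ) * driftDeriv d χ₁ s R θ g x) := by
  have hr : 0 < ‖x‖ := norm_pos_iff.2 hx
  have h1 := (hasRadialDerivAt_radial hx (h.hasDerivAt_jacobian_rpow hχ₁ hs0 hs1 hr)).mul
    (hasRadialDerivAt_of_contDiffAt hg.contDiffAt)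
  rw [innerDeriv, h1.2, driftDeriv]
  ring

theorem Regular.hasRadialDerivAt_driftDeriv (h : Regular d χ₁ s R θ) (hχ₁ : IsStep χ₁)
    {g : Space d → ℂ} (hg : ContDiff ℝ ∞ g) {x : Space d} (hx : x ≠ 0) :
    HasRadialDerivAt (driftDeriv d χ₁ s R θ g)
      (radialDeriv (driftDeriv d χ₁ s R θ g) x) x := by
  have hr : 0 < ‖x‖ := norm_pos_iff.2 hx
  exact ⟨(((hasRadialDerivAt_of_contDiffAt (contDiffAt_radialDeriv hg hx)).sub
    ((hasRadialDerivAt_radial hx ((h.contDiffAt_drift hχ₁ hr).differentiableAt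
      (by simp)).hasDerivAt).mul (hasRadialDerivAt_of_contDiffAt hg.contDiffAt)))).1, rfl⟩

/-- The distorted Laplacian with its coefficients made explicit. -/
theorem Regular.distortedNegLaplacian_eq (h : Regular d χ₁ s R θ) (hχ₁ : IsStep χ₁)
    (hs0 : 0 < s) (hs1 : s ≤ 1) {g : Space d → ℂ} (hg : ContDiff ℝ ∞ g) {x : Space d}
    (hx : x ≠ 0) :
    distortedNegLaplacian χ₁ s R θ g x =
      -(radCoeff χ₁ s R θ ‖x‖ * (radialDeriv (driftDeriv d χ₁ s R θ g) x +
        (drift d χ₁ s R θ ‖x‖ + ((d : ℂ) - 1) / ‖x‖ - 2 * radLogDeriv χ₁ s R θ ‖x‖) *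
          driftDeriv d χ₁ s R θ g x))
      - angCoeff χ₁ s R θ ‖x‖ * (Laplacian.laplacian g x - radialDeriv (radialDeriv g) x
        - ((d : ℂ) - 1) / ‖x‖ * radialDeriv g x) := by
  have hr : 0 < ‖x‖ := norm_pos_iff.2 hx
  have hrC : (‖x‖ : ℂ) ≠ 0 := by exact_mod_cast hr.ne'
  have hn := Complex.slitPlane_ne_zero (h.powRatio_mem _ hr)
  have hS := h.stretch_ne _ hr
  have hJ : jacobian d χ₁ s R θ ‖x‖ ≠ 0 := by
    rw [h.jacobian_eq hχ₁ hs0 hs1 hr]; exact Complex.slitPlane_ne_zero (h.jac_mem _ hr)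
  have hp0 := mul_ne_zero (Complex.exp_ne_zero (logRatio χ₁ s R θ ‖x‖)) hS
  have hJJ : jacobian d χ₁ s R θ ‖x‖ ^ (1 / 2 : ℂ) * jacobian d χ₁ s R θ ‖x‖ ^ (-(1 / 2) : ℂ) = 1 := by
    rw [← Complex.cpow_add _ _ hJ]; simp
  have hev : innerDeriv χ₁ s R θ g =ᶠ[𝓝 x] fun y =>
      (Complex.exp (logRatio χ₁ s R θ ‖y‖) * (1 + stretch χ₁ s R θ ‖y‖))⁻¹ *
      (jacobian d χ₁ s R θ ‖y‖ ^ (-(1 / 2) : ℂ) * driftDeriv d χ₁ s R θ g y) := by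
    filter_upwards [eventually_ne_zero hx] with y hy
    rw [h.innerDeriv_eq hχ₁ hs0 hs1 hg hy, h.radius'_eq hχ₁ hs0 hs1 (norm_pos_iff.2 hy)]
  have hd := ((hasRadialDerivAt_radial hx ((h.hasDerivAt_radFactor hχ₁ hs0 hr).inv hp0)).mul
    ((hasRadialDerivAt_radial hx (h.hasDerivAt_jacobian_rpow hχ₁ hs0 hs1 hr)).mul
      (h.hasRadialDerivAt_driftDeriv hχ₁ hg hx))).congr hev
  rw [distortedNegLaplacian, hd.2, hev.eq_of_nhds, h.radius'_eq hχ₁ hs0 hs1 hr,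
    radius_eq hs0 hs1 hr hn, sphereLaplacian, radCoeff, angCoeff]
  have hB : Complex.exp (-2 * logRatio χ₁ s R θ ‖x‖) =
      (Complex.exp (logRatio χ₁ s R θ ‖x‖) ^ 2)⁻¹ := by
    rw [← Complex.exp_nat_mul, ← Complex.exp_neg]; congr 1; push_cast; ring
  -- This relation merges the two first-order terms of the polar formula. What remains contains −2
  -- `radLogDeriv`, the logarithmic derivative of `radCoeff`, and so can be written as a divergence.
  have hdr : 2 * drift d χ₁ s R θ ‖x‖ = radLogDeriv χ₁ s R θ ‖x‖ +
      ((d : ℂ) - 1) * (stretch χ₁ s R θ ‖x‖ / ‖x‖) := by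
    rw [drift, radLogDeriv]; ring
  rw [hB]
  simp only [Pi.inv_apply]
  generalize jacobian d χ₁ s R θ ‖x‖ ^ (1 / 2 : ℂ) = j₁ at *
  generalize jacobian d χ₁ s R θ ‖x‖ ^ (-(1 / 2) : ℂ) = j₂ at *
  have hj : j₁ = j₂⁻¹ := eq_inv_of_mul_eq_one_left hJJ
  have hj₂ : j₂ ≠ 0 := right_ne_zero_of_mul_eq_one hJJ
  have he := Complex.exp_ne_zero (logRatio χ₁ s R θ ‖x‖)
  have hpi : radLogDeriv χ₁ s R θ ‖x‖ = 2 * drift d χ₁ s R θ ‖x‖ -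
      ((d : ℂ) - 1) * (stretch χ₁ s R θ ‖x‖ / ‖x‖) := by rw [hdr]; ring
  rw [hj, hpi]
  simp only [driftDeriv]
  generalize Complex.exp (logRatio χ₁ s R θ ‖x‖) = e at *
  generalize stretch χ₁ s R θ ‖x‖ = S at *
  field_simp
  ring

/-- The scalar part of the flux: `(A (∂_r g - b g) - B ∂_r g) / r`. -/
def flux (d : ℕ) (χ₁ : ℝ → ℝ) (s R : ℝ) (θ : ℂ) (g : Space d → ℂ) (x : Space d) : ℂ :=
  (radCoeff χ₁ s R θ ‖x‖ * driftDeriv d χ₁ s R θ g x - angCoeff χ₁ s R θ ‖x‖ * radialDeriv g x)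
    * ((‖x‖⁻¹ : ℝ) : ℂ)

/-- The flux vector field of the distorted Laplacian. -/
def fluxField (d : ℕ) (χ₁ : ℝ → ℝ) (s R : ℝ) (θ : ℂ) (g : Space d → ℂ) (i : Fin d)
    (x : Space d) : ℂ :=
  flux d χ₁ s R θ g x * ((x i : ℝ) : ℂ) +
    angCoeff χ₁ s R θ ‖x‖ * fderiv ℝ g x (EuclideanSpace.single i 1)

theorem sum_coord_mul (T : Space d →L[ℝ] ℂ) (x : Space d) :
    ∑ i, T (EuclideanSpace.single i 1) * ((x i : ℝ) : ℂ) = T x := by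
  conv_rhs => rw [← (EuclideanSpace.basisFun (Fin d) ℝ).sum_repr x]
  simp [map_sum, mul_comm]

theorem Regular.hasRadialDerivAt_flux (h : Regular d χ₁ s R θ) (hχ₁ : IsStep χ₁)
    (hs0 : 0 < s) {g : Space d → ℂ} (hg : ContDiff ℝ ∞ g) {x : Space d} (hx : x ≠ 0) :
    HasRadialDerivAt (flux d χ₁ s R θ g)
      ((-2 * radLogDeriv χ₁ s R θ ‖x‖ * radCoeff χ₁ s R θ ‖x‖ * driftDeriv d χ₁ s R θ g x
        + radCoeff χ₁ s R θ ‖x‖ * radialDeriv (driftDeriv d χ₁ s R θ g) x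
        - (-2 * (stretch χ₁ s R θ ‖x‖ / ‖x‖) * angCoeff χ₁ s R θ ‖x‖ * radialDeriv g x
          + angCoeff χ₁ s R θ ‖x‖ * radialDeriv (radialDeriv g) x)) * ((‖x‖⁻¹ : ℝ) : ℂ)
        + (radCoeff χ₁ s R θ ‖x‖ * driftDeriv d χ₁ s R θ g x
          - angCoeff χ₁ s R θ ‖x‖ * radialDeriv g x) * ((-(‖x‖ ^ 2)⁻¹ : ℝ) : ℂ)) x := by
  have hr : 0 < ‖x‖ := norm_pos_iff.2 hx
  have hi := (hasDerivAt_inv hr.ne').ofReal_comp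
  exact (((hasRadialDerivAt_radial hx (h.hasDerivAt_radCoeff hχ₁ hs0 hr)).mul
    (h.hasRadialDerivAt_driftDeriv hχ₁ hg hx)).sub
    ((hasRadialDerivAt_radial hx (h.hasDerivAt_angCoeff hχ₁ hs0 hr)).mul
      (hasRadialDerivAt_of_contDiffAt (contDiffAt_radialDeriv hg hx)))).mul
    (hasRadialDerivAt_radial hx hi)

theorem laplacian_eq_sum {g : Space d → ℂ} (x : Space d) :
    Laplacian.laplacian g x = ∑ i, fderiv ℝ (fderiv ℝ g) x (EuclideanSpace.single i 1)
      (EuclideanSpace.single i 1) := by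
  rw [InnerProductSpace.laplacian_eq_iteratedFDeriv_orthonormalBasis g
    (EuclideanSpace.basisFun (Fin d) ℝ)]
  simp [iteratedFDeriv_two_apply]

theorem radialDeriv_smul_norm {u : Space d → ℂ} {x : Space d} (hx : x ≠ 0) :
    fderiv ℝ u x x = ‖x‖ * radialDeriv u x := by
  have : (‖x‖ : ℂ) ≠ 0 := by exact_mod_cast norm_ne_zero_iff.2 hx
  rw [radialDeriv, map_smul, Complex.real_smul]
  push_cast
  field_simp

/-- The distorted Laplacian is a divergence up to a first-order term. -/
theorem Regular.sum_fderiv_fluxField (h : Regular d χ₁ s R θ) (hχ₁ : IsStep χ₁)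
    (hs0 : 0 < s) (hs1 : s ≤ 1) {g : Space d → ℂ} (hg : ContDiff ℝ ∞ g) {x : Space d}
    (hx : x ≠ 0) :
    ∑ i, fderiv ℝ (fluxField d χ₁ s R θ g i) x (EuclideanSpace.single i 1) =
      -distortedNegLaplacian χ₁ s R θ g x
        - drift d χ₁ s R θ ‖x‖ * radCoeff χ₁ s R θ ‖x‖ * driftDeriv d χ₁ s R θ g x := by
  have hr : 0 < ‖x‖ := norm_pos_iff.2 hx
  have hrC : (‖x‖ : ℂ) ≠ 0 := by exact_mod_cast hr.ne'
  have hfl := h.hasRadialDerivAt_flux hχ₁ hs0 hg hx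
  have hB := hasFDerivAt_radial hx (h.hasDerivAt_angCoeff hχ₁ hs0 hr)
  have hg2 : DifferentiableAt ℝ (fderiv ℝ g) x :=
    ((hg.fderiv_right (m := ∞) (by simp)).differentiable (by simp)) x
  have hterm : ∀ i : Fin d, fderiv ℝ (fluxField d χ₁ s R θ g i) x (EuclideanSpace.single i 1) =
      fderiv ℝ (flux d χ₁ s R θ g) x (EuclideanSpace.single i 1) * ((x i : ℝ) : ℂ)
      + flux d χ₁ s R θ g x
      + (-2 * (stretch χ₁ s R θ ‖x‖ / ‖x‖) * angCoeff χ₁ s R θ ‖x‖) * ((‖x‖⁻¹ : ℝ) : ℂ) *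
        (fderiv ℝ g x (EuclideanSpace.single i 1) * ((x i : ℝ) : ℂ))
      + angCoeff χ₁ s R θ ‖x‖ * fderiv ℝ (fderiv ℝ g) x (EuclideanSpace.single i 1)
        (EuclideanSpace.single i 1) := by
    intro i
    have hc : HasFDerivAt (fun y : Space d => ((y i : ℝ) : ℂ))
        (Complex.ofRealCLM.comp (EuclideanSpace.proj i : Space d →L[ℝ] ℝ)) x :=
      (Complex.ofRealCLM.comp (EuclideanSpace.proj i : Space d →L[ℝ] ℝ)).hasFDerivAt
    have hgi : HasFDerivAt (fun y => fderiv ℝ g y (EuclideanSpace.single i 1)) _ x :=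
      hg2.hasFDerivAt.clm_apply (hasFDerivAt_const (EuclideanSpace.single i (1 : ℝ)) x)
    have := (hfl.1.hasFDerivAt.mul hc).add (hB.mul hgi)
    rw [HasFDerivAt.fderiv (f := fluxField d χ₁ s R θ g i) this]
    simp [EuclideanSpace.inner_single_right]
    ring
  rw [Finset.sum_congr rfl fun i _ => hterm i]
  simp only [Finset.sum_add_distrib, ← Finset.mul_sum, sum_coord_mul, ← laplacian_eq_sum]
  rw [radialDeriv_smul_norm hx, radialDeriv_smul_norm hx, hfl.2,
    h.distortedNegLaplacian_eq hχ₁ hs0 hs1 hg hx, flux]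
  simp only [Finset.sum_const, Finset.card_univ, Fintype.card_fin, nsmul_eq_mul]
  push_cast
  field_simp
  ring

end

/-! ### Integration by parts. -/

section

variable {d : ℕ} {χ₁ : ℝ → ℝ} {s R : ℝ} {θ : ℂ}

/-- Compact support of `v` alone removes the boundary terms; the field `G` may be unrestricted at
infinity. -/
theorem integral_mul_divergence {v : Space d → ℂ} (hv : ContDiff ℝ 1 v)
    (hvc : HasCompactSupport v) {G : Fin d → Space d → ℂ} (hG : ∀ i, ContDiff ℝ 1 (G i)) :
    Integrable (fun x => v x * ∑ i, fderiv ℝ (G i) x (EuclideanSpace.single i 1)) ∧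
    Integrable (fun x => ∑ i, fderiv ℝ v x (EuclideanSpace.single i 1) * G i x) ∧
    ∫ x, v x * ∑ i, fderiv ℝ (G i) x (EuclideanSpace.single i 1) =
      -∫ x, ∑ i, fderiv ℝ v x (EuclideanSpace.single i 1) * G i x := by
  have c1 : ∀ i, Continuous fun x => fderiv ℝ (G i) x (EuclideanSpace.single i (1 : ℝ)) :=
    fun i => ((hG i).continuous_fderiv (by simp)).clm_apply continuous_const
  have c2 : ∀ i, Continuous fun x => fderiv ℝ v x (EuclideanSpace.single (i : Fin d) (1 : ℝ)) :=
    fun i => (hv.continuous_fderiv (by simp)).clm_apply continuous_const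
  have i1 : ∀ i, Integrable fun x =>
      v x * fderiv ℝ (G i) x (EuclideanSpace.single i (1 : ℝ)) := fun i =>
    (hv.continuous.mul (c1 i)).integrable_of_hasCompactSupport hvc.mul_right
  have i2 : ∀ i, Integrable fun x =>
      fderiv ℝ v x (EuclideanSpace.single i (1 : ℝ)) * G i x := fun i =>
    ((c2 i).mul (hG i).continuous).integrable_of_hasCompactSupport
      (hvc.fderiv_apply (𝕜 := ℝ) _).mul_right
  have i3 : ∀ i, Integrable fun x => v x * G i x := fun i =>
    (hv.continuous.mul (hG i).continuous).integrable_of_hasCompactSupport hvc.mul_right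
  simp only [Finset.mul_sum]
  refine ⟨integrable_finsetSum _ fun i _ => i1 i, integrable_finsetSum _ fun i _ => i2 i, ?_⟩
  rw [integral_finsetSum _ fun i _ => i1 i, integral_finsetSum _ fun i _ => i2 i,
    ← Finset.sum_neg_distrib]
  refine Finset.sum_congr rfl fun i _ => ?_
  exact integral_mul_fderiv_eq_neg_fderiv_mul_of_integrable (i2 i) (i1 i) (i3 i)
    (fun x _ => hv.differentiable (by simp) x) fun x _ => (hG i).differentiable (by simp) x

section NearZero

/-- The distortion is the identity inside radius R. Expressions that are singular at the origin in
polar coordinates thus reduce there to those of the ordinary Laplacian and are smooth. -/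
theorem near_zero_values (hχ₁ : IsStep χ₁) (hs0 : 0 < s) (hR : 0 < R) {r : ℝ} (hr : |r| < R) :
    radCoeff χ₁ s R θ r = 1 ∧ angCoeff χ₁ s R θ r = 1 ∧ drift d χ₁ s R θ r = 0 := by
  have h0 := amp_eventually_zero (χ₁ := χ₁) hχ₁ hs0 hR hr
  have h1 : deriv (amp χ₁ s R) r = 0 := by rw [h0.deriv_eq]; simp
  have h2 : deriv (deriv (amp χ₁ s R)) r = 0 := by rw [h0.deriv.deriv_eq]; simp
  have hL : logRatio χ₁ s R θ r = 0 := by simp [logRatio, powRatio, h0.eq_of_nhds]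
  have hS : stretch χ₁ s R θ r = 0 := by simp [stretch, h1]
  have hS' : stretchDeriv χ₁ s R θ r = 0 := by simp [stretchDeriv, h1, h2]
  simp [radCoeff, angCoeff, drift, hL, hS, hS']

theorem contDiff_of_near_zero {F G : Space d → ℂ} {n : ℕ∞ω} (hR : 0 < R)
    (hG : ContDiff ℝ n G) (h0 : ∀ x, ‖x‖ < R → F x = G x)
    (h : ∀ x ≠ 0, ContDiffAt ℝ n F x) : ContDiff ℝ n F := by
  rw [contDiff_iff_contDiffAt]
  intro x
  by_cases hx : ‖x‖ < R
  · refine hG.contDiffAt.congr_of_eventuallyEq ?_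
    filter_upwards [(isOpen_lt continuous_norm continuous_const).mem_nhds hx] with y hy
    exact h0 y hy
  · refine h x ?_
    rintro rfl
    exact hx (by simpa using hR)

theorem contDiffAt_comp_norm {f : ℝ → ℂ} {x : Space d} (hx : x ≠ 0)
    (hf : ContDiffAt ℝ ∞ f ‖x‖) : ContDiffAt ℝ ∞ (fun y : Space d => f ‖y‖) x :=
  hf.comp x (contDiffAt_norm ℝ hx)

theorem Regular.contDiffAt_driftDeriv (h : Regular d χ₁ s R θ) (hχ₁ : IsStep χ₁)
    {g : Space d → ℂ} (hg : ContDiff ℝ ∞ g) {x : Space d} (hx : x ≠ 0) :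
    ContDiffAt ℝ ∞ (driftDeriv d χ₁ s R θ g) x :=
  (contDiffAt_radialDeriv hg hx).sub ((contDiffAt_comp_norm hx
    (h.contDiffAt_drift hχ₁ (norm_pos_iff.2 hx))).mul hg.contDiffAt)

theorem Regular.contDiff_fluxField (h : Regular d χ₁ s R θ) (hχ₁ : IsStep χ₁) (hs0 : 0 < s)
    (hR : 0 < R) {g : Space d → ℂ} (hg : ContDiff ℝ ∞ g) (i : Fin d) :
    ContDiff ℝ ∞ (fluxField d χ₁ s R θ g i) := by
  have hgi : ContDiff ℝ ∞ fun y => fderiv ℝ g y (EuclideanSpace.single i (1 : ℝ)) :=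
    (hg.fderiv_right (m := ∞) (by simp)).clm_apply contDiff_const
  refine contDiff_of_near_zero hR hgi (fun x hx => ?_) fun x hx => ?_
  · obtain ⟨hA, hB, hb⟩ := near_zero_values (d := d) (θ := θ) hχ₁ hs0 hR
      (show |‖x‖| < R by rwa [abs_norm])
    simp [fluxField, flux, driftDeriv, hA, hB, hb]
  · have hr : 0 < ‖x‖ := norm_pos_iff.2 hx
    have hB := contDiffAt_comp_norm hx (h.contDiffAt_angCoeff hχ₁ hr)
    have hc : ContDiff ℝ ∞ fun y : Space d => ((y i : ℝ) : ℂ) :=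
      (Complex.ofRealCLM.comp (EuclideanSpace.proj i : Space d →L[ℝ] ℝ)).contDiff
    refine ContDiffAt.add (ContDiffAt.mul (ContDiffAt.mul ?_ ?_) hc.contDiffAt)
      (hB.mul hgi.contDiffAt)
    · exact ((contDiffAt_comp_norm hx (h.contDiffAt_radCoeff hχ₁ hr)).mul
        (h.contDiffAt_driftDeriv hχ₁ hg hx)).sub (hB.mul (contDiffAt_radialDeriv hg hx))
    · exact Complex.ofRealCLM.contDiff.contDiffAt.comp x
        ((contDiffAt_norm ℝ hx).inv hr.ne')

theorem Regular.contDiff_driftTerm (h : Regular d χ₁ s R θ) (hχ₁ : IsStep χ₁) (hs0 : 0 < s)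
    (hR : 0 < R) {g : Space d → ℂ} (hg : ContDiff ℝ ∞ g) :
    ContDiff ℝ ∞ fun x => drift d χ₁ s R θ ‖x‖ * radCoeff χ₁ s R θ ‖x‖ *
      driftDeriv d χ₁ s R θ g x := by
  refine contDiff_of_near_zero (G := 0) hR contDiff_const (fun x hx => ?_) fun x hx => ?_
  · obtain ⟨hA, hB, hb⟩ := near_zero_values (d := d) (θ := θ) hχ₁ hs0 hR
      (show |‖x‖| < R by rwa [abs_norm])
    simp [hb]
  · have hr : 0 < ‖x‖ := norm_pos_iff.2 hx
    exact ((contDiffAt_comp_norm hx (h.contDiffAt_drift hχ₁ hr)).mul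
      (contDiffAt_comp_norm hx (h.contDiffAt_radCoeff hχ₁ hr))).mul
      (h.contDiffAt_driftDeriv hχ₁ hg hx)

end NearZero

/-- Squared length of the gradient. -/
def gradSq (g : Space d → ℂ) (x : Space d) : ℝ :=
  ∑ i, ‖fderiv ℝ g x (EuclideanSpace.single i 1)‖ ^ 2

/-- Cauchy–Schwarz in the direction x/|x|. It makes the angular energy `gradSq` minus the squared
radial derivative nonnegative. -/
theorem norm_radialDeriv_sq_le (g : Space d → ℂ) {x : Space d} (hx : x ≠ 0) :
    ‖radialDeriv g x‖ ^ 2 ≤ gradSq g x := by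
  have hr : 0 < ‖x‖ := norm_pos_iff.2 hx
  have h1 : ‖(‖x‖ : ℂ) * radialDeriv g x‖ ≤
      ∑ i, ‖fderiv ℝ g x (EuclideanSpace.single i 1)‖ * |x i| := by
    rw [← radialDeriv_smul_norm hx, ← sum_coord_mul]
    refine (norm_sum_le _ _).trans (Finset.sum_le_sum fun i _ => ?_)
    rw [norm_mul]; simp
  have h2 := Finset.sum_mul_sq_le_sq_mul_sq Finset.univ
    (fun i => ‖fderiv ℝ g x (EuclideanSpace.single i 1)‖) (fun i => |x i|)
  have h3 : ∑ i, |x i| ^ 2 = ‖x‖ ^ 2 := by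
    rw [EuclideanSpace.norm_sq_eq]; simp
  rw [h3] at h2
  rw [norm_mul, Complex.norm_real, norm_norm] at h1
  have h4 : (‖x‖ * ‖radialDeriv g x‖) ^ 2 ≤ gradSq g x * ‖x‖ ^ 2 :=
    (pow_le_pow_left₀ (by positivity) h1 2).trans h2
  rw [mul_pow, mul_comm] at h4
  exact le_of_mul_le_mul_right h4 (by positivity)

/-- The density of the sesquilinear form of the distorted Laplacian, tested against `a g`;
`k`, `G2` stand for the radial derivative and the squared gradient of `g`. -/
def formDensity (A B b a a' g k : ℂ) (G2 : ℝ) : ℂ :=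
  A * (k - b * g) * (a' * conj g + a * conj k) + a * B * (G2 - ‖k‖ ^ 2 : ℝ)
    - a * conj g * (b * A * (k - b * g))

/-- Integration by parts for the distorted Laplacian against a radial weight. -/
theorem Regular.integral_form (hd : 1 ≤ d) (h : Regular d χ₁ s R θ) (hχ₁ : IsStep χ₁)
    (hs0 : 0 < s) (hs1 : s ≤ 1) (hR : 0 < R) {g : Space d → ℂ} (hg : ContDiff ℝ ∞ g)
    (hgc : HasCompactSupport g) {a a' : ℝ → ℂ} (ha : ContDiff ℝ 1 fun x : Space d => a ‖x‖)
    (ha' : ∀ r > 0, HasDerivAt a (a' r) r) :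
    let K := fun x : Space d => formDensity (radCoeff χ₁ s R θ ‖x‖) (angCoeff χ₁ s R θ ‖x‖)
      (drift d χ₁ s R θ ‖x‖) (a ‖x‖) (a' ‖x‖) (g x) (radialDeriv g x) (gradSq g x)
    Integrable K ∧
      Integrable (fun x => a ‖x‖ * conj (g x) * distortedNegLaplacian χ₁ s R θ g x) ∧
      ∫ x, a ‖x‖ * conj (g x) * distortedNegLaplacian χ₁ s R θ g x = ∫ x, K x := by
  intro K
  -- For d ≥ 1 the origin, where the polar formulas fail, is a null set.
  have : Nonempty (Fin d) := ⟨⟨0, hd⟩⟩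
  have hae : ∀ᵐ x : Space d, x ≠ 0 := by
    rw [ae_iff]; simp
  have hgconj : ContDiff ℝ 1 fun x => conj (g x) :=
    (Complex.conjCLE.contDiff.comp hg).of_le (by simp)
  have hv : ContDiff ℝ 1 fun x => a ‖x‖ * conj (g x) := ha.mul hgconj
  have hvc : HasCompactSupport fun x => a ‖x‖ * conj (g x) :=
    (hgc.comp_left (g := fun z : ℂ => conj z) (map_zero _)).mul_left
  obtain ⟨i1, i2, e⟩ := integral_mul_divergence hv hvc
    (G := fluxField d χ₁ s R θ g) fun i => (h.contDiff_fluxField hχ₁ hs0 hR hg i).of_le (by simp)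
  have i3 : Integrable fun x => a ‖x‖ * conj (g x) * (drift d χ₁ s R θ ‖x‖ *
      radCoeff χ₁ s R θ ‖x‖ * driftDeriv d χ₁ s R θ g x) :=
    (hv.continuous.mul (h.contDiff_driftTerm hχ₁ hs0 hR hg).continuous
      ).integrable_of_hasCompactSupport hvc.mul_right
  -- Pairing the gradient of a ḡ with the flux involves only its radial derivative and the full
  -- gradient, because the flux is a radial field plus `angCoeff` times the gradient of g.
  have hK : (fun x => ∑ i, fderiv ℝ (fun x => a ‖x‖ * conj (g x)) x (EuclideanSpace.single i 1) *
      fluxField d χ₁ s R θ g i x - a ‖x‖ * conj (g x) * (drift d χ₁ s R θ ‖x‖ *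
      radCoeff χ₁ s R θ ‖x‖ * driftDeriv d χ₁ s R θ g x)) =ᵐ[volume] K := by
    filter_upwards [hae] with x hx
    have hr : 0 < ‖x‖ := norm_pos_iff.2 hx
    have hrC : (‖x‖ : ℂ) ≠ 0 := by exact_mod_cast hr.ne'
    have hgx := (hg.differentiable (by simp) x).hasFDerivAt
    have hgcx : HasFDerivAt (fun x => conj (g x))
        ((Complex.conjCLE : ℂ →L[ℝ] ℂ).comp (fderiv ℝ g x)) x :=
      Complex.conjCLE.hasFDerivAt.comp x hgx
    have hvx := (hasFDerivAt_radial hx (ha' _ hr)).mul hgcx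
    have hrv := ((hasRadialDerivAt_radial hx (ha' _ hr)).mul
      (v' := conj (radialDeriv g x)) ⟨hgcx.differentiableAt, by
        rw [radialDeriv, hgcx.fderiv]; simp [radialDeriv]⟩)
    have e1 : ∑ i, fderiv ℝ (fun x => a ‖x‖ * conj (g x)) x (EuclideanSpace.single i 1) *
        fluxField d χ₁ s R θ g i x = flux d χ₁ s R θ g x *
          (‖x‖ * (a' ‖x‖ * conj (g x) + a ‖x‖ * conj (radialDeriv g x)))
        + angCoeff χ₁ s R θ ‖x‖ * (a' ‖x‖ * conj (g x) * radialDeriv g x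
          + a ‖x‖ * (gradSq g x : ℝ)) := by
      have t : ∀ i, fderiv ℝ (fun x => a ‖x‖ * conj (g x)) x (EuclideanSpace.single i 1) *
          fluxField d χ₁ s R θ g i x = flux d χ₁ s R θ g x *
            (fderiv ℝ (fun x => a ‖x‖ * conj (g x)) x (EuclideanSpace.single i 1)
              * ((x i : ℝ) : ℂ))
          + (angCoeff χ₁ s R θ ‖x‖ * a' ‖x‖ * conj (g x) * (‖x‖ : ℂ)⁻¹) *
            (fderiv ℝ g x (EuclideanSpace.single i 1) * ((x i : ℝ) : ℂ))
          + (angCoeff χ₁ s R θ ‖x‖ * a ‖x‖) *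
            ((‖fderiv ℝ g x (EuclideanSpace.single i 1)‖ ^ 2 : ℝ) : ℂ) := by
        intro i
        have e2 : fderiv ℝ (fun x => a ‖x‖ * conj (g x)) x (EuclideanSpace.single i 1) =
            a ‖x‖ * conj (fderiv ℝ g x (EuclideanSpace.single i 1)) +
            (‖x‖ : ℂ)⁻¹ * (x i : ℝ) * a' ‖x‖ * conj (g x) := by
          rw [HasFDerivAt.fderiv (f := fun x => a ‖x‖ * conj (g x)) hvx]
          simp [EuclideanSpace.inner_single_right]
          ring
        have e3 : conj (fderiv ℝ g x (EuclideanSpace.single i 1)) *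
            fderiv ℝ g x (EuclideanSpace.single i 1) =
            ((‖fderiv ℝ g x (EuclideanSpace.single i 1)‖ ^ 2 : ℝ) : ℂ) := by
          rw [Complex.conj_mul']; push_cast; rfl
        rw [fluxField, ← e3, mul_add, e2]
        ring
      rw [Finset.sum_congr rfl fun i _ => t i]
      simp only [Finset.sum_add_distrib, ← Finset.mul_sum, sum_coord_mul]
      rw [radialDeriv_smul_norm hx, radialDeriv_smul_norm hx, hrv.2, gradSq]
      push_cast
      field_simp
      ring
    have e4 : conj (radialDeriv g x) * radialDeriv g x = ((‖radialDeriv g x‖ ^ 2 : ℝ) : ℂ) := by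
      rw [Complex.conj_mul']; push_cast; rfl
    simp only [K, formDensity]
    rw [e1, Complex.ofReal_sub, ← e4, flux, driftDeriv]
    push_cast
    field_simp
    ring
  have hD : (fun x => a ‖x‖ * conj (g x) * distortedNegLaplacian χ₁ s R θ g x) =ᵐ[volume]
      fun x => -(a ‖x‖ * conj (g x) * ∑ i, fderiv ℝ (fluxField d χ₁ s R θ g i) x
        (EuclideanSpace.single i 1)) - a ‖x‖ * conj (g x) * (drift d χ₁ s R θ ‖x‖ *
      radCoeff χ₁ s R θ ‖x‖ * driftDeriv d χ₁ s R θ g x) := by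
    filter_upwards [hae] with x hx
    rw [h.sum_fderiv_fluxField hχ₁ hs0 hs1 hg hx]
    ring
  refine ⟨(i2.sub i3).congr hK, (i1.neg.sub i3).congr hD.symm, ?_⟩
  have i1' : Integrable fun x => -(a ‖x‖ * conj (g x) *
      ∑ i, fderiv ℝ (fluxField d χ₁ s R θ g i) x (EuclideanSpace.single i 1)) := i1.neg
  rw [integral_congr_ae hD, ← integral_congr_ae hK, integral_sub i1' i3, integral_sub i2 i3,
    integral_neg, e, neg_neg]

end

/-! ### Bounds for the form density and for the coefficients, uniform in β. -/

section

variable {d : ℕ} {χ₁ : ℝ → ℝ} {s R : ℝ} {θ : ℂ}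

/-- Only the two purely kinetic terms carry a useful sign. The other five contain a factor g or its
conjugate and are estimated by their moduli. -/
theorem formDensity_re_ge (A B b a a' g k : ℂ) (G2 : ℝ) :
    (a * A).re * ‖k‖ ^ 2 + (a * B).re * (G2 - ‖k‖ ^ 2)
      - ‖A‖ * (‖a'‖ + 2 * ‖a‖ * ‖b‖) * (‖g‖ * ‖k‖)
      - ‖A‖ * (‖a'‖ * ‖b‖ + ‖a‖ * ‖b‖ ^ 2) * ‖g‖ ^ 2 ≤ (formDensity A B b a a' g k G2).re := by
  have hk : k * conj k = ((‖k‖ ^ 2 : ℝ) : ℂ) := by rw [Complex.mul_conj']; push_cast; rfl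
  have e : formDensity A B b a a' g k G2 = ((‖k‖ ^ 2 : ℝ) : ℂ) * (a * A)
      + ((G2 - ‖k‖ ^ 2 : ℝ) : ℂ) * (a * B)
      + (A * a' * conj g * k - A * b * a' * g * conj g - A * b * a * g * conj k
        - A * b * a * conj g * k + A * b ^ 2 * a * g * conj g) := by
    rw [← hk, formDensity]; ring
  have h1 : ‖A * a' * conj g * k - A * b * a' * g * conj g - A * b * a * g * conj k
        - A * b * a * conj g * k + A * b ^ 2 * a * g * conj g‖ ≤
      ‖A * a' * conj g * k‖ + ‖A * b * a' * g * conj g‖ + ‖A * b * a * g * conj k‖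
        + ‖A * b * a * conj g * k‖ + ‖A * b ^ 2 * a * g * conj g‖ := by
    refine (norm_add_le _ _).trans (add_le_add_left ?_ _)
    refine (norm_sub_le _ _).trans (add_le_add_left ?_ _)
    refine (norm_sub_le _ _).trans (add_le_add_left ?_ _)
    exact norm_sub_le _ _
  simp only [norm_mul, norm_pow, RCLike.norm_conj] at h1
  have h2 := (abs_le.1 ((Complex.abs_re_le_norm _).trans h1)).1
  rw [e, Complex.add_re, Complex.add_re, Complex.re_ofReal_mul, Complex.re_ofReal_mul]
  nlinarith [h2]

/-- Uniform bounds on the coefficients of the distorted Laplacian for `θ = iβ`, `β` small. -/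
theorem coefficient_bounds (d : ℕ) (hχ₁ : IsStep χ₁) (hs0 : 0 < s) (hs1 : s ≤ 1) (hR : 0 < R) :
    ∃ β₁ > (0 : ℝ), ∃ C > (0 : ℝ), ∀ β ∈ Ioo (0 : ℝ) β₁,
      Regular d χ₁ s R (Complex.I * β) ∧ ∀ r > (0 : ℝ), ∀ m : ℝ, m = 1 ∨ m = r ^ (-s) →
      ‖angCoeff χ₁ s R (Complex.I * β) r - 1 + 2 * Complex.I * (β * amp χ₁ s R r : ℝ)‖
        ≤ C * (β * m) ^ 2 ∧
      ‖radCoeff χ₁ s R (Complex.I * β) r - 1 + 2 * Complex.I *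
        (β * (amp χ₁ s R r + r * deriv (amp χ₁ s R) r) : ℝ)‖ ≤ C * (β * m) ^ 2 ∧
      ‖drift d χ₁ s R (Complex.I * β) r‖ ≤ C * (β * m) := by
  obtain ⟨D, hD, hb⟩ := amp_bounds hχ₁ hs0 hs1 hR (χ₁ := χ₁) (s := s) (R := R)
  obtain ⟨ε₀, hε₀, C, hC, hexp⟩ := coefficient_expansion d hs0
  -- The part `C * D ^ 2` serves the two kinetic coefficients, the bracket serves `drift`.
  refine ⟨min 1 (ε₀ / D), by positivity, C * D ^ 2 + (d * D + 4 * D + 8 * s * D ^ 2),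
    by positivity, ?_⟩
  rintro β ⟨hβ0, hβ⟩
  have hβ1 : β ≤ 1 := hβ.le.trans (min_le_left _ _)
  have hβD : β * D ≤ ε₀ := (le_div_iff₀ hD).1 (hβ.le.trans (min_le_right _ _))
  have key : ∀ r > (0 : ℝ), ∀ m : ℝ, 0 < m → m ≤ 1 → |amp χ₁ s R r| ≤ D * m →
      |r * deriv (amp χ₁ s R) r| ≤ D * m → _ := fun r hr m hm0 hm1 h1 h2 =>
    hexp (β * amp χ₁ s R r) (β * (r * deriv (amp χ₁ s R) r)) (β * (D * m))
      (by rw [abs_mul, abs_of_pos hβ0]; gcongr) (by rw [abs_mul, abs_of_pos hβ0]; gcongr)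
      (by
        calc β * (D * m) = β * D * m := by ring
          _ ≤ ε₀ * 1 := by gcongr
          _ = ε₀ := mul_one _)
      (powRatio χ₁ s R (Complex.I * β) r) (logRatio χ₁ s R (Complex.I * β) r)
      (1 + stretch χ₁ s R (Complex.I * β) r)
      (by rw [powRatio]; push_cast; ring) rfl (by rw [stretch]; push_cast; ring)
  have key1 : ∀ r > (0 : ℝ), _ := fun r hr => key r hr 1 one_pos le_rfl
    (by simpa using (hb r hr (amp χ₁ s R r) (by simp)).1)
    (by simpa using (hb r hr (r * deriv (amp χ₁ s R) r) (by simp)).1)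
  refine ⟨⟨fun r hr => (key1 r hr).1, fun r hr => (key1 r hr).2.2.1, fun r hr h0 => ?_,
    fun r hr => (key1 r hr).2.2.2.2.1⟩, fun r hr m hm => ?_⟩
  · have := (key1 r hr).2.2.2.1
    rw [h0, norm_zero] at this
    linarith
  · have hm0 : 0 < m := by
      rcases hm with rfl | rfl
      · exact one_pos
      · exact Real.rpow_pos_of_pos hr _
    have hbm : ∀ y ∈ ({amp χ₁ s R r, deriv (amp χ₁ s R) r, r * deriv (amp χ₁ s R) r,
        r * deriv (deriv (amp χ₁ s R)) r} : Set ℝ), |y| ≤ D * m := by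
      intro y hy
      rcases hm with rfl | rfl
      · simpa using (hb r hr y hy).1
      · exact (hb r hr y hy).2
    -- Near the origin r^{-s} exceeds 1 and could violate the smallness condition of the expansion,
    -- which is therefore applied with min(m, 1).
    have hmm : min m 1 ≤ m := min_le_left _ _
    have hbmin : ∀ y ∈ ({amp χ₁ s R r, deriv (amp χ₁ s R) r, r * deriv (amp χ₁ s R) r,
        r * deriv (deriv (amp χ₁ s R)) r} : Set ℝ), |y| ≤ D * min m 1 := by
      intro y hy
      rw [mul_min_of_nonneg _ _ hD.le]
      exact le_min (hbm y hy) (by simpa using (hb r hr y hy).1)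
    have hmin0 : 0 < min m 1 := lt_min hm0 one_pos
    obtain ⟨-, k2, -, k4, -, k6, k7⟩ := key r hr (min m 1) hmin0 (min_le_right _ _)
      (hbmin (amp χ₁ s R r) (by simp)) (hbmin (r * deriv (amp χ₁ s R) r) (by simp))
    have hq : C * (β * (D * min m 1)) ^ 2 ≤
        (C * D ^ 2 + (d * D + 4 * D + 8 * s * D ^ 2)) * (β * m) ^ 2 := by
      calc C * (β * (D * min m 1)) ^ 2 ≤ C * (β * (D * m)) ^ 2 := by gcongr
        _ = (C * D ^ 2) * (β * m) ^ 2 := by ring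
        _ ≤ _ := by
          gcongr
          have : (0 : ℝ) ≤ d * D + 4 * D + 8 * s * D ^ 2 := by positivity
          linarith
    refine ⟨?_, ?_, ?_⟩
    · exact k6.trans hq
    · refine le_trans (le_of_eq ?_) (k7.trans hq)
      rw [radCoeff]
      push_cast
      congr 2
      ring
    · have hβn : ‖Complex.I * (β : ℂ)‖ = β := by simp [abs_of_pos hβ0]
      have w1 : ‖stretch χ₁ s R (Complex.I * β) r / r‖ ≤ 2 * (β * (D * m)) := by
        have hrC : (r : ℂ) ≠ 0 := by exact_mod_cast hr.ne'
        have : stretch χ₁ s R (Complex.I * β) r / r =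
            Complex.I * β * (deriv (amp χ₁ s R) r : ℝ) / powRatio χ₁ s R (Complex.I * β) r := by
          rw [stretch]; push_cast; field_simp
        rw [this, norm_div, norm_mul, hβn, Complex.norm_real, Real.norm_eq_abs,
          div_le_iff₀ (by linarith)]
        have := hbm (deriv (amp χ₁ s R) r) (by simp)
        calc β * |deriv (amp χ₁ s R) r| ≤ β * (D * m) := by gcongr
          _ = 2 * (β * (D * m)) * (1 / 2) := by ring
          _ ≤ _ := by gcongr
      have w2 : ‖stretchDeriv χ₁ s R (Complex.I * β) r‖ ≤ β * m * (4 * D + 8 * s * D ^ 2) := by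
        have v1 := hbm (deriv (amp χ₁ s R) r) (by simp)
        have v2 := hbm (r * deriv (deriv (amp χ₁ s R)) r) (by simp)
        have v3 := hbm (r * deriv (amp χ₁ s R) r) (by simp)
        have v4 : |deriv (amp χ₁ s R) r| ≤ D := (hb r hr (deriv (amp χ₁ s R) r) (by simp)).1
        rw [stretchDeriv]
        refine (norm_sub_le _ _).trans ?_
        have p1 : ‖Complex.I * β * (deriv (amp χ₁ s R) r + r * deriv (deriv (amp χ₁ s R)) r : ℝ)
            / powRatio χ₁ s R (Complex.I * β) r‖ ≤ β * m * (4 * D) := by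
          rw [norm_div, norm_mul, hβn, Complex.norm_real, Real.norm_eq_abs,
            div_le_iff₀ (by linarith)]
          calc β * |deriv (amp χ₁ s R) r + r * deriv (deriv (amp χ₁ s R)) r|
              ≤ β * (D * m + D * m) := by
                gcongr
                exact (abs_add_le _ _).trans (add_le_add v1 v2)
            _ = β * m * (4 * D) * (1 / 2) := by ring
            _ ≤ _ := by gcongr
        have p2 : ‖2 * s * (Complex.I * β) ^ 2 * (r * deriv (amp χ₁ s R) r : ℝ) *
            deriv (amp χ₁ s R) r / powRatio χ₁ s R (Complex.I * β) r ^ 2‖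
            ≤ β * m * (8 * s * D ^ 2) := by
          rw [norm_div, norm_mul, norm_mul, norm_mul, norm_pow, hβn, norm_mul, norm_pow,
            Complex.norm_real, Complex.norm_real, Complex.norm_real, Real.norm_eq_abs,
            Real.norm_eq_abs, Real.norm_eq_abs, abs_of_pos hs0, Complex.norm_ofNat,
            div_le_iff₀ (by positivity)]
          calc 2 * s * β ^ 2 * |r * deriv (amp χ₁ s R) r| * |deriv (amp χ₁ s R) r|
              ≤ 2 * s * (β * 1) * (D * m) * D := by
                rw [pow_two]
                gcongr
            _ = β * m * (8 * s * D ^ 2) * (1 / 2) ^ 2 := by ring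
            _ ≤ _ := by gcongr
        linarith
      have w3 : ‖stretchDeriv χ₁ s R (Complex.I * β) r /
          (1 + stretch χ₁ s R (Complex.I * β) r)‖ ≤ 2 * (β * m * (4 * D + 8 * s * D ^ 2)) := by
        rw [norm_div, div_le_iff₀ (by linarith)]
        calc _ ≤ _ := w2
          _ = 2 * (β * m * (4 * D + 8 * s * D ^ 2)) * (1 / 2) := by ring
          _ ≤ _ := by gcongr
      rw [drift, norm_mul]
      have w4 := norm_add_le ((d : ℂ) * (stretch χ₁ s R (Complex.I * β) r / r))
        (stretchDeriv χ₁ s R (Complex.I * β) r / (1 + stretch χ₁ s R (Complex.I * β) r))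
      rw [norm_mul, Complex.norm_natCast] at w4
      have w5 : (d : ℝ) * ‖stretch χ₁ s R (Complex.I * β) r / r‖ ≤ d * (2 * (β * (D * m))) := by
        gcongr
      have w6 : 0 ≤ C * D ^ 2 * (β * m) := by positivity
      have w7 : ‖(1 / 2 : ℂ)‖ = 1 / 2 := by norm_num
      rw [w7]
      nlinarith

end

/-! ### Expansion of the distorted potential, and consequences of the energy hypotheses. -/

section

variable {d : ℕ} {χ₁ : ℝ → ℝ} {s R : ℝ}

theorem realRadius_eq (hs0 : 0 < s) (hs1 : s ≤ 1) {r t : ℝ} (hr : 0 < r)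
    (ht : 0 < 1 + 2 * s * t * amp χ₁ s R r) :
    realRadius χ₁ s R t r = r * (1 + 2 * s * t * amp χ₁ s R r) ^ (1 / (2 * s)) := by
  have h1 : r ^ (2 * s) * r ^ (-(2 * s)) = 1 := by
    rw [← Real.rpow_add hr]; simp
  have hrr : r ^ (2 * s) * (1 + 2 * s * t * amp χ₁ s R r) =
      r ^ (2 * s) + 2 * s * t * (stepAt χ₁ s R (r ^ (2 * s)) * if s < 1 then 1 else Real.log r) := by
    rw [amp]
    linear_combination (2 * s * t * (stepAt χ₁ s R (r ^ (2 * s)) *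
      if s < 1 then 1 else Real.log r)) * h1
  have h2 : (r ^ (2 * s) * (1 + 2 * s * t * amp χ₁ s R r)) ^ (1 / (2 * s)) =
      r * (1 + 2 * s * t * amp χ₁ s R r) ^ (1 / (2 * s)) := by
    rw [Real.mul_rpow (by positivity) ht.le, ← Real.rpow_mul hr.le,
      mul_one_div_cancel (by positivity), Real.rpow_one]
  rw [← h2, hrr, realRadius]
  split_ifs with h
  · simp
  · obtain rfl : s = 1 := le_antisymm hs1 (not_lt.1 h)
    have e : r ^ (2 * 1 : ℝ) = r ^ 2 := by rw [← Real.rpow_natCast]; norm_num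
    rw [e, Real.sqrt_eq_rpow]
    ring_nf

/-- First-order expansion of the distorted potential. -/
theorem IsAnalyticExtension.expansion {q : Space d → ℝ} {β₀ ℓ : ℝ} {Q : ℂ → Space d → ℂ}
    (hQ : IsAnalyticExtension χ₁ s R q β₀ ℓ Q) (hq : LongRange s q) (hs0 : 0 < s) (hs1 : s ≤ 1)
    (hβ₀ : 0 < β₀) (hℓ : 0 < ℓ) :
    ∃ β₁ > (0 : ℝ), ∃ C > (0 : ℝ), ∀ β ∈ Ioo (0 : ℝ) β₁, ∀ x : Space d, x ≠ 0 →
      ‖Q (Complex.I * β) x - q x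
        - Complex.I * (β * (amp χ₁ s R ‖x‖ * ‖x‖ * radialDeriv q x) : ℝ)‖ ≤ C * β ^ 2 := by
  set ρ := min ℓ β₀ / 2 with hρdef
  have hρ : 0 < ρ := by positivity
  have hρℓ : ρ < ℓ := by
    have := min_le_left ℓ β₀
    linarith
  have hρβ : ρ < β₀ := by
    have := min_le_right ℓ β₀
    linarith
  have hsub : Metric.closedBall (0 : ℂ) ρ ⊆ region β₀ ℓ := fun z hz => by
    rw [mem_closedBall_zero_iff] at hz
    exact ⟨hz.trans_lt hρℓ, ((Complex.abs_im_le_norm z).trans hz).trans_lt hρβ⟩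
  obtain ⟨M, hM⟩ := hQ.uniform _ hsub (isCompact_closedBall _ _)
  refine ⟨ρ, hρ, 4 * max M 1 / ρ ^ 2, by positivity, fun β hβ x hx => ?_⟩
  have hr : 0 < ‖x‖ := norm_pos_iff.2 hx
  have hdiff : DifferentiableOn ℂ (fun θ => Q θ x - q x) (Metric.ball 0 ρ) :=
    ((hQ.analytic x).mono (Metric.ball_subset_closedBall.trans hsub)).sub_const _
  have hreal : ∀ᶠ t : ℝ in 𝓝 0, Q t x - q x =
      ((q (((1 + 2 * s * t * amp χ₁ s R ‖x‖) ^ (1 / (2 * s))) • x) - q x : ℝ) : ℂ) := by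
    have c : ContinuousAt (fun t : ℝ => 1 + 2 * s * t * amp χ₁ s R ‖x‖) 0 := by fun_prop
    filter_upwards [c.eventually (lt_mem_nhds (show (0 : ℝ) < 1 + 2 * s * 0 * amp χ₁ s R ‖x‖ by
      simp)), Metric.ball_mem_nhds (0 : ℝ) hℓ] with t ht htℓ
    rw [hQ.eq_real t (by simpa using htℓ), realRadius_eq hs0 hs1 hr ht, mul_comm ‖x‖,
      mul_div_assoc, div_self hr.ne', mul_one]
    push_cast; rfl
  have h0 : Q ((0 : ℝ) : ℂ) x - q x = 0 := by
    rw [hreal.self_of_nhds]; simp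
  -- The complex derivative at 0 is determined along the real axis, where the extension is q at a
  -- dilated point and the chain rule applies.
  have hder : deriv (fun θ => Q θ x - q x) 0 =
      ((amp χ₁ s R ‖x‖ * ‖x‖ * radialDeriv q x : ℝ) : ℂ) := by
    have d1 : HasDerivAt (fun θ => Q θ x - q x) (deriv (fun θ => Q θ x - q x) 0) ((0 : ℝ) : ℂ) := by
      rw [Complex.ofReal_zero]
      exact (hdiff.differentiableAt (Metric.ball_mem_nhds _ hρ)).hasDerivAt
    have d2 : HasDerivAt (fun t : ℝ => (1 + 2 * s * t * amp χ₁ s R ‖x‖) ^ (1 / (2 * s)))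
        (amp χ₁ s R ‖x‖) 0 := by
      have : HasDerivAt (fun t : ℝ => 1 + 2 * s * t * amp χ₁ s R ‖x‖)
          (2 * s * amp χ₁ s R ‖x‖) 0 := by
        have := (((hasDerivAt_id (0 : ℝ)).const_mul (2 * s)).mul_const
          (amp χ₁ s R ‖x‖)).const_add 1
        simpa using this
      refine (this.rpow_const (p := 1 / (2 * s)) (Or.inl (by simp))).congr_deriv ?_
      simp
      field_simp
    have d3 : HasDerivAt (fun t : ℝ => (1 + 2 * s * t * amp χ₁ s R ‖x‖) ^ (1 / (2 * s)) • x)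
        (amp χ₁ s R ‖x‖ • x) 0 := d2.smul_const x
    have hqd : HasFDerivAt q (fderiv ℝ q x)
        ((1 + 2 * s * (0 : ℝ) * amp χ₁ s R ‖x‖) ^ (1 / (2 * s)) • x) := by
      simpa using (hq.1.differentiable (by simp) x).hasFDerivAt
    have d4 := ((hqd.comp_hasDerivAt (0 : ℝ) d3).sub_const (q x)).ofReal_comp
    have d5 := d4.congr_of_eventuallyEq hreal
    rw [d1.comp_ofReal.unique d5, map_smul, radialDeriv, map_smul]
    simp only [smul_eq_mul]
    congr 1
    field_simp
  have hz : Complex.I * β ∈ Metric.ball (0 : ℂ) ρ := by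
    simpa [abs_of_pos hβ.1] using hβ.2
  have := taylor_bound hρ hdiff (M := max M 1) (fun z hz =>
    (hM z (Metric.ball_subset_closedBall hz) x).trans (le_max_left _ _)) hz
  rw [Complex.ofReal_zero] at h0
  rw [hder] at this
  simp only [h0, sub_zero, norm_mul, Complex.norm_I, one_mul, Complex.norm_real,
    Real.norm_eq_abs, sq_abs] at this
  refine le_trans (le_of_eq ?_) this
  push_cast
  ring_nf

variable {q : Space d → ℝ} {E μ α γ : ℝ} {χ χt : ℝ → ℝ}

theorem exists_norm_eq' (hd : 1 ≤ d) {r : ℝ} (hr : 0 ≤ r) : ∃ x : Space d, ‖x‖ = r :=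
  ⟨EuclideanSpace.single ⟨0, hd⟩ r, by simp [abs_of_nonneg hr]⟩

theorem VirialData.forbidden_of_ne (hχ : VirialData s q E μ α γ χ χt) {x : Space d}
    (hx : χ ‖x‖ ≠ 0) : α ≤ -(1 / 2) * ‖x‖ ^ (2 * s) + q x - E :=
  hχ.forbidden x (subset_tsupport _ hx)

/-- Since |q| ≤ r^{2s}/4 + C, the potential is at most −r^{2s}/4 + C, so the forbidden region is
bounded. -/
theorem VirialData.eventually_zero (hχ : VirialData s q E μ α γ χ χt) (hd : 1 ≤ d)
    (hs0 : 0 < s) (hs1 : s ≤ 1) (hq : LongRange s q) : ∃ T > 0, ∀ r ≥ T, χ r = 0 := by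
  obtain ⟨Cq, hCq, hgr⟩ := hq.growth hs0 hs1
  have ht : Tendsto (fun r : ℝ => r ^ (2 * s)) atTop atTop := tendsto_rpow_atTop (by positivity)
  obtain ⟨T, hT⟩ := eventually_atTop.1 (ht.eventually_gt_atTop (4 * (Cq - E - α)))
  refine ⟨max T 1, by positivity, fun r hr => ?_⟩
  by_contra h0
  have hr0 : 0 ≤ r := by linarith [le_max_right T 1]
  obtain ⟨x, rfl⟩ := exists_norm_eq' hd hr0
  have h1 := hχ.forbidden_of_ne h0
  have h2 := hT _ ((le_max_left _ _).trans hr)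
  have h3 := (abs_le.1 (hgr x)).2
  linarith

theorem VirialData.contDiffAt (hχ : VirialData s q E μ α γ χ χt) {r : ℝ} (hr : 0 < r) :
    ContDiffAt ℝ 1 χ r :=
  hχ.contDiff.contDiffAt (Ici_mem_nhds hr)

/-- Provides a bounded cut-off derivative, by compactness, and a ball on which the multiplier equals
1. The one-sided derivative handles the endpoint 0. -/
theorem VirialData.profile (hχ : VirialData s q E μ α γ χ χt) (hd : 1 ≤ d)
    (hs0 : 0 < s) (hs1 : s ≤ 1) (hq : LongRange s q) :
    ∃ r₀ > 0, ∃ C > 0, (∀ r ∈ Ico 0 r₀, χ r = 1) ∧ ∀ r > 0,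
      |deriv χ r| ≤ C ∧ (r < r₀ → deriv χ r = 0) := by
  obtain ⟨T, hT0, hT⟩ := hχ.eventually_zero hd hs0 hs1 hq
  obtain ⟨r₀, hr₀, h1⟩ := (mem_nhdsGE_iff_exists_Ico_subset).1 hχ.near_zero
  have hz : ∀ r, 0 < r → r < r₀ → deriv χ r = 0 := fun r hr hr' => by
    have : χ =ᶠ[𝓝 r] fun _ => 1 := by
      filter_upwards [Ioo_mem_nhds hr hr'] with t ht
      exact h1 ⟨ht.1.le, ht.2⟩
    rw [this.deriv_eq]; simp
  have hc : ContinuousOn (derivWithin χ (Ici 0)) (Ici 0) :=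
    hχ.contDiff.continuousOn_derivWithin (uniqueDiffOn_Ici 0) (by simp)
  obtain ⟨M, hM⟩ := (isCompact_Icc (a := 0) (b := T)).exists_bound_of_continuousOn
    (hc.mono Icc_subset_Ici_self)
  refine ⟨r₀, hr₀, max M 1, by positivity, fun r hr => h1 hr, fun r hr => ⟨?_, hz r hr⟩⟩
  rcases le_or_gt r T with h | h
  · have := hM r ⟨hr.le, h⟩
    rw [derivWithin_of_mem_nhds (Ici_mem_nhds hr), Real.norm_eq_abs] at this
    exact this.trans (le_max_left _ _)
  · have : χ =ᶠ[𝓝 r] fun _ => 0 := by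
      filter_upwards [Ioi_mem_nhds h] with t ht
      exact hT t (le_of_lt ht)
    rw [this.deriv_eq]; simp

/-- The virial hypothesis in terms of the amplitude of the distortion. -/
theorem VirialData.virial (hχ : VirialData s q E μ α γ χ χt) (hs0 : 0 < s) (hs1 : s ≤ 1)
    (hR : ∀ x ∈ radialSupport d χt, stepAt χ₁ s R (‖x‖ ^ (2 * s)) = 1) {x : Space d}
    (hx : x ≠ 0) (hχx : χ ‖x‖ ^ 2 ≠ 1) :
    ‖x‖ * deriv (amp χ₁ s R) ‖x‖ ≤ 0 ∧
    γ ≤ s * (‖x‖ ^ (2 * s) * amp χ₁ s R ‖x‖)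
      + (amp χ₁ s R ‖x‖ + ‖x‖ * deriv (amp χ₁ s R) ‖x‖) * ‖x‖ ^ (2 * s)
      - amp χ₁ s R ‖x‖ * ‖x‖ * radialDeriv q x
      - 2 * (amp χ₁ s R ‖x‖ + ‖x‖ * deriv (amp χ₁ s R) ‖x‖) * (q x - E) - μ := by
  have hr : 0 < ‖x‖ := norm_pos_iff.2 hx
  have hne : χt ‖x‖ ≠ 0 := by
    intro h
    have := hχ.sq_add_sq ‖x‖ hr.le
    rw [h] at this
    exact hχx (by linarith)
  have hmem : x ∈ radialSupport d χt := subset_tsupport _ hne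
  -- Nonvanishing of `χt` is an open condition, so the cut-off of the distortion equals 1 on a whole
  -- neighbourhood and derivatives may be compared too.
  have hev : amp χ₁ s R =ᶠ[𝓝 ‖x‖] ampTail s := by
    have hc : ContinuousAt χt ‖x‖ :=
      hχ.contDiff_t.continuousOn.continuousAt (Ici_mem_nhds hr)
    filter_upwards [Ioi_mem_nhds hr, hc.eventually_ne hne] with t ht ht'
    have hnorm : ‖(t / ‖x‖) • x‖ = t := by
      rw [norm_smul, Real.norm_eq_abs, abs_of_pos (div_pos ht hr)]; field_simp
    have := hR ((t / ‖x‖) • x) (subset_tsupport _ (by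
      rw [Function.mem_support, hnorm]; exact ht'))
    rw [hnorm] at this
    rw [amp, this, one_mul, ampTail]
  rw [hev.deriv_eq, hev.eq_of_nhds, (hasDerivAt_ampTail hs1 hr).deriv, ampTail]
  have hp : 0 < ‖x‖ ^ (-(2 * s)) := Real.rpow_pos_of_pos hr _
  have e1 : ‖x‖ ^ (2 * s) * ‖x‖ ^ (-(2 * s)) = 1 := by rw [← Real.rpow_add hr]; simp
  have e2 : ‖x‖ * ‖x‖ ^ (-(2 * s) - 1) = ‖x‖ ^ (-(2 * s)) := by
    rw [mul_comm, ← Real.rpow_add_one hr.ne']; ring_nf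
  rcases hs1.lt_or_eq with h | rfl
  · simp only [if_pos h]
    have hv := hχ.virial_lt h x hmem
    have e3 : ‖x‖ ^ (1 - 2 * s) = ‖x‖ ^ (-(2 * s)) * ‖x‖ := by
      rw [← Real.rpow_add_one hr.ne']; ring_nf
    constructor
    · have : ‖x‖ * (-(2 * s) * ‖x‖ ^ (-(2 * s) - 1)) = -(2 * s) * ‖x‖ ^ (-(2 * s)) := by
        linear_combination -(2 * s) * e2
      rw [this]
      nlinarith
    · refine hv.trans (le_of_eq ?_)
      rw [e3]
      linear_combination (-s - (1 - 2 * s)) * e1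
        + (2 * s * ‖x‖ ^ (2 * s) - 4 * s * (q x - E)) * e2
  · simp only [lt_irrefl, if_false]
    have hv := hχ.virial_one rfl x hmem
    -- This is where r ≥ √e enters: (1 − 2 log r) r^{-2} ≤ 0 is the required sign of r times the
    -- derivative of the amplitude.
    have hlog : 1 / 2 ≤ Real.log ‖x‖ := by
      have := Real.log_le_log (by positivity) (hχ.support_t rfl x hmem)
      rwa [Real.log_sqrt (by positivity), Real.log_exp] at this
    have e4 : ‖x‖ ^ (-(2 * 1) : ℝ) = ‖x‖⁻¹ ^ 2 := by
      rw [Real.rpow_neg hr.le, inv_pow, ← Real.rpow_natCast]; norm_num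
    have e5 : ‖x‖⁻¹ ^ 2 * ‖x‖ = ‖x‖⁻¹ := by field_simp
    rw [e4] at e1 e2 hp ⊢
    constructor
    · have : ‖x‖ * ((1 - 2 * Real.log ‖x‖) * ‖x‖ ^ (-(2 * 1) - 1 : ℝ)) =
        (1 - 2 * Real.log ‖x‖) * ‖x‖⁻¹ ^ 2 := by
        linear_combination (1 - 2 * Real.log ‖x‖) * e2
      rw [this]
      nlinarith
    · refine hv.trans (le_of_eq ?_)
      linear_combination (-Real.log ‖x‖ - (1 - Real.log ‖x‖)) * e1
        + (-(1 - 2 * Real.log ‖x‖) * ‖x‖ ^ (2 * 1 : ℝ)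
          + 2 * (1 - 2 * Real.log ‖x‖) * (q x - E)) * e2
        + (Real.log ‖x‖ * radialDeriv q x) * e5

end

/-! ### Pointwise positivity of the kinetic and potential parts. -/

section

variable {d : ℕ} {χ₁ : ℝ → ℝ} {s R : ℝ}

/-- Lower bound for the form density when the weighted kinetic coefficients are positive enough
to absorb the commutator terms. -/
theorem formDensity_lower {A B b a a' g k : ℂ} {G2 p y C : ℝ} (hp0 : 0 ≤ p) (hp1 : p ≤ 1)
    (hA : ‖A‖ ≤ 2) (hG : ‖k‖ ^ 2 ≤ G2)
    (haA : p ^ 2 / 2 + (1 - p ^ 2) * y ^ 2 ≤ (a * A).re) (haB : 0 ≤ (a * B).re)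
    (ha'y : ‖a'‖ ≤ C * (p + (1 - p ^ 2) * y)) (hab : ‖a‖ * ‖b‖ ≤ C * (p + (1 - p ^ 2) * y))
    (hb : ‖b‖ ≤ C) (ha' : ‖a'‖ ≤ C) (ha : ‖a‖ ≤ C) :
    -(29 * C ^ 2 + 2 * C ^ 3) * ‖g‖ ^ 2 ≤ (formDensity A B b a a' g k G2).re := by
  have hC : 0 ≤ C := (norm_nonneg _).trans hb
  have hu : 0 ≤ 1 - p ^ 2 := by nlinarith
  have h1 := formDensity_re_ge A B b a a' g k G2
  have h2 : 0 ≤ (a * B).re * (G2 - ‖k‖ ^ 2) := mul_nonneg haB (by linarith)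
  have h3 : (p ^ 2 / 2 + (1 - p ^ 2) * y ^ 2) * ‖k‖ ^ 2 ≤ (a * A).re * ‖k‖ ^ 2 := by gcongr
  have h4 : ‖A‖ * (‖a'‖ + 2 * ‖a‖ * ‖b‖) * (‖g‖ * ‖k‖) ≤
      6 * C * (p + (1 - p ^ 2) * y) * (‖g‖ * ‖k‖) := by
    have : ‖a'‖ + 2 * ‖a‖ * ‖b‖ ≤ 3 * (C * (p + (1 - p ^ 2) * y)) := by linarith
    calc ‖A‖ * (‖a'‖ + 2 * ‖a‖ * ‖b‖) * (‖g‖ * ‖k‖)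
        ≤ 2 * (3 * (C * (p + (1 - p ^ 2) * y))) * (‖g‖ * ‖k‖) := by gcongr
      _ = _ := by ring
  have h5 : ‖A‖ * (‖a'‖ * ‖b‖ + ‖a‖ * ‖b‖ ^ 2) * ‖g‖ ^ 2 ≤
      2 * (C * C + C * C ^ 2) * ‖g‖ ^ 2 := by gcongr
  -- Completing squares separately in the two regions costs 18C² and 9C²; with 2C² + 2C³ from the
  -- zeroth-order terms this gives the stated constant.
  have h6 : 6 * C * p * (‖g‖ * ‖k‖) ≤ p ^ 2 / 2 * ‖k‖ ^ 2 + 18 * C ^ 2 * ‖g‖ ^ 2 := by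
    nlinarith [sq_nonneg (p * ‖k‖ - 6 * C * ‖g‖)]
  have h7 : 6 * C * ((1 - p ^ 2) * y) * (‖g‖ * ‖k‖) ≤
      (1 - p ^ 2) * y ^ 2 * ‖k‖ ^ 2 + 9 * C ^ 2 * ‖g‖ ^ 2 := by
    have e1 : (1 - p ^ 2) * (6 * C * ‖g‖ * (y * ‖k‖)) ≤
        (1 - p ^ 2) * (y ^ 2 * ‖k‖ ^ 2 + 9 * C ^ 2 * ‖g‖ ^ 2) := by
      gcongr
      nlinarith [sq_nonneg (y * ‖k‖ - 3 * C * ‖g‖)]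
    have e2 : (1 - p ^ 2) * (9 * C ^ 2 * ‖g‖ ^ 2) ≤ 1 * (9 * C ^ 2 * ‖g‖ ^ 2) := by
      gcongr
      nlinarith
    linarith
  linarith

/-- The factor by which the Hamiltonian is multiplied in the non-forbidden region makes the
real part of the kinetic coefficient positive. -/
theorem tail_kinetic_lower {A : ℂ} {β h η ν M C W : ℝ} (hβ : 0 < β) (hη : h ≤ η)
    (hν : ν = -2 * β * h + M * β ^ 2 * W) (hW : 0 ≤ W) (hh : |2 * β * h| ≤ 1)
    (hC : C * β ^ 2 ≤ 1 / 2) (hM : 4 * C + 2 ≤ M) (hM0 : 0 ≤ M)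
    (h1 : ‖A - 1 + 2 * Complex.I * (β * η : ℝ)‖ ≤ C * β ^ 2)
    (h2 : ‖A - 1 + 2 * Complex.I * (β * η : ℝ)‖ ≤ C * β ^ 2 * W) :
    1 / 2 ≤ A.re ∧ β ^ 2 * W ≤ ((Complex.I + (ν : ℂ)) * A).re := by
  set e := A - 1 + 2 * Complex.I * (β * η : ℝ) with he
  have hre : A.re = 1 + e.re := by simp [he]
  have him : A.im = -2 * (β * η) + e.im := by simp [he]
  have r1 := abs_le.1 ((Complex.abs_re_le_norm e).trans h1)
  have r2 := abs_le.1 ((Complex.abs_re_le_norm e).trans h2)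
  have i2 := abs_le.1 ((Complex.abs_im_le_norm e).trans h2)
  have hA : 1 / 2 ≤ A.re := by rw [hre]; linarith
  refine ⟨hA, ?_⟩
  have e1 : ((Complex.I + (ν : ℂ)) * A).re = ν * A.re - A.im := by
    simp [Complex.add_re, Complex.mul_re]
  have e2 : |2 * β * h * e.re| ≤ C * β ^ 2 * W := by
    rw [abs_mul]
    calc |2 * β * h| * |e.re| ≤ 1 * (C * β ^ 2 * W) := by
          gcongr
          exact abs_le.2 r2
      _ = _ := one_mul _
  have e3 := abs_le.1 e2
  -- With Re A ≥ 1/2 half of the M-term survives. As M/2 ≥ 2C + 1, it covers the two errors of size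
  -- Cβ²W and leaves β²W.
  have e4 : M * β ^ 2 * W * (1 / 2) ≤ M * β ^ 2 * W * A.re := by gcongr
  have e5 : β * h ≤ β * η := by gcongr
  have e6 : (4 * C + 2) * (β ^ 2 * W) ≤ M * (β ^ 2 * W) := by gcongr
  rw [e1, hν, him]
  rw [hre] at e4 ⊢
  linarith

/-- Lower bound for the weighted potential. -/
theorem weighted_potential_lower {a V Qx : ℂ} {t β h v ν M W rs q E κ τ α γ μ H CQ Cq W₀ : ℝ}
    (hβ : 0 < β) (hβ1 : β ≤ 1) (ht0 : 0 ≤ t) (ht1 : t ≤ 1) (hM : 0 ≤ M) (hW : 0 ≤ W)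
    (hCq : 0 ≤ Cq) (hCQ : 0 ≤ CQ) (hH : 0 ≤ H) (hW₀ : 0 ≤ W₀)
    (hν : ν = -2 * β * h + M * β ^ 2 * W) (ha : a = t + (1 - t) * (Complex.I + (ν : ℂ)))
    (hV : V = -(1 / 2) * (rs * (1 + 2 * s * (Complex.I * β * v))) + Qx - E + Complex.I * τ)
    (hQ : ‖Qx - q - Complex.I * (β * κ : ℝ)‖ ≤ CQ * β ^ 2)
    (hα : t ≠ 0 → α ≤ -(1 / 2) * rs + q - E) (hαγ : β * γ ≤ α)
    (hvir : t ≠ 1 → W ≤ W₀ ∧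
      γ ≤ s * (rs * v) + h * rs - κ - 2 * h * (q - E) - μ)
    (hh : |h| ≤ H) (hWrs : W * rs = 1) (hq : |q| ≤ 1 / 4 * rs + Cq) (hτ : τ ≤ β * μ) :
    β * γ - (CQ * (2 * H + 1) + M * (1 + W₀ * (Cq + CQ + |E|))) * β ^ 2 ≤ (a * V).re := by
  set e := Qx - q - Complex.I * (β * κ : ℝ) with he
  have hQre : Qx.re = q + e.re := by simp [he]
  have hQim : Qx.im = β * κ + e.im := by simp [he]
  have hVre : V.re = -(1 / 2) * rs + q + e.re - E := by
    rw [hV]; simp [hQre]; ring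
  have hVim : V.im = -(s * β * (rs * v)) + β * κ + e.im + τ := by
    rw [hV]; simp [hQim]; ring
  have r1 := abs_le.1 ((Complex.abs_re_le_norm e).trans hQ)
  have i1 := abs_le.1 ((Complex.abs_im_le_norm e).trans hQ)
  have ha' : (a * V).re = t * V.re + (1 - t) * (ν * V.re - V.im) := by
    rw [ha]
    simp [Complex.add_re, Complex.mul_re, Complex.add_im, Complex.mul_im]
    ring
  have hb2 : 0 ≤ β ^ 2 := by positivity
  have hb21 : β ^ 2 ≤ 1 := by nlinarith
  set K := CQ * (2 * H + 1) + M * (1 + W₀ * (Cq + CQ + |E|)) with hK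
  have hKC : CQ ≤ K := by
    have h' : 0 ≤ M * (1 + W₀ * (Cq + CQ + |E|)) := by positivity
    rw [hK]
    nlinarith
  have w2 : t ≠ 1 → β * γ - K * β ^ 2 ≤ ν * V.re - V.im := by
    intro h1
    obtain ⟨hW0, hv⟩ := hvir h1
    have p1 : |2 * β * h * e.re| ≤ 2 * H * (CQ * β ^ 2) := by
      rw [abs_mul, abs_mul, abs_mul, abs_of_pos hβ, abs_of_pos (two_pos : (0 : ℝ) < 2)]
      calc 2 * β * |h| * |e.re| ≤ 2 * 1 * H * (CQ * β ^ 2) := by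
            gcongr
            exact abs_le.2 r1
        _ = _ := by ring
    -- Because W·rs = 1 and |q| is at most rs/4 plus a constant, the growing part contributes only
    -- −3/4.
    have p2 : W * (-(1 / 2) * rs + q + e.re - E) ≥ -(1 + W₀ * (Cq + CQ + |E|)) := by
      have q1 : -(1 / 4 * rs + Cq) ≤ q := (abs_le.1 hq).1
      have q2 : -CQ ≤ e.re := by
        have : CQ * β ^ 2 ≤ CQ * 1 := by gcongr
        linarith
      have q3 : E ≤ |E| := le_abs_self E
      have q4 : -(3 / 4 * rs) - (Cq + CQ + |E|) ≤ -(1 / 2) * rs + q + e.re - E := by linarith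
      have q5 : W * (-(3 / 4 * rs) - (Cq + CQ + |E|)) ≤
          W * (-(1 / 2) * rs + q + e.re - E) := by gcongr
      have q6 : W * (Cq + CQ + |E|) ≤ W₀ * (Cq + CQ + |E|) := by gcongr
      have q7 : W * (-(3 / 4 * rs) - (Cq + CQ + |E|)) =
          -(3 / 4) * (W * rs) - W * (Cq + CQ + |E|) := by ring
      rw [hWrs] at q7
      linarith
    have p3 : M * β ^ 2 * (-(1 + W₀ * (Cq + CQ + |E|))) ≤
        M * β ^ 2 * (W * (-(1 / 2) * rs + q + e.re - E)) := by gcongr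
    have p4 : β * γ ≤ β * (s * (rs * v) + h * rs - κ - 2 * h * (q - E) - μ) := by gcongr
    have p5 := (abs_le.1 p1).2
    -- The first-order terms assemble into β times the virial expression; the rest is of order β² or
    -- has a favourable sign since τ ≤ βμ.
    have p6 : ν * V.re - V.im = β * (s * (rs * v) + h * rs - κ - 2 * h * (q - E) - μ)
        + M * β ^ 2 * (W * (-(1 / 2) * rs + q + e.re - E)) - 2 * β * h * e.re - e.im
        + (β * μ - τ) := by
      rw [hν, hVre, hVim]; ring
    have p7 : K * β ^ 2 = 2 * H * (CQ * β ^ 2) + CQ * β ^ 2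
        - M * β ^ 2 * (-(1 + W₀ * (Cq + CQ + |E|))) := by
      rw [hK]; ring
    linarith
  have w1 : t ≠ 0 → β * γ - CQ * β ^ 2 ≤ V.re := by
    intro h0
    have := hα h0
    rw [hVre]
    linarith
  rw [ha']
  -- The quantity is a convex combination with weights t and 1 − t; each of the two bounds is
  -- available exactly where its weight is nonzero.
  rcases eq_or_ne t 1 with rfl | h1
  · have h1 := w1 one_ne_zero
    have h2 : CQ * β ^ 2 ≤ K * β ^ 2 := by gcongr
    linarith
  · have h2 := w2 h1
    have h3 : (1 - t) * (β * γ - K * β ^ 2) ≤ (1 - t) * (ν * V.re - V.im) := by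
      have : 0 ≤ 1 - t := by linarith
      gcongr
    have h4 : t * (β * γ - K * β ^ 2) ≤ t * V.re := by
      rcases eq_or_ne t 0 with rfl | h0
      · simp
      · have h5 := w1 h0
        have h6 : CQ * β ^ 2 ≤ K * β ^ 2 := by gcongr
        gcongr
        linarith
    linarith

end

/-! ### The radial multiplier and its bounds. -/

section

variable {d : ℕ} {χ₁ : ℝ → ℝ} {s R : ℝ}

/-- First-order coefficient of `∂ r_θ / ∂ r` in `θ`. -/
def stretchAmp (χ₁ : ℝ → ℝ) (s R r : ℝ) : ℝ := amp χ₁ s R r + r * deriv (amp χ₁ s R) r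

/-- Real part of the multiplier in the non-forbidden region. -/
def tailShift (χ₁ : ℝ → ℝ) (s R M β r : ℝ) : ℝ :=
  -2 * β * stretchAmp χ₁ s R r + M * β ^ 2 * r ^ (-(2 * s))

/-- Derivative of `tailShift`. -/
def tailShift' (χ₁ : ℝ → ℝ) (s R M β r : ℝ) : ℝ :=
  -2 * β * (2 * deriv (amp χ₁ s R) r + r * deriv (deriv (amp χ₁ s R)) r)
    + M * β ^ 2 * (-(2 * s) * r ^ (-(2 * s) - 1))

/-- The radial multiplier: `1` in the forbidden region, close to `i` elsewhere. -/
def weight (χ₁ χ : ℝ → ℝ) (s R M β r : ℝ) : ℂ :=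
  ((χ r ^ 2 : ℝ) : ℂ) + (1 - ((χ r ^ 2 : ℝ) : ℂ)) * (Complex.I + (tailShift χ₁ s R M β r : ℂ))

/-- Derivative of `weight`. -/
def weight' (χ₁ χ : ℝ → ℝ) (s R M β r : ℝ) : ℂ :=
  ((2 * χ r * deriv χ r : ℝ) : ℂ) * (1 - (Complex.I + (tailShift χ₁ s R M β r : ℂ)))
    + (1 - ((χ r ^ 2 : ℝ) : ℂ)) * (tailShift' χ₁ s R M β r : ℂ)

variable {q : Space d → ℝ} {E μ α γ : ℝ} {χ χt : ℝ → ℝ} {M β : ℝ}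

theorem contDiffAt_tailShift (hχ₁ : IsStep χ₁) {r : ℝ} (hr : 0 < r) :
    ContDiffAt ℝ ∞ (tailShift χ₁ s R M β) r :=
  (contDiffAt_const.mul ((contDiffAt_amp hχ₁ hr).add
    (contDiffAt_id.mul (contDiffAt_deriv_amp hχ₁ hr)))).add
    (contDiffAt_const.mul (Real.contDiffAt_rpow_const_of_ne hr.ne'))

theorem hasDerivAt_tailShift (hχ₁ : IsStep χ₁) {r : ℝ} (hr : 0 < r) :
    HasDerivAt (tailShift χ₁ s R M β) (tailShift' χ₁ s R M β r) r := by
  have h1 := ((contDiffAt_amp hχ₁ hr (s := s) (R := R)).differentiableAt (by simp)).hasDerivAt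
  have h2 := ((contDiffAt_deriv_amp hχ₁ hr (s := s) (R := R)).differentiableAt
    (by simp)).hasDerivAt
  have h3 := ((h1.add ((hasDerivAt_id r).mul h2)).const_mul (-2 * β)).add
    ((Real.hasDerivAt_rpow_const (p := -(2 * s)) (Or.inl hr.ne')).const_mul (M * β ^ 2))
  refine h3.congr_deriv ?_
  rw [tailShift']
  simp only [id, one_mul]
  ring

theorem VirialData.hasDerivAt_weight (hχ : VirialData s q E μ α γ χ χt) (hχ₁ : IsStep χ₁)
    {r : ℝ} (hr : 0 < r) :
    HasDerivAt (weight χ₁ χ s R M β) (weight' χ₁ χ s R M β r) r := by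
  have h1 := (((hχ.contDiffAt hr).differentiableAt (by simp)).hasDerivAt.pow 2).ofReal_comp
  have h2 := (hasDerivAt_tailShift (s := s) (R := R) (M := M) (β := β) hχ₁ hr).ofReal_comp
  refine (h1.add ((h1.const_sub 1).mul (h2.const_add Complex.I))).congr_deriv ?_
  rw [weight']
  simp only [Pi.pow_apply]
  push_cast
  ring

/-- `tailShift` contains r^{-2s}, singular at the origin, but its factor 1 − χ² vanishes near 0. -/
theorem VirialData.contDiff_weight (hχ : VirialData s q E μ α γ χ χt) (hχ₁ : IsStep χ₁)
    {r₀ : ℝ} (hr₀ : 0 < r₀) (h1 : ∀ r ∈ Ico 0 r₀, χ r = 1) :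
    ContDiff ℝ 1 fun x : Space d => weight χ₁ χ s R M β ‖x‖ := by
  refine contDiff_of_near_zero (G := fun _ => 1) hr₀ contDiff_const (fun x hx => ?_)
    fun x hx => ?_
  · simp [weight, h1 ‖x‖ ⟨norm_nonneg _, hx⟩]
  · have hr : 0 < ‖x‖ := norm_pos_iff.2 hx
    have c1 : ContDiffAt ℝ 1 (fun r => ((χ r ^ 2 : ℝ) : ℂ)) ‖x‖ :=
      Complex.ofRealCLM.contDiff.contDiffAt.comp _ ((hχ.contDiffAt hr).pow 2)
    have c2 : ContDiffAt ℝ 1 (fun r => (tailShift χ₁ s R M β r : ℂ)) ‖x‖ :=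
      Complex.ofRealCLM.contDiff.contDiffAt.comp _
        ((contDiffAt_tailShift hχ₁ hr).of_le (by simp))
    exact (c1.add ((contDiffAt_const.sub c1).mul (contDiffAt_const.add c2))).comp x
      (contDiffAt_norm ℝ hx)

/-- All bounds on the multiplier and on the coefficients used in the positivity argument. -/
theorem VirialData.weight_bounds (hχ : VirialData s q E μ α γ χ χt) (hχ₁ : IsStep χ₁)
    (hd : 1 ≤ d) (hs0 : 0 < s) (hs1 : s ≤ 1) (hR : 0 < R) (hq : LongRange s q) :
    ∃ M > (0 : ℝ), ∃ β₁ > (0 : ℝ), ∃ C > (0 : ℝ), ∃ r₀ > (0 : ℝ), (∀ r ∈ Ico 0 r₀, χ r = 1) ∧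
      ∀ β ∈ Ioo (0 : ℝ) β₁, Regular d χ₁ s R (Complex.I * β) ∧
      ∀ r > (0 : ℝ), (χ r ^ 2 ≠ 1 → r * deriv (amp χ₁ s R) r ≤ 0) →
      |stretchAmp χ₁ s R r| ≤ C ∧
      ‖weight χ₁ χ s R M β r‖ ≤ 1 + C * β ∧ ‖weight χ₁ χ s R M β r‖ ≤ C ∧
      ‖weight' χ₁ χ s R M β r‖ ≤ C ∧
      ‖weight' χ₁ χ s R M β r‖ ≤ C * (χ r + (1 - χ r ^ 2) * (β * r ^ (-s))) ∧
      ‖drift d χ₁ s R (Complex.I * β) r‖ ≤ C ∧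
      ‖weight χ₁ χ s R M β r‖ * ‖drift d χ₁ s R (Complex.I * β) r‖ ≤
        C * (χ r + (1 - χ r ^ 2) * (β * r ^ (-s))) ∧
      ‖radCoeff χ₁ s R (Complex.I * β) r‖ ≤ 2 ∧
      χ r ^ 2 / 2 + (1 - χ r ^ 2) * (β * r ^ (-s)) ^ 2 ≤
        (weight χ₁ χ s R M β r * radCoeff χ₁ s R (Complex.I * β) r).re ∧
      0 ≤ (weight χ₁ χ s R M β r * angCoeff χ₁ s R (Complex.I * β) r).re := by
  obtain ⟨D, hD, hb⟩ := amp_bounds hχ₁ hs0 hs1 hR (χ₁ := χ₁) (s := s) (R := R)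
  obtain ⟨β₁, hβ₁, C, hC, hcoef⟩ := coefficient_bounds d hχ₁ hs0 hs1 hR (χ₁ := χ₁) (R := R)
  obtain ⟨r₀, hr₀, Cχ, hCχ, hone, hprof⟩ := hχ.profile hd hs0 hs1 hq
  set M := 4 * C + 2 with hM
  have hM0 : 0 < M := by positivity
  set w₀ := r₀ ^ (-s) with hw₀
  have hw₀0 : 0 < w₀ := Real.rpow_pos_of_pos hr₀ _
  set C₁ := 8 * Cχ + (6 * D + 2 * s * M * w₀ / r₀) + 3 * C with hC₁
  have hC₁0 : 0 < C₁ := by positivity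
  -- The thresholds give in turn |2βh| ≤ 1/2, Mβ²r^{-2s} ≤ β for r ≥ r₀, and Cβ² ≤ 1/2.
  refine ⟨M, hM0, min β₁ (min 1 (min (1 / (8 * D)) (min (1 / (M * w₀ ^ 2)) (1 / (2 * C))))),
    by positivity, C₁ * (1 + w₀) + 3 + (4 * D + 1), by positivity, r₀, hr₀, hone, ?_⟩
  rintro β ⟨hβ0, hβ⟩
  simp only [lt_min_iff] at hβ
  obtain ⟨b1, b2, b3, b4, b5⟩ := hβ
  rw [lt_div_iff₀ (by positivity)] at b3 b4 b5
  obtain ⟨hreg, hco⟩ := hcoef β ⟨hβ0, b1⟩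
  refine ⟨hreg, fun r hr hneg => ?_⟩
  set w := r ^ (-s) with hw
  have hw0 : 0 < w := Real.rpow_pos_of_pos hr _
  have hWw : r ^ (-(2 * s)) = w ^ 2 := by
    rw [hw, ← Real.rpow_natCast, ← Real.rpow_mul hr.le]; congr 1; push_cast; ring
  set h := stretchAmp χ₁ s R r with hh
  set ν := tailShift χ₁ s R M β r with hν
  have hbω := hb r hr (amp χ₁ s R r) (by simp)
  have hbω1 := hb r hr (deriv (amp χ₁ s R) r) (by simp)
  have hbrω := hb r hr (r * deriv (amp χ₁ s R) r) (by simp)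
  have hbrω2 := hb r hr (r * deriv (deriv (amp χ₁ s R)) r) (by simp)
  have hh1 : |h| ≤ 2 * D := (abs_add_le _ _).trans (by linarith [hbω.1, hbrω.1])
  have h2βh : |2 * β * h| ≤ 4 * D * β := by
    rw [abs_mul, abs_of_pos (by positivity : 0 < 2 * β)]
    calc 2 * β * |h| ≤ 2 * β * (2 * D) := by gcongr
      _ = _ := by ring
  have hCβ : C * β ^ 2 ≤ 1 / 2 := by
    calc C * β ^ 2 = C * β * β := by ring
      _ ≤ C * β * 1 := by gcongr
      _ ≤ 1 / 2 := by linarith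
  obtain ⟨cB1, cA1, cb1⟩ := hco r hr 1 (Or.inl rfl)
  obtain ⟨cB2, cA2, cb2⟩ := hco r hr w (Or.inr rfl)
  rw [mul_one] at cB1 cA1 cb1
  have hsq : C * (β * w) ^ 2 = C * β ^ 2 * r ^ (-(2 * s)) := by rw [hWw]; ring
  rw [hsq] at cB2 cA2
  have hν' : ν = -2 * β * h + M * β ^ 2 * r ^ (-(2 * s)) := rfl
  have kA := tail_kinetic_lower hβ0 (le_refl h) hν' (by positivity) (by linarith) hCβ hM.ge
    hM0.le cA1 cA2
  -- For the angular coefficient the same shift suffices: `amp` dominates `stretchAmp` where r times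
  -- the derivative of `amp` is nonpositive.
  have kB : χ r ^ 2 ≠ 1 → _ := fun hne =>
    tail_kinetic_lower (η := amp χ₁ s R r) hβ0 (by
      have := hneg hne
      rw [hh, stretchAmp]; linarith) hν' (by positivity) (by linarith) hCβ hM.ge
      hM0.le cB1 cB2
  have hBre : 1 / 2 ≤ (angCoeff χ₁ s R (Complex.I * β) r).re := by
    have := (abs_le.1 ((Complex.abs_re_le_norm _).trans cB1)).1
    simp at this
    linarith
  have hχI := hχ.mem_Icc r hr.le
  have hp0 : 0 ≤ χ r := hχI.1
  have hp1 : χ r ≤ 1 := hχI.2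
  have ht1 : χ r ^ 2 ≤ χ r := pow_le_of_le_one hp0 hp1 two_ne_zero
  have hu0 : 0 ≤ 1 - χ r ^ 2 := by linarith
  have hu1 : 1 - χ r ^ 2 ≤ 1 := sub_le_self _ (sq_nonneg _)
  have hy0 : 0 < β * w := by positivity
  have hexp : ∀ Z : ℂ, (weight χ₁ χ s R M β r * Z).re =
      χ r ^ 2 * Z.re + (1 - χ r ^ 2) * ((Complex.I + (ν : ℂ)) * Z).re := by
    intro Z
    have : weight χ₁ χ s R M β r * Z = ((χ r ^ 2 : ℝ) : ℂ) * Z +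
        ((1 - χ r ^ 2 : ℝ) : ℂ) * ((Complex.I + (ν : ℂ)) * Z) := by
      rw [weight]; push_cast; ring
    rw [this, Complex.add_re, Complex.re_ofReal_mul, Complex.re_ofReal_mul]
  have haA : χ r ^ 2 / 2 + (1 - χ r ^ 2) * (β * w) ^ 2 ≤
      (weight χ₁ χ s R M β r * radCoeff χ₁ s R (Complex.I * β) r).re := by
    rw [hexp]
    have e : (β * w) ^ 2 = β ^ 2 * r ^ (-(2 * s)) := by rw [hWw]; ring
    rw [e]
    have := mul_le_mul_of_nonneg_left kA.1 (sq_nonneg (χ r))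
    have := mul_le_mul_of_nonneg_left kA.2 hu0
    linarith
  have haB : 0 ≤ (weight χ₁ χ s R M β r * angCoeff χ₁ s R (Complex.I * β) r).re := by
    rw [hexp]
    have h1 : 0 ≤ χ r ^ 2 * (angCoeff χ₁ s R (Complex.I * β) r).re :=
      mul_nonneg (sq_nonneg _) (by linarith)
    have h2 : 0 ≤ (1 - χ r ^ 2) *
        ((Complex.I + (ν : ℂ)) * angCoeff χ₁ s R (Complex.I * β) r).re := by
      by_cases hne : χ r ^ 2 = 1
      · rw [hne]; simp
      · exact mul_nonneg hu0 ((by positivity : 0 ≤ β ^ 2 * r ^ (-(2 * s))).trans (kB hne).2)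
    linarith
  have hA2 : ‖radCoeff χ₁ s R (Complex.I * β) r‖ ≤ 2 := by
    have e : radCoeff χ₁ s R (Complex.I * β) r = (radCoeff χ₁ s R (Complex.I * β) r - 1 +
        2 * Complex.I * (β * (amp χ₁ s R r + r * deriv (amp χ₁ s R) r) : ℝ)) + 1
        - Complex.I * ((2 * β * h : ℝ) : ℂ) := by
      rw [hh, stretchAmp]; push_cast; ring
    rw [e]
    refine (norm_sub_le _ _).trans ?_
    have n1 := norm_add_le (radCoeff χ₁ s R (Complex.I * β) r - 1 +
        2 * Complex.I * (β * (amp χ₁ s R r + r * deriv (amp χ₁ s R) r) : ℝ)) 1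
    have n2 : ‖Complex.I * ((2 * β * h : ℝ) : ℂ)‖ = |2 * β * h| := by
      rw [norm_mul, Complex.norm_I, one_mul, Complex.norm_real, Real.norm_eq_abs]
    rw [norm_one] at n1
    linarith
  have hdr : ‖drift d χ₁ s R (Complex.I * β) r‖ ≤ C :=
    cb1.trans (mul_le_of_le_one_right hC.le b2.le)
  suffices hmain : ‖weight χ₁ χ s R M β r‖ ≤ 1 + (4 * D + 1) * β ∧
      ‖weight χ₁ χ s R M β r‖ ≤ χ r ^ 2 + 3 * (1 - χ r ^ 2) ∧
      ‖weight' χ₁ χ s R M β r‖ ≤ C₁ * (χ r + (1 - χ r ^ 2) * (β * w)) ∧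
      (1 - χ r ^ 2) * (β * w) ≤ w₀ by
    obtain ⟨m1, m2, m3, m4⟩ := hmain
    have hS0 : 0 ≤ χ r + (1 - χ r ^ 2) * (β * w) := by positivity
    have hS1 : χ r + (1 - χ r ^ 2) * (β * w) ≤ 1 + w₀ := by linarith
    have hCC : C₁ ≤ C₁ * (1 + w₀) + 3 + (4 * D + 1) := by
      have : 0 ≤ C₁ * w₀ := by positivity
      linarith
    have hCw : C₁ * (1 + w₀) ≤ C₁ * (1 + w₀) + 3 + (4 * D + 1) := by linarith
    have hC3 : 3 * C ≤ C₁ := by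
      have : 0 ≤ 8 * Cχ + (6 * D + 2 * s * M * w₀ / r₀) := by positivity
      linarith
    have hCb : C ≤ C₁ * (1 + w₀) + 3 + (4 * D + 1) := by linarith
    have hcw : 0 ≤ C₁ * (1 + w₀) := by positivity
    refine ⟨by linarith, m1.trans ?_, by linarith, ?_, ?_, hdr.trans hCb, ?_, hA2, haA, haB⟩
    · exact add_le_add_right (mul_le_mul_of_nonneg_right (by linarith) hβ0.le) _
    · refine m3.trans (le_trans ?_ hCw)
      gcongr
    · exact m3.trans (by gcongr)
    -- The plain bound on `drift` is used against χ², the decaying bound βr^{-s} against 1 − χ².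
    · calc ‖weight χ₁ χ s R M β r‖ * ‖drift d χ₁ s R (Complex.I * β) r‖
          ≤ (χ r ^ 2 + 3 * (1 - χ r ^ 2)) * ‖drift d χ₁ s R (Complex.I * β) r‖ := by gcongr
        _ = χ r ^ 2 * ‖drift d χ₁ s R (Complex.I * β) r‖
            + 3 * (1 - χ r ^ 2) * ‖drift d χ₁ s R (Complex.I * β) r‖ := by ring
        _ ≤ χ r * C + 3 * (1 - χ r ^ 2) * (C * (β * w)) := by gcongr
        _ ≤ 3 * C * (χ r + (1 - χ r ^ 2) * (β * w)) := by linarith [mul_nonneg hp0 hC.le]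
        _ ≤ _ := by
          gcongr
          linarith
  -- Powers r^{-s} are bounded only for r ≥ r₀; inside that radius the multiplier is constantly 1.
  rcases lt_or_ge r r₀ with hrr | hrr
  · have e1 : χ r = 1 := hone r ⟨hr.le, hrr⟩
    have e2 : deriv χ r = 0 := (hprof r hr).2 hrr
    have ea : weight χ₁ χ s R M β r = 1 := by simp [weight, e1]
    have ea' : weight' χ₁ χ s R M β r = 0 := by simp [weight', e1, e2]
    rw [ea, ea', e1]
    refine ⟨?_, ?_, ?_, ?_⟩
    · rw [norm_one]
      have : 0 ≤ (4 * D + 1) * β := by positivity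
      linarith
    · norm_num
    · rw [norm_zero]; norm_num; exact hC₁0.le
    · norm_num; exact hw₀0.le
  · have hww : w ≤ w₀ := Real.rpow_le_rpow_of_nonpos hr₀ hrr (by linarith)
    have hMβ : M * β * w ^ 2 ≤ 1 := by
      calc M * β * w ^ 2 ≤ M * β * w₀ ^ 2 := by gcongr
        _ ≤ 1 := by linarith
    have hνabs : |ν| ≤ (4 * D + 1) * β := by
      rw [hν', hWw]
      refine (abs_add_le _ _).trans ?_
      have : |-2 * β * h| = |2 * β * h| := by rw [neg_mul, neg_mul, abs_neg]
      rw [this, abs_of_nonneg (by positivity : 0 ≤ M * β ^ 2 * w ^ 2)]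
      have : M * β ^ 2 * w ^ 2 = M * β * w ^ 2 * β := by ring
      rw [this]
      have : M * β * w ^ 2 * β ≤ 1 * β := by gcongr
      linarith
    have hν2 : |ν| ≤ 2 := by linarith
    have hc : ‖Complex.I + (ν : ℂ)‖ ≤ 1 + |ν| := by
      refine (norm_add_le _ _).trans ?_
      rw [Complex.norm_I, Complex.norm_real, Real.norm_eq_abs]
    have hunorm : ‖(1 : ℂ) - ((χ r ^ 2 : ℝ) : ℂ)‖ = 1 - χ r ^ 2 := by
      rw [← Complex.ofReal_one, ← Complex.ofReal_sub, Complex.norm_real, Real.norm_eq_abs,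
        abs_of_nonneg hu0]
    have hwt : ‖weight χ₁ χ s R M β r‖ ≤ χ r ^ 2 + (1 - χ r ^ 2) * (1 + |ν|) := by
      rw [weight]
      refine (norm_add_le _ _).trans ?_
      rw [norm_mul, hunorm, Complex.norm_real, Real.norm_eq_abs, abs_of_nonneg (sq_nonneg _)]
      gcongr
    have hu1ν : (1 - χ r ^ 2) * |ν| ≤ 1 * |ν| := by gcongr
    refine ⟨by linarith, hwt.trans ?_, ?_, ?_⟩
    · have : (1 - χ r ^ 2) * (1 + |ν|) ≤ (1 - χ r ^ 2) * 3 := by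
        gcongr
        linarith
      linarith
    · have hts : |tailShift' χ₁ s R M β r| ≤ (6 * D + 2 * s * M * w₀ / r₀) * (β * w) := by
        rw [tailShift']
        refine (abs_add_le _ _).trans ?_
        have p1 : |-2 * β * (2 * deriv (amp χ₁ s R) r + r * deriv (deriv (amp χ₁ s R)) r)| ≤
            2 * β * (3 * D * w) := by
          rw [abs_mul, neg_mul, abs_neg, abs_of_pos (by positivity : 0 < 2 * β)]
          gcongr
          refine (abs_add_le _ _).trans ?_
          rw [abs_mul, abs_of_pos (two_pos : (0 : ℝ) < 2)]
          linarith [hbω1.2, hbrω2.2]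
        have p2 : |M * β ^ 2 * (-(2 * s) * r ^ (-(2 * s) - 1))| ≤
            2 * s * M * w₀ / r₀ * (β * w) := by
          rw [neg_mul, mul_neg, abs_neg, abs_of_pos (by positivity), Real.rpow_sub_one hr.ne', hWw]
          calc M * β ^ 2 * (2 * s * (w ^ 2 / r)) = (M * (β * β) * (2 * s * (w * w / r))) := by ring
            _ ≤ M * (β * 1) * (2 * s * (w₀ * w / r₀)) := by gcongr
            _ = _ := by ring
        linarith
      have hd2 := (hprof r hr).1
      rw [weight']
      refine (norm_add_le _ _).trans ?_
      rw [norm_mul, norm_mul, hunorm, Complex.norm_real, Complex.norm_real, Real.norm_eq_abs,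
        Real.norm_eq_abs]
      have p3 : ‖1 - (Complex.I + (ν : ℂ))‖ ≤ 4 := by
        refine (norm_sub_le _ _).trans ?_
        rw [norm_one]; linarith
      have p4 : |2 * χ r * deriv χ r| ≤ 2 * χ r * Cχ := by
        rw [abs_mul, abs_of_nonneg (by positivity : 0 ≤ 2 * χ r)]
        gcongr
      have p5 : |2 * χ r * deriv χ r| * ‖1 - (Complex.I + (ν : ℂ))‖ ≤ 2 * χ r * Cχ * 4 := by
        gcongr
      have p6 : (1 - χ r ^ 2) * |tailShift' χ₁ s R M β r| ≤
          (1 - χ r ^ 2) * ((6 * D + 2 * s * M * w₀ / r₀) * (β * w)) := by gcongr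
      have p7 : 8 * Cχ * χ r ≤ C₁ * χ r := by
        gcongr
        have : 0 ≤ (6 * D + 2 * s * M * w₀ / r₀) + 3 * C := by positivity
        linarith
      have p8 : (6 * D + 2 * s * M * w₀ / r₀) * ((1 - χ r ^ 2) * (β * w)) ≤
          C₁ * ((1 - χ r ^ 2) * (β * w)) := by
        gcongr
        have : 0 ≤ 8 * Cχ + 3 * C := by positivity
        linarith
      linarith
    · calc (1 - χ r ^ 2) * (β * w) ≤ 1 * (1 * w₀) := by gcongr
        _ = w₀ := by ring

end

/-! ### The lower bound in L². -/

section

variable {d : ℕ} {χ₁ : ℝ → ℝ} {s R : ℝ} {q : Space d → ℝ} {E μ α γ : ℝ} {χ χt : ℝ → ℝ}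

theorem L2_norm_sq_eq (u : L2 d) : ‖u‖ ^ 2 = ∫ x, ‖u x‖ ^ 2 := by
  have h : (inner ℂ u u : ℂ) = ((‖u‖ ^ 2 : ℝ) : ℂ) := by
    rw [inner_self_eq_norm_sq_to_K]; push_cast; rfl
  rw [L2.inner_def] at h
  have e : ∀ x, (inner ℂ (u x) (u x) : ℂ) = ((‖u x‖ ^ 2 : ℝ) : ℂ) := fun x => by
    rw [inner_self_eq_norm_sq_to_K]; push_cast; rfl
  simp only [e] at h
  rw [integral_complex_ofReal] at h
  exact (Complex.ofReal_injective h).symm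

theorem integrable_norm_sq {g : Space d → ℂ} (hg : Continuous g) (hgc : HasCompactSupport g) :
    Integrable fun x => ‖g x‖ ^ 2 := by
  have h1 : Continuous fun x => ‖g x‖ ^ 2 := by fun_prop
  have h2 : HasCompactSupport fun x => ‖g x‖ ^ 2 :=
    HasCompactSupport.comp_left (g := fun z : ℂ => ‖z‖ ^ 2) hgc (by simp)
  exact h1.integrable_of_hasCompactSupport h2

/-- Pairing with a bounded multiplier. -/
theorem re_integral_weighted_le {a : Space d → ℂ} (ha : Continuous a) {c : ℝ}
    (hac : ∀ᵐ x, ‖a x‖ ≤ c) (u f : L2 d) :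
    Integrable (fun x => a x * conj (u x) * f x) ∧
      (∫ x, a x * conj (u x) * f x).re ≤ c * ‖u‖ * ‖f‖ := by
  have hu := Lp.memLp u
  have hbd : ∀ᵐ x, ‖conj (a x) * u x‖ ≤ c * ‖u x‖ := by
    filter_upwards [hac] with x hx
    rw [norm_mul, RCLike.norm_conj]
    gcongr
  have hv : MemLp (fun x => conj (a x) * u x) 2 volume := by
    refine MemLp.of_le_mul hu ?_ hbd
    exact ((Complex.continuous_conj.comp ha).aestronglyMeasurable).mul hu.1
  have hvn : ‖hv.toLp _‖ ≤ c * ‖u‖ := by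
    refine Lp.norm_le_mul_norm_of_ae_le_mul ?_
    filter_upwards [hv.coeFn_toLp, hbd] with x h1 h2
    rw [h1]; exact h2
  have hin : (fun x => (inner ℂ (hv.toLp _ x) (f x) : ℂ)) =ᵐ[volume]
      fun x => a x * conj (u x) * f x := by
    filter_upwards [hv.coeFn_toLp] with x h1
    rw [h1]
    simp
    ring
  refine ⟨(L2.integrable_inner (𝕜 := ℂ) (hv.toLp _) f).congr hin, ?_⟩
  rw [← integral_congr_ae hin, ← L2.inner_def]
  calc (inner ℂ (hv.toLp _) f : ℂ).re ≤ ‖(inner ℂ (hv.toLp _) f : ℂ)‖ := Complex.re_le_norm _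
    _ ≤ ‖hv.toLp _‖ * ‖f‖ := norm_inner_le_norm _ _
    _ ≤ c * ‖u‖ * ‖f‖ := by gcongr

/-- The lower bound on `H_{iβ} - (E - iτ)`, before normalizing the constant. -/
theorem VirialData.lower_bound (hχ : VirialData s q E μ α γ χ χt) (hχ₁ : IsStep χ₁)
    (hd : 1 ≤ d) (hs0 : 0 < s) (hs1 : s ≤ 1) (hq : LongRange s q) (hα : 0 < α) (hγ : 0 < γ)
    (hR0 : 0 < R) (hR : ∀ x ∈ radialSupport d χt, stepAt χ₁ s R (‖x‖ ^ (2 * s)) = 1)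
    {β₀ ℓ : ℝ} (hβ₀ : 0 < β₀) (hℓ : 0 < ℓ) {Q : ℂ → Space d → ℂ}
    (hQ : IsAnalyticExtension χ₁ s R q β₀ ℓ Q) :
    ∃ β₁ > (0 : ℝ), ∃ K₀ > (0 : ℝ), ∃ K₁ > (0 : ℝ), ∀ β ∈ Ioo (0 : ℝ) β₁, ∀ ħ : ℝ,
      ∀ τ ≤ β * μ, ∀ u f : L2 d,
      (u, f) ∈ distortedGraph χ₁ s R (Q (Complex.I * β)) ħ (Complex.I * β) →
      (β * γ - K₀ * (β ^ 2 + ħ ^ 2)) * ‖u‖ ≤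
        (1 + K₁ * β) * ‖f - ((E : ℂ) - Complex.I * τ) • u‖ := by
  obtain ⟨M, hM, b₁, hb₁, C, hC, r₀, hr₀, hone, hw⟩ := hχ.weight_bounds hχ₁ hd hs0 hs1 hR0 hq
    (R := R)
  obtain ⟨b₂, hb₂, CQ, hCQ, hexp⟩ := hQ.expansion hq hs0 hs1 hβ₀ hℓ
  obtain ⟨Cq, hCq, hgr⟩ := hq.growth hs0 hs1
  set W₀ := r₀ ^ (-(2 * s)) with hW₀
  have hW₀0 : 0 < W₀ := Real.rpow_pos_of_pos hr₀ _
  set K₂ := CQ * (2 * C + 1) + M * (1 + W₀ * (Cq + CQ + |E|)) with hK₂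
  set K₃ := 29 * C ^ 2 + 2 * C ^ 3 with hK₃
  have hK₂0 : 0 < K₂ := by positivity
  have hK₃0 : 0 < K₃ := by positivity
  -- The threshold α/γ makes βγ ≤ α, so the forbidden region never gives the smaller bound.
  refine ⟨min (min b₁ b₂) (min 1 (α / γ)), by positivity, K₂ + K₃, by positivity, C, hC, ?_⟩
  rintro β ⟨hβ0, hβ⟩ ħ τ hτ
  simp only [lt_min_iff] at hβ
  obtain ⟨⟨h1, h2⟩, h3, h4⟩ := hβ
  rw [lt_div_iff₀ hγ] at h4
  obtain ⟨hreg, hwb⟩ := hw β ⟨hβ0, h1⟩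
  have hq1 := hexp β ⟨hβ0, h2⟩
  set z : ℂ := (E : ℂ) - Complex.I * τ with hz
  suffices hsub : ∀ (u f : L2 d) (φ : Space d → ℂ), ContDiff ℝ ∞ φ → HasCompactSupport φ →
      (u : Space d → ℂ) =ᵐ[volume] φ → (f : Space d → ℂ) =ᵐ[volume]
        distortedExpr χ₁ s R (Q (Complex.I * β)) ħ (Complex.I * β) φ →
      (β * γ - (K₂ + K₃) * (β ^ 2 + ħ ^ 2)) * ‖u‖ ≤ (1 + C * β) * ‖f - z • u‖ by
    intro u f huf
    rw [distortedGraph] at huf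
    -- The inequality is a closed condition on pairs (u, f), so it passes from test functions to the
    -- closure of the graph.
    have hcl : IsClosed {p : L2 d × L2 d | (β * γ - (K₂ + K₃) * (β ^ 2 + ħ ^ 2)) * ‖p.1‖ ≤
        (1 + C * β) * ‖p.2 - z • p.1‖} :=
      isClosed_le (continuous_const.mul continuous_fst.norm)
        (continuous_const.mul (continuous_snd.sub (continuous_fst.const_smul z)).norm)
    have hmem := hcl.closure_subset_iff.2 (fun p hp => by
      obtain ⟨φ, h5, h6, h7, h8⟩ := hp
      rw [mem_ofPred_eq]
      exact hsub p.1 p.2 φ h5 h6 h7 h8) huf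
    rw [mem_ofPred_eq] at hmem
    exact hmem
  intro u f φ hφ hφc hu hf
  have : Nonempty (Fin d) := ⟨⟨0, hd⟩⟩
  have hae : ∀ᵐ x : Space d, x ≠ 0 := by
    rw [ae_iff]; simp
  have hwx := fun (x : Space d) (hx : x ≠ 0) => hwb ‖x‖ (norm_pos_iff.2 hx) fun hne =>
    (hχ.virial hs0 hs1 hR hx hne).1
  have hacont := hχ.contDiff_weight (d := d) (s := s) (R := R) (M := M) (β := β) hχ₁ hr₀ hone
  set a : ℝ → ℂ := weight χ₁ χ s R M β with ha
  have hc0 : 0 ≤ 1 + C * β := by positivity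
  obtain ⟨iG, hG⟩ := re_integral_weighted_le hacont.continuous
    (by filter_upwards [hae] with x hx; exact (hwx x hx).2.1) u (f - z • u)
  obtain ⟨iK, iD, eD⟩ := hreg.integral_form hd hχ₁ hs0 hs1 hR0 hφ hφc hacont
    (fun r hr => hχ.hasDerivAt_weight (M := M) (β := β) hχ₁ hr)
  set K : Space d → ℂ := fun x => formDensity (radCoeff χ₁ s R (Complex.I * β) ‖x‖)
    (angCoeff χ₁ s R (Complex.I * β) ‖x‖) (drift d χ₁ s R (Complex.I * β) ‖x‖) (a ‖x‖)
    (weight' χ₁ χ s R M β ‖x‖) (φ x) (radialDeriv φ x) (gradSq φ x) with hK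
  set V : Space d → ℂ := fun x =>
    -(1 / 2) * radiusPow χ₁ s R (Complex.I * β) ‖x‖ + Q (Complex.I * β) x - z with hV
  have hsplit : (fun x => a ‖x‖ * conj (u x) * (f - z • u) x) =ᵐ[volume] fun x =>
      (ħ ^ 2 / 2 : ℂ) * (a ‖x‖ * conj (φ x) *
        distortedNegLaplacian χ₁ s R (Complex.I * β) φ x)
      + a ‖x‖ * V x * ((‖φ x‖ ^ 2 : ℝ) : ℂ) := by
    filter_upwards [hu, hf, Lp.coeFn_sub f (z • u), Lp.coeFn_smul z u] with x e1 e2 e3 e4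
    have e5 : conj (φ x) * φ x = ((‖φ x‖ ^ 2 : ℝ) : ℂ) := by
      rw [Complex.conj_mul']; push_cast; rfl
    rw [e3, Pi.sub_apply, e4, Pi.smul_apply, e2, e1, smul_eq_mul, distortedExpr, hV, ← e5]
    ring
  have iD' := iD.const_mul (ħ ^ 2 / 2 : ℂ)
  -- No regularity of `Q` in x is available; integrability of the potential term follows by
  -- subtracting the kinetic term from the total.
  have iV : Integrable fun x => a ‖x‖ * V x * ((‖φ x‖ ^ 2 : ℝ) : ℂ) := by
    refine ((iG.congr hsplit).sub iD').congr (Eventually.of_forall fun x => ?_)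
    simp
  have iK' := iK.const_mul (ħ ^ 2 / 2 : ℂ)
  have hint : ∫ x, a ‖x‖ * conj (u x) * (f - z • u) x =
      ∫ x, ((ħ ^ 2 / 2 : ℂ) * K x + a ‖x‖ * V x * ((‖φ x‖ ^ 2 : ℝ) : ℂ)) := by
    rw [integral_congr_ae hsplit, integral_add iD' iV, integral_add iK' iV,
      integral_const_mul, integral_const_mul, eD]
  have iφ : Integrable fun x => ‖φ x‖ ^ 2 := integrable_norm_sq hφ.continuous hφc
  have hpoint : ∀ᵐ x, (β * γ - (K₂ + K₃) * (β ^ 2 + ħ ^ 2)) * ‖φ x‖ ^ 2 ≤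
      ((ħ ^ 2 / 2 : ℂ) * K x + a ‖x‖ * V x * ((‖φ x‖ ^ 2 : ℝ) : ℂ)).re := by
    filter_upwards [hae] with x hx
    have hr : 0 < ‖x‖ := norm_pos_iff.2 hx
    obtain ⟨w0, w1, w2, w3, w4, w5, w6, w7, w8, w9⟩ := hwx x hx
    have hχI := hχ.mem_Icc ‖x‖ hr.le
    have k1 : -K₃ * ‖φ x‖ ^ 2 ≤ (K x).re :=
      formDensity_lower hχI.1 hχI.2 w7 (norm_radialDeriv_sq_le φ hx) w8 w9 w4 w6 w5 w3 w2
    have k2 : β * γ - K₂ * β ^ 2 ≤ (a ‖x‖ * V x).re := by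
      have hv : χ ‖x‖ ^ 2 ≠ 1 → _ := fun h0 => (hχ.virial hs0 hs1 hR hx h0).2
      rw [← stretchAmp] at hv
      have hν : tailShift χ₁ s R M β ‖x‖ = -2 * β * stretchAmp χ₁ s R ‖x‖ +
          M * β ^ 2 * ‖x‖ ^ (-(2 * s)) := by rw [tailShift]
      rw [hK₂]
      refine weighted_potential_lower (Qx := Q (Complex.I * β) x) (t := χ ‖x‖ ^ 2)
        (h := stretchAmp χ₁ s R ‖x‖) (κ := amp χ₁ s R ‖x‖ * ‖x‖ * radialDeriv q x)
        (H := C) (W₀ := W₀) (E := E)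
        (s := s) (W := ‖x‖ ^ (-(2 * s)))
        (rs := ‖x‖ ^ (2 * s)) (v := amp χ₁ s R ‖x‖) (q := q x) (τ := τ) (α := α) (μ := μ)
        hβ0 h3.le (sq_nonneg _) (pow_le_one₀ hχI.1 hχI.2) hM.le (by positivity) hCq.le hCQ.le
        hC.le hW₀0.le hν ?_ ?_ (hq1 x hx) ?_ h4.le ?_ w0 ?_
        (hgr x) hτ
      · rw [ha, weight]
      · simp only [hV, hz]
        rw [radiusPow_eq hs1 _ hr, powRatio]
        ring
      · intro h0
        refine hχ.forbidden_of_ne ?_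
        rintro h
        exact h0 (by rw [h]; norm_num)
      · intro h0
        refine ⟨?_, hv h0⟩
        refine Real.rpow_le_rpow_of_nonpos hr₀ ?_ (by linarith)
        by_contra hlt
        exact h0 (by rw [hone _ ⟨hr.le, not_le.1 hlt⟩]; norm_num)
      · rw [← Real.rpow_add hr]; simp
    have e1 : ((ħ ^ 2 / 2 : ℂ) * K x + a ‖x‖ * V x * ((‖φ x‖ ^ 2 : ℝ) : ℂ)).re =
        ħ ^ 2 / 2 * (K x).re + (a ‖x‖ * V x).re * ‖φ x‖ ^ 2 := by
      rw [Complex.add_re, Complex.re_mul_ofReal,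
        show (ħ ^ 2 / 2 : ℂ) = ((ħ ^ 2 / 2 : ℝ) : ℂ) by push_cast; rfl, Complex.re_ofReal_mul]
    rw [e1]
    have e2 : ħ ^ 2 / 2 * (-K₃ * ‖φ x‖ ^ 2) ≤ ħ ^ 2 / 2 * (K x).re := by gcongr
    have e3 : (β * γ - K₂ * β ^ 2) * ‖φ x‖ ^ 2 ≤ (a ‖x‖ * V x).re * ‖φ x‖ ^ 2 := by gcongr
    have e4 : 0 ≤ (K₂ * ħ ^ 2 + K₃ * β ^ 2 + K₃ * ħ ^ 2 / 2) * ‖φ x‖ ^ 2 := by positivity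
    linarith
  have hmono := integral_mono_ae (iφ.const_mul _) (iK'.add iV).re hpoint
  rw [integral_const_mul] at hmono
  have hre : ∫ x, RCLike.re ((((fun x => (ħ ^ 2 / 2 : ℂ) * K x) +
      fun x => a ‖x‖ * V x * ((‖φ x‖ ^ 2 : ℝ) : ℂ)) x)) =
      (∫ x, ((ħ ^ 2 / 2 : ℂ) * K x + a ‖x‖ * V x * ((‖φ x‖ ^ 2 : ℝ) : ℂ))).re :=
    integral_re (iK'.add iV)
  rw [hre, ← hint] at hmono
  have hnorm : ∫ x, ‖φ x‖ ^ 2 = ‖u‖ ^ 2 := by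
    rw [L2_norm_sq_eq]
    refine integral_congr_ae ?_
    filter_upwards [hu] with x hx
    rw [hx]
  rw [hnorm] at hmono
  have hfin := hmono.trans hG
  rcases (norm_nonneg u).eq_or_lt with h0 | h0
  · rw [← h0, mul_zero]; positivity
  · refine le_of_mul_le_mul_right ?_ h0
    calc _ = (β * γ - (K₂ + K₃) * (β ^ 2 + ħ ^ 2)) * ‖u‖ ^ 2 := by ring
      _ ≤ _ := hfin
      _ = _ := by ring

end

end Repulsive

end

end

/-! ### Choice of constants and exclusion of the eigenvalue. -/

theorem corollary2p2 (d : ℕ) (hd : 1 ≤ d) (s : ℝ) (hs0 : 0 < s) (hs1 : s ≤ 1)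
    (χ₁ : ℝ → ℝ) (hχ₁ : Repulsive.IsStep χ₁)
    (q : Repulsive.Space d → ℝ) (hq : Repulsive.LongRange s q)
    (E μ α γ : ℝ) (hμ : 0 < μ) (hα : 0 < α) (hγ : 0 < γ)
    (χ χt : ℝ → ℝ) (hχ : Repulsive.VirialData s q E μ α γ χ χt)
    (R : ℝ) (hR0 : 0 < R)
    (hR : ∀ x ∈ Repulsive.radialSupport d χt, Repulsive.stepAt χ₁ s R (‖x‖ ^ (2 * s)) = 1)
    (β₀ ℓ : ℝ) (hβ₀ : 0 < β₀) (hℓ : 0 < ℓ)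
    (Q : ℂ → Repulsive.Space d → ℂ) (hQ : Repulsive.IsAnalyticExtension χ₁ s R q β₀ ℓ Q) :
    ∃ c > 0, ∃ K > 0, ∃ βc > 0, βc ≤ min ℓ β₀ ∧ ∃ C : ℝ → ℝ → ℝ,
      (∀ β ∈ Set.Ioo 0 βc, ∀ ħ > 0,
        |C β ħ - (1 - c * β) * min α (β * γ)| ≤ K * (β ^ 2 + ħ ^ 2)) ∧
      (∀ β ∈ Set.Ioo 0 βc, ∀ ħ > 0, ∀ u f : Repulsive.L2 d,
        (u, f) ∈ Repulsive.distortedGraph χ₁ s R (Q (Complex.I * β)) ħ (Complex.I * β) →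
          C β ħ * ‖u‖ ≤ ‖f - ((E : ℂ) - Complex.I * β * μ) • u‖) ∧
      ∀ β ∈ Set.Ioo 0 βc, ∃ ħ₀ > 0, ∀ ħ ∈ Set.Ioo 0 ħ₀,
        0 < C β ħ ∧
        ∀ β' ∈ Set.Ico β βc,
          ¬ Repulsive.IsEigenvalue
            (Repulsive.distortedGraph χ₁ s R (Q (Complex.I * β')) ħ (Complex.I * β'))
            ((E : ℂ) - Complex.I * μ * β) := by
  obtain ⟨β₁, hβ₁, K₀, hK₀, K₁, hK₁, hmain⟩ := hχ.lower_bound hχ₁ hd hs0 hs1 hq hα hγ hR0 hR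
    hβ₀ hℓ hQ
  -- Dividing by 1 + K₁β costs at most K₁β·βγ, which the second summand absorbs.
  set K := K₀ + K₁ * γ with hK
  have hK0 : 0 < K := by positivity
  -- Below α/γ the minimum of α and βγ is βγ; the bounds 1/4 and γ/(4K) keep (1 − β)βγ − Kβ² at or
  -- above βγ/2.
  set βc := min (min β₁ (min ℓ β₀)) (min (1 / 4) (min (α / γ) (γ / (4 * K)))) with hβc
  have hbnd : ∀ β ∈ Ioo 0 βc, β < β₁ ∧ β < 1 / 4 ∧ β * γ ≤ α ∧ K * β ≤ γ / 4 := by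
    rintro β ⟨h0, h⟩
    simp only [hβc, lt_min_iff] at h
    obtain ⟨⟨h1, -⟩, h2, h3, h4⟩ := h
    rw [lt_div_iff₀ (by positivity)] at h3 h4
    exact ⟨h1, h2, h3.le, by linarith⟩
  have key : ∀ β ∈ Ioo 0 βc, ∀ ħ τ : ℝ, τ ≤ β * μ → ∀ u f : Repulsive.L2 d,
      (u, f) ∈ Repulsive.distortedGraph χ₁ s R (Q (Complex.I * β)) ħ (Complex.I * β) →
      ((1 - 1 * β) * min α (β * γ) - K * (β ^ 2 + ħ ^ 2)) * ‖u‖ ≤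
        ‖f - ((E : ℂ) - Complex.I * τ) • u‖ := by
    intro β hβ ħ τ hτ u f huf
    obtain ⟨h1, h2, h3, h4⟩ := hbnd β hβ
    have hβ0 := hβ.1
    have hm := hmain β ⟨hβ0, h1⟩ ħ τ hτ u f huf
    rw [min_eq_right h3]
    set X := ‖f - ((E : ℂ) - Complex.I * τ) • u‖ with hX
    have hX0 : 0 ≤ X := norm_nonneg _
    have hu0 := norm_nonneg u
    -- A nonpositive constant makes the claim trivial; positivity is what allows multiplication by 1
    -- + K₁β to be estimated.
    rcases le_or_gt ((1 - 1 * β) * (β * γ) - K * (β ^ 2 + ħ ^ 2)) 0 with hneg | hpos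
    · exact (mul_nonpos_of_nonpos_of_nonneg hneg hu0).trans hX0
    · have hcmp : ((1 - 1 * β) * (β * γ) - K * (β ^ 2 + ħ ^ 2)) * (1 + K₁ * β) ≤
          β * γ - K₀ * (β ^ 2 + ħ ^ 2) := by
        have e1 : (1 - 1 * β) * (β * γ) - K * (β ^ 2 + ħ ^ 2) ≤ β * γ := by
          have : 0 ≤ K * (β ^ 2 + ħ ^ 2) := by positivity
          have : 0 ≤ β * (β * γ) := by positivity
          linarith
        have e2 : ((1 - 1 * β) * (β * γ) - K * (β ^ 2 + ħ ^ 2)) * (K₁ * β) ≤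
            β * γ * (K₁ * β) := by gcongr
        have e3 : 0 ≤ K₁ * γ * ħ ^ 2 := by positivity
        have e4 : 0 ≤ β * (β * γ) := by positivity
        rw [hK] at *
        linarith
      refine le_of_mul_le_mul_right ?_ (show 0 < 1 + K₁ * β by positivity)
      calc _ = ((1 - 1 * β) * (β * γ) - K * (β ^ 2 + ħ ^ 2)) * (1 + K₁ * β) * ‖u‖ := by ring
        _ ≤ (β * γ - K₀ * (β ^ 2 + ħ ^ 2)) * ‖u‖ := by gcongr
        _ ≤ _ := hm
        _ = _ := mul_comm _ _
  -- The choice c = 1 is a convenience: cβ·βγ is of second order. The constant is defined so that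
  -- its distance from the main term is exactly K(β² + ħ²).
  refine ⟨1, one_pos, K, hK0, βc, by positivity,
    (min_le_left _ _).trans (min_le_right _ _),
    fun β ħ => (1 - 1 * β) * min α (β * γ) - K * (β ^ 2 + ħ ^ 2), ?_, ?_, ?_⟩
  · intro β _ ħ _
    rw [sub_sub_cancel_left, abs_neg, abs_of_nonneg (by positivity)]
  · intro β hβ ħ _ u f huf
    have := key β hβ ħ (β * μ) le_rfl u f huf
    rwa [Complex.ofReal_mul, ← mul_assoc] at this
  · intro β hβ
    have hβ0 := hβ.1
    -- This yields Kħ² ≤ βγ/4 ≤ β'γ/4, so one ħ₀ serves all β' ≥ β.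
    refine ⟨min 1 (β * γ / (4 * K)), by positivity, ?_⟩
    rintro ħ ⟨hħ0, hħ⟩
    simp only [lt_min_iff] at hħ
    obtain ⟨hħ1, hħ2⟩ := hħ
    rw [lt_div_iff₀ (by positivity)] at hħ2
    have hħK : K * ħ ^ 2 ≤ β * γ / 4 := by
      calc K * ħ ^ 2 = K * ħ * ħ := by ring
        _ ≤ K * ħ * 1 := by gcongr
        _ ≤ _ := by linarith
    have hpos : ∀ β' ∈ Ico β βc,
        0 < (1 - 1 * β') * min α (β' * γ) - K * (β' ^ 2 + ħ ^ 2) := by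
      intro β' hβ'
      have hβ'0 : 0 < β' := hβ0.trans_le hβ'.1
      obtain ⟨h1, h2, h3, h4⟩ := hbnd β' ⟨hβ'0, hβ'.2⟩
      rw [min_eq_right h3]
      have e1 : 3 / 4 * (β' * γ) ≤ (1 - 1 * β') * (β' * γ) := by
        gcongr
        linarith
      have e2 : K * β' * β' ≤ γ / 4 * β' := by gcongr
      have e3 : β * γ ≤ β' * γ := by
        have := hβ'.1
        gcongr
      have e4 : 0 < β * γ := by positivity
      linarith
    refine ⟨hpos β ⟨le_rfl, hβ.2⟩, ?_⟩
    rintro β' hβ' ⟨u, hu, hmem⟩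
    have hβ'0 : 0 < β' := hβ0.trans_le hβ'.1
    -- Here τ = μβ ≤ β'μ: the energy is held fixed while the distortion grows to β'.
    have := key β' ⟨hβ'0, hβ'.2⟩ ħ (μ * β) (by
      have := hβ'.1
      rw [mul_comm]
      gcongr) u _ hmem
    rw [Complex.ofReal_mul, ← mul_assoc, sub_self, norm_zero] at this
    have h2 := mul_pos (hpos β' hβ') (norm_pos_iff.2 hu)
    linarith
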